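/- For an integer $k\ge 1$ let $\mathfrak S(k)=0$ if $k$ is odd, and \[ \mathfrak S(k)=2C_2\prod_{\substack{p\mid k\\ p>2}}\frac{p-1}{p-2}\quad\text{if $k$ is even},\qquad C_2=\prod_{p>2}\Bigl(1-\frac1{(p-1)^2}\Bigr), \] where $p$ denotes primes. For real $x\geq 1$ let $S(x)=\sum_{1\le k\le x}(x-k)\,\mathfrak S(k)$, and define $E(x)$ by \[ S(x)=\tfrac12x^2-\tfrac12x\log x+\tfrac12(1-\gamma-\log 2\pi)\,x+E(x), \] where $\gamma$ is the Euler--Mascheroni constant. Then, unconditionally, $E(x)=\Omega_{\pm}(x^{1/4})$ as $x\to\infty$; that is, \[ \limsup_{x\to\infty}\frac{E(x)}{x^{1/4}}>0\qquad\text{and}\qquad \liminf_{x\to\infty}\frac{E(x)}{x^{1/4}}<0. \] -/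

import Mathlib

open Filter

noncomputable section

/-- The odd primes. -/
abbrev OddPrime : Type := {p : ℕ // p.Prime ∧ 2 < p}

/-- The twin prime constant `C₂ = ∏_{p > 2} (1 - 1 / (p - 1) ^ 2)`. -/
def twinPrimeConst : ℝ := ∏' p : OddPrime, (1 - 1 / (((p : ℕ) : ℝ) - 1) ^ 2)

/-- The infinite product defining `C₂` converges (absolutely). -/
theorem multipliable_twinPrimeConst :
    Multipliable (fun p : OddPrime => (1 - 1 / (((p : ℕ) : ℝ) - 1) ^ 2)) := by
  have h1 : Summable (fun n : ℕ => 1 / ((n : ℝ) - 1) ^ 2) := by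
    rw [← summable_nat_add_iff 1]
    simp
  have h2 : Summable (fun p : OddPrime => 1 / (((p : ℕ) : ℝ) - 1) ^ 2) :=
    h1.comp_injective Subtype.val_injective
  have h3 := Real.multipliable_one_add_of_summable h2.neg
  simpa [sub_eq_add_neg] using h3

/-- The singular series of the prime-pair conjecture, for an integer `k ≥ 1`:
`𝔖(k) = 2 C₂ ∏_{p ∣ k, p > 2} (p - 1) / (p - 2)` if `k` is even, and `𝔖(k) = 0` if `k` is odd.
(The value at `k = 0` plays no role.) -/
def singularSeries (k : ℕ) : ℝ :=
  if Even k then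
    2 * twinPrimeConst * ∏ p ∈ k.primeFactors.filter (fun p => 2 < p), ((p : ℝ) - 1) / ((p : ℝ) - 2)
  else 0

/-- The Cesàro mean `S(x) = ∑_{1 ≤ k ≤ x} (x - k) 𝔖(k)`. -/
def cesaroMean (x : ℝ) : ℝ :=
  ∑ k ∈ Finset.Icc 1 ⌊x⌋₊, (x - (k : ℝ)) * singularSeries k

/-- The error term `E(x)`, defined by
`S(x) = x² / 2 - (x log x) / 2 + (1 - γ - log 2π) x / 2 + E(x)`. -/
def cesaroError (x : ℝ) : ℝ :=
  cesaroMean x - (1 / 2 * x ^ 2 - 1 / 2 * x * Real.log x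
    + 1 / 2 * (1 - Real.eulerMascheroniConstant - Real.log (2 * Real.pi)) * x)

/-- `f(x) = Ω_±(g(x))` as `x → ∞`, for `g` eventually positive: `limsup f / g > 0` and
`liminf f / g < 0`, where the limits superior and inferior are taken in `[-∞, ∞]`. -/
def IsOmegaPlusMinus (f g : ℝ → ℝ) : Prop :=
  0 < limsup (fun x => ((f x / g x : ℝ) : EReal)) atTop ∧
    liminf (fun x => ((f x / g x : ℝ) : EReal)) atTop < 0

end

/-!
The Mellin transform `∫₁^∞ E(x) x ^ (-w - 1) dx` of the error term is a quotient `D(w) / Z(2w)`, with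
`Z(s) = (s - 1) ζ(s)` and `D` holomorphic for `re w > 0`. Indeed the Dirichlet series of the singular
series is an Euler product, and it equals, up to elementary factors,
`ζ(w - 1) ζ(w) Q(w) / ζ(2w)` at `s = w - 1`, where `Q(w) = ∏_p (1 + a_p / (p ^ w + 1))` converges
absolutely for `re w > 0` (`tsum_singularFactor`). The main term of `S(x)` is exactly what cancels the
simple pole of the transform at `w = 2` and the double pole at `w = 1` (`errorNumer_two`,
`hasDerivAt_errorNumer_one`); so only the zeros of `ζ(2w)` can produce poles
(`exists_continuation_mellin_cesaroError`).

Suppose that `E(x) ≤ c x ^ (1/4)` eventually, for every `c > 0`. By Landau's theorem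
(`landau_complexMGF`) the transform of the nonnegative function `c x ^ (1/4) + C - E(x)` converges for
`re w > 1/4`, because `ζ(2σ) (2σ - 1) ≠ 0` for real `σ > 0`. Comparing it on the line `re w = 1/4` with
its value at the real point of the same abscissa bounds `D(w₀)` by a multiple of `c` at each zero `w₀`
of `ζ(2w)` on this line, and `D(w₀) = 0` to the right of it. Letting `c → 0` shows that `D` vanishes at
all zeros of `ζ(2w)` with `re w ≥ 1/4` (`eq_zero_of_forall_eventually_le`).

This is impossible, with no hypothesis on the zeros of zeta. At a zero `ρ = 2w` of zeta the vanishing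
of `D` forces `ζ(w - 1) ζ(w) Q(w) = 0`. The first factor is nonzero by the functional equation. If
`re w` is rational, `Q(w) ≠ 0` by unique factorization, since a zero would give
`p ^ (1 - re w) = p - 2` (`one_add_correctionTerm_ne_zero`). Hence `ζ(ρ / 2) = 0`, so
`ζ(1 - ρ / 2) = 0`. The map `ρ ↦ 1 - ρ / 2` preserves the strip `1/2 ≤ re ρ ≤ 3/4` and rational real
parts, and its iterates tend to `2/3`; starting from a zero on the critical line one gets
`ζ(2/3) = 0`. But `ζ` has no zeros on `(0, 1)` (`riemannZeta_ofReal_ne_zero`). The same argument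
applies to `-E`.

The existence of a zero on the critical line (`exists_riemannZeta_half_add_eq_zero`) is Hardy's
theorem. With `θ(z) = ∑ exp (-π n² z)`, the function `θ(z) - 1 - z ^ (-1/2)` has Mellin transform
`2 ξ(2s)` for `0 < re s < 1/2`, `ξ` being the completed zeta function; it is real and even on the
critical line. Inversion along the ray `arg z = β` gives the integrals of `cosh (β t)` against it. If
there were no zero, it would have constant sign there, and both signs contradict the behaviour of these
integrals as `β → π/2`, where `θ` vanishes to higher order (`norm_jacobiTheta_neg_exp_le`).
-/

/-! ### The theta function on the right half plane -/

open Complex in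
theorem norm_jacobiTheta_sub_one_le_div {τ : ℂ} (hτ : 0 < τ.im) :
    ‖jacobiTheta τ - 1‖ ≤ 2 / (Real.exp (Real.pi * τ.im) - 1) := by
  refine (norm_jacobiTheta_sub_one_le hτ).trans (le_of_eq ?_)
  have h1 : 1 < Real.exp (Real.pi * τ.im) := by
    rw [Real.one_lt_exp_iff]; positivity
  have h2 : Real.exp (-Real.pi * τ.im) = (Real.exp (Real.pi * τ.im))⁻¹ := by
    rw [← Real.exp_neg]; ring_nf
  rw [h2]
  have h3 : Real.exp (Real.pi * τ.im) - 1 ≠ 0 := by linarith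
  have h4 : Real.exp (Real.pi * τ.im) ≠ 0 := by linarith
  have h5 : 1 - (Real.exp (Real.pi * τ.im))⁻¹ ≠ 0 := by
    have : (Real.exp (Real.pi * τ.im))⁻¹ < 1 := inv_lt_one_of_one_lt₀ h1
    linarith
  field_simp

theorem norm_jacobiTheta_sub_one_lt_inv {τ : ℂ} (hτ : 0 < τ.im) :
    ‖jacobiTheta τ - 1‖ < 1 / τ.im := by
  refine (norm_jacobiTheta_sub_one_le_div hτ).trans_lt ?_
  have hp : 0 < Real.pi * τ.im := by positivity
  have h1 := Real.add_one_lt_exp hp.ne'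
  have h3 : (3 : ℝ) < Real.pi := Real.pi_gt_three
  rw [div_lt_div_iff₀ (by linarith) hτ]
  nlinarith

theorem norm_jacobiTheta_sub_one_le_inv_sq {τ : ℂ} (hτ : 0 < τ.im) :
    ‖jacobiTheta τ - 1‖ ≤ 1 / τ.im ^ 2 := by
  refine (norm_jacobiTheta_sub_one_le_div hτ).trans ?_
  have hp : 0 < Real.pi * τ.im := by positivity
  have h1 := Real.quadratic_le_exp_of_nonneg hp.le
  have h3 : (3 : ℝ) < Real.pi := Real.pi_gt_three
  have h4 : 9 * τ.im ^ 2 ≤ (Real.pi * τ.im) ^ 2 := by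
    rw [mul_pow]; gcongr; nlinarith
  have h5 : 0 < τ.im ^ 2 := by positivity
  rw [div_le_div_iff₀ (by linarith) h5]
  nlinarith

/-- The involution `z ↦ 1 / z` of the right half plane acting on `θ(z) = ∑ exp (-π n² z)`. -/
theorem jacobiTheta_I_mul {z : ℂ} (hz : 0 < z.re) :
    jacobiTheta (Complex.I * z) = 1 / z ^ (1 / 2 : ℂ) * jacobiTheta (Complex.I * (1 / z)) := by
  have hz0 : z ≠ 0 := by rintro rfl; simp at hz
  have h := jacobiTheta₂_functional_equation 0 (Complex.I * z)
  have h1 : -Complex.I * (Complex.I * z) = z := by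
    rw [← mul_assoc, neg_mul, Complex.I_mul_I]; ring
  have h2 : -1 / (Complex.I * z) = Complex.I * (1 / z) := by
    field_simp; rw [Complex.I_sq]
  rw [h1, h2] at h
  simpa [jacobiTheta_eq_jacobiTheta₂] using h

/-- `θ(z) - 1 - z ^ (-1/2)`, where `θ(z) = ∑ exp (-π n² z)`: the theta function on the right half
plane with its behaviour at `∞` and at `0` removed. -/
noncomputable def thetaRem (z : ℂ) : ℂ := jacobiTheta (Complex.I * z) - 1 - 1 / z ^ (1 / 2 : ℂ)

theorem im_I_mul (z : ℂ) : (Complex.I * z).im = z.re := by simp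

theorem differentiableAt_thetaRem {z : ℂ} (hz : 0 < z.re) : DifferentiableAt ℂ thetaRem z := by
  have hz0 : z ≠ 0 := by rintro rfl; simp at hz
  unfold thetaRem
  have h1 : DifferentiableAt ℂ (fun z => jacobiTheta (Complex.I * z)) z := by
    have h := differentiableAt_jacobiTheta (τ := Complex.I * z) (by simpa using hz)
    exact h.comp z (by fun_prop)
  have h2 : DifferentiableAt ℂ (fun z : ℂ => 1 / z ^ (1 / 2 : ℂ)) z := by
    refine (differentiableAt_const _).div ?_ ?_
    · exact differentiableAt_id.cpow_const (Or.inl hz)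
    · simp [Complex.cpow_eq_zero_iff, hz0]
  exact (h1.sub_const 1).sub h2

theorem re_one_div {z : ℂ} : (1 / z).re = z.re / ‖z‖ ^ 2 := by
  rw [one_div, Complex.inv_re, Complex.normSq_eq_norm_sq]

theorem one_div_cpow_half {z : ℂ} (hz : 0 < z.re) :
    (1 / z) ^ (1 / 2 : ℂ) = 1 / z ^ (1 / 2 : ℂ) := by
  have h : z.arg ≠ Real.pi := by
    rw [Ne, Complex.arg_eq_pi_iff]
    rintro ⟨h, -⟩
    linarith
  rw [one_div z, Complex.inv_cpow _ _ h, one_div (z ^ _)]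

theorem thetaRem_eq_inv {z : ℂ} (hz : 0 < z.re) :
    thetaRem z = 1 / z ^ (1 / 2 : ℂ) * thetaRem (1 / z) := by
  have hz0 : z ≠ 0 := by rintro rfl; simp at hz
  unfold thetaRem
  rw [one_div_cpow_half hz, jacobiTheta_I_mul hz]
  have : z ^ (1 / 2 : ℂ) ≠ 0 := by simp [Complex.cpow_eq_zero_iff, hz0]
  field_simp
  ring

theorem norm_cpow_half (z : ℂ) : ‖z ^ (1 / 2 : ℂ)‖ = ‖z‖ ^ (1 / 2 : ℝ) := by
  have h : (1 / 2 : ℂ) = ((1 / 2 : ℝ) : ℂ) := by push_cast; ring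
  rw [h, Complex.norm_cpow_real]

theorem norm_thetaRem_le_of_one_le {z : ℂ} (hz : 0 < z.re) (h1 : 1 ≤ ‖z‖) :
    ‖thetaRem z‖ ≤ (‖z‖ / z.re + 1) * ‖z‖ ^ (-(1 / 2) : ℝ) := by
  have hz0 : z ≠ 0 := by rintro rfl; simp at hz
  have hn : 0 < ‖z‖ := norm_pos_iff.mpr hz0
  have h2 := norm_jacobiTheta_sub_one_lt_inv (τ := Complex.I * z) (by simpa using hz)
  rw [im_I_mul] at h2
  have h3 : ‖1 / z ^ (1 / 2 : ℂ)‖ = ‖z‖ ^ (-(1 / 2) : ℝ) := by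
    rw [norm_div, norm_one, norm_cpow_half, Real.rpow_neg hn.le, one_div]
  have h4 : ‖z‖⁻¹ ≤ ‖z‖ ^ (-(1 / 2) : ℝ) := by
    rw [← Real.rpow_neg_one]
    exact Real.rpow_le_rpow_of_exponent_le h1 (by norm_num)
  calc ‖thetaRem z‖ ≤ ‖jacobiTheta (Complex.I * z) - 1‖ + ‖1 / z ^ (1 / 2 : ℂ)‖ := norm_sub_le _ _
    _ ≤ 1 / z.re + ‖z‖ ^ (-(1 / 2) : ℝ) := by rw [h3]; gcongr
    _ = ‖z‖ / z.re * ‖z‖⁻¹ + ‖z‖ ^ (-(1 / 2) : ℝ) := by field_simp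
    _ ≤ ‖z‖ / z.re * ‖z‖ ^ (-(1 / 2) : ℝ) + ‖z‖ ^ (-(1 / 2) : ℝ) := by gcongr
    _ = _ := by ring

theorem norm_thetaRem_le_of_le_one {z : ℂ} (hz : 0 < z.re) (h1 : ‖z‖ ≤ 1) :
    ‖thetaRem z‖ ≤ ‖z‖ / z.re + 1 := by
  have hz0 : z ≠ 0 := by rintro rfl; simp at hz
  have hn : 0 < ‖z‖ := norm_pos_iff.mpr hz0
  have hre : 0 < (1 / z).re := by rw [re_one_div]; positivity
  have h2 := norm_thetaRem_le_of_one_le hre (by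
    rw [norm_div, norm_one]; exact (one_le_div hn).mpr h1)
  rw [thetaRem_eq_inv hz, norm_mul, norm_div, norm_one, norm_cpow_half]
  have h3 : ‖1 / z‖ = ‖z‖⁻¹ := by simp
  rw [h3, re_one_div] at h2
  have h5 : (‖z‖⁻¹) ^ (-(1 / 2) : ℝ) = ‖z‖ ^ (1 / 2 : ℝ) := by
    rw [Real.inv_rpow hn.le, Real.rpow_neg hn.le, inv_inv]
  rw [h5] at h2
  have h6 : 0 < ‖z‖ ^ (1 / 2 : ℝ) := by positivity
  calc 1 / ‖z‖ ^ (1 / 2 : ℝ) * ‖thetaRem (1 / z)‖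
      ≤ 1 / ‖z‖ ^ (1 / 2 : ℝ) * ((‖z‖⁻¹ / (z.re / ‖z‖ ^ 2) + 1) * ‖z‖ ^ (1 / 2 : ℝ)) := by gcongr
    _ = _ := by field_simp

/-- In a sector around the positive axis, `thetaRem` is `O(1)` at `0` and `O(|z| ^ (-1/2))` at
infinity. -/
theorem norm_thetaRem_mul_le {r : ℂ} {x κ : ℝ} (hx : 0 < x) (hκ : 0 < κ) (hr : κ ≤ r.re)
    (hr1 : ‖r‖ ≤ 1 / κ) :
    ‖thetaRem (r * x)‖ ≤
      (1 / κ ^ 2 + 1) * (1 / κ) * (if x ≤ 1 then 1 else x ^ (-(1 / 2) : ℝ)) := by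
  have hrn : κ ≤ ‖r‖ := hr.trans (Complex.re_le_norm r)
  have hκ1 : κ ≤ 1 := by
    by_contra! h
    have : 1 / κ < 1 := by rw [div_lt_one hκ]; exact h
    linarith
  have hre : (r * x).re = r.re * x := by simp
  have hno : ‖r * x‖ = ‖r‖ * x := by simp [abs_of_pos hx]
  have hre0 : 0 < (r * x).re := by rw [hre]; nlinarith
  have hq : ‖r * x‖ / (r * x).re ≤ 1 / κ ^ 2 := by
    rw [hre, hno, mul_div_mul_right _ _ hx.ne', div_le_div_iff₀ (by linarith) (by positivity)]
    have : ‖r‖ * κ ≤ 1 := by rwa [le_div_iff₀ hκ] at hr1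
    nlinarith
  have hk1 : 1 ≤ 1 / κ := by rw [le_div_iff₀ hκ]; linarith
  have hk2 : 0 < 1 / κ ^ 2 := by positivity
  have key : ∀ y : ℝ, κ * x ≤ y → 0 < y → y ^ (-(1 / 2) : ℝ) ≤ 1 / κ * x ^ (-(1 / 2) : ℝ) := by
    intro y hy hy0
    calc y ^ (-(1 / 2) : ℝ) ≤ (κ * x) ^ (-(1 / 2) : ℝ) :=
          Real.rpow_le_rpow_of_nonpos (by positivity) hy (by norm_num)
      _ = κ ^ (-(1 / 2) : ℝ) * x ^ (-(1 / 2) : ℝ) := Real.mul_rpow hκ.le hx.le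
      _ ≤ κ ^ (-1 : ℝ) * x ^ (-(1 / 2) : ℝ) := by
          gcongr ?_ * _
          exact Real.rpow_le_rpow_of_exponent_ge hκ hκ1 (by norm_num)
      _ = _ := by rw [Real.rpow_neg_one, one_div κ]
  have hpos : 0 < ‖r * x‖ := by rw [hno]; have : 0 < ‖r‖ := by linarith
                                positivity
  split_ifs with h
  · rcases le_total 1 ‖r * x‖ with h1 | h1
    · refine (norm_thetaRem_le_of_one_le hre0 h1).trans ?_
      have : ‖r * x‖ ^ (-(1 / 2) : ℝ) ≤ 1 := Real.rpow_le_one_of_one_le_of_nonpos h1 (by norm_num)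
      have h0 : 0 < ‖r * x‖ ^ (-(1 / 2) : ℝ) := by positivity
      calc _ ≤ (1 / κ ^ 2 + 1) * 1 := by gcongr
        _ ≤ _ := by nlinarith
    · refine (norm_thetaRem_le_of_le_one hre0 h1).trans ?_
      nlinarith
  · push Not at h
    rcases le_total 1 ‖r * x‖ with h1 | h1
    · refine (norm_thetaRem_le_of_one_le hre0 h1).trans ?_
      rw [mul_assoc]
      gcongr
      · exact key _ (by rw [hno]; gcongr) hpos
    · refine (norm_thetaRem_le_of_le_one hre0 h1).trans ?_
      have h3 : 1 ≤ ‖r * x‖ ^ (-(1 / 2) : ℝ) :=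
        Real.one_le_rpow_of_pos_of_le_one_of_nonpos hpos h1 (by norm_num)
      have h4 := key _ (by rw [hno]; gcongr) hpos
      rw [mul_assoc]
      calc _ ≤ (1 / κ ^ 2 + 1) := by linarith
        _ ≤ _ := by
          have : 1 ≤ 1 / κ * x ^ (-(1 / 2) : ℝ) := by linarith
          nlinarith

theorem jacobiTheta_I_mul_ofReal_im {x : ℝ} (hx : 0 < x) :
    (jacobiTheta (Complex.I * x)).im = 0 := by
  have h := hasSum_nat_jacobiTheta (τ := Complex.I * x) (by simpa using hx)
  have h2 := (Complex.hasSum_iff _ _).mp h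
  have h3 := h2.2
  have h4 : ∀ n : ℕ, (Complex.exp (Real.pi * Complex.I * ((n : ℂ) + 1) ^ 2 * (Complex.I * x))).im = 0 := by
    intro n
    have : Real.pi * Complex.I * ((n : ℂ) + 1) ^ 2 * (Complex.I * x)
      = ((-Real.pi * (n + 1) ^ 2 * x : ℝ) : ℂ) := by
      push_cast
      linear_combination (Real.pi * ((n : ℂ) + 1) ^ 2 * x) * Complex.I_mul_I
    rw [this, ← Complex.ofReal_exp, Complex.ofReal_im]
  simp only [h4] at h3
  have h5 := h3.unique hasSum_zero
  have h6 : ((jacobiTheta (Complex.I * x) - 1) / 2).im = (jacobiTheta (Complex.I * x)).im / 2 := by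
    rw [show ((jacobiTheta (Complex.I * x) - 1) / 2) = (((1 / 2 : ℝ)) : ℂ) * (jacobiTheta (Complex.I * x) - 1) by push_cast; ring,
      Complex.im_ofReal_mul]
    simp; ring
  rw [h6] at h5
  linarith

theorem one_div_ofReal_cpow_half {x : ℝ} (hx : 0 < x) :
    1 / (x : ℂ) ^ (1 / 2 : ℂ) = ((x ^ (-(1 / 2) : ℝ) : ℝ) : ℂ) := by
  have h : (1 / 2 : ℂ) = ((1 / 2 : ℝ) : ℂ) := by push_cast; ring
  rw [h, ← Complex.ofReal_cpow hx.le, Real.rpow_neg hx.le]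
  push_cast
  rw [one_div]

theorem thetaRem_ofReal_im {x : ℝ} (hx : 0 < x) : (thetaRem x).im = 0 := by
  unfold thetaRem
  rw [one_div_ofReal_cpow_half hx]
  simp [jacobiTheta_I_mul_ofReal_im hx]

/-- For `x ≥ 1` the term `x ^ (-1/2)` dominates `θ(x) - 1`; the functional equation gives the
rest. -/
theorem thetaRem_ofReal_re_neg {x : ℝ} (hx : 0 < x) : (thetaRem x).re < 0 := by
  have key : ∀ x : ℝ, 1 ≤ x → (thetaRem x).re < 0 := by
    intro x hx
    have hx0 : 0 < x := by linarith
    have h := norm_jacobiTheta_sub_one_lt_inv (τ := Complex.I * x) (by simpa using hx0)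
    rw [im_I_mul, Complex.ofReal_re] at h
    have h2 := (Complex.re_le_norm _).trans_lt h
    have h4 : 1 / x ≤ x ^ (-(1 / 2) : ℝ) := by
      rw [one_div, ← Real.rpow_neg_one]
      exact Real.rpow_le_rpow_of_exponent_le hx (by norm_num)
    unfold thetaRem
    rw [one_div_ofReal_cpow_half hx0, Complex.sub_re, Complex.ofReal_re]
    linarith
  rcases le_total 1 x with h | h
  · exact key x h
  · have h1 : (1 : ℝ) ≤ 1 / x := by rwa [le_div_iff₀ hx, one_mul]
    have h2 := key _ h1
    rw [thetaRem_eq_inv (z := (x : ℂ)) (by simpa using hx), one_div_ofReal_cpow_half hx,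
      Complex.re_ofReal_mul]
    push_cast at h2
    have : 0 < x ^ (-(1 / 2) : ℝ) := by positivity
    exact mul_neg_of_pos_of_neg this h2

/-- Splitting the theta series into even and odd indices. -/
theorem jacobiTheta_sub_one_add {τ : ℂ} (hτ : 0 < τ.im) :
    jacobiTheta (τ - 1) + jacobiTheta τ = 2 * jacobiTheta (4 * τ) := by
  have h1 := hasSum_nat_jacobiTheta hτ
  have h2 := hasSum_nat_jacobiTheta (τ := τ - 1) (by simpa using hτ)
  have h3 := hasSum_nat_jacobiTheta (τ := 4 * τ) (by simpa using hτ)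
  have hev : ∀ n : ℕ, Even n → Complex.exp (Real.pi * Complex.I * ((n : ℂ) + 1) ^ 2 * (τ - 1)) =
      - Complex.exp (Real.pi * Complex.I * ((n : ℂ) + 1) ^ 2 * τ) := by
    rintro n ⟨k, rfl⟩
    have : Real.pi * Complex.I * (((k + k : ℕ) : ℂ) + 1) ^ 2 * (τ - 1) =
        (Real.pi * Complex.I * (((k + k : ℕ) : ℂ) + 1) ^ 2 * τ + Real.pi * Complex.I)
        + ((-(2 * k ^ 2 + 2 * k + 1) : ℤ) : ℂ) * (2 * Real.pi * Complex.I) := by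
      push_cast; ring
    rw [this, Complex.exp_add, Complex.exp_int_mul_two_pi_mul_I, Complex.exp_add, Complex.exp_pi_mul_I]
    ring
  have hod : ∀ k : ℕ, Complex.exp (Real.pi * Complex.I * (((2 * k + 1 : ℕ) : ℂ) + 1) ^ 2 * (τ - 1)) +
      Complex.exp (Real.pi * Complex.I * (((2 * k + 1 : ℕ) : ℂ) + 1) ^ 2 * τ) =
      2 * Complex.exp (Real.pi * Complex.I * ((k : ℂ) + 1) ^ 2 * (4 * τ)) := by
    intro k
    have e1 : Real.pi * Complex.I * (((2 * k + 1 : ℕ) : ℂ) + 1) ^ 2 * (τ - 1) =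
        Real.pi * Complex.I * ((k : ℂ) + 1) ^ 2 * (4 * τ)
        + ((-(2 * (k + 1) ^ 2) : ℤ) : ℂ) * (2 * Real.pi * Complex.I) := by
      push_cast; ring
    have e2 : Real.pi * Complex.I * (((2 * k + 1 : ℕ) : ℂ) + 1) ^ 2 * τ =
        Real.pi * Complex.I * ((k : ℂ) + 1) ^ 2 * (4 * τ) := by
      push_cast; ring
    rw [e1, e2, Complex.exp_add, Complex.exp_int_mul_two_pi_mul_I]
    ring
  have h4 := h2.add h1
  have h5 : HasSum (fun n : ℕ => Complex.exp (Real.pi * Complex.I * ((n : ℂ) + 1) ^ 2 * (τ - 1)) +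
      Complex.exp (Real.pi * Complex.I * ((n : ℂ) + 1) ^ 2 * τ))
      (0 + 2 * ((jacobiTheta (4 * τ) - 1) / 2)) := by
    apply HasSum.even_add_odd
    · simp only [hev _ (even_two_mul _), neg_add_cancel]
      exact hasSum_zero
    · simp only [hod]
      exact h3.mul_left 2
  have h6 := h4.unique h5
  linear_combination 2 * h6

/-! ### Mellin transforms of the theta function along rays -/

/-- Holomorphy of a parametric integral from a local domination of the integrand alone. -/
theorem differentiableAt_integral_of_dominated {α : Type*} [MeasurableSpace α]
    {μ : MeasureTheory.Measure α} {F : ℂ → α → ℂ} {r₀ : ℂ} {ε : ℝ} (hε : 0 < ε) {b : α → ℝ}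
    (hb : MeasureTheory.Integrable b μ)
    (hm : ∀ r ∈ Metric.ball r₀ ε, MeasureTheory.AEStronglyMeasurable (F r) μ)
    (hbd : ∀ᵐ x ∂μ, ∀ r ∈ Metric.ball r₀ ε, ‖F r x‖ ≤ b x)
    (hd : ∀ᵐ x ∂μ, ∀ r ∈ Metric.ball r₀ ε, DifferentiableAt ℂ (F · x) r) :
    DifferentiableAt ℂ (fun r => ∫ x, F r x ∂μ) r₀ := by
  have hs : Metric.ball r₀ (ε / 2) ∈ nhds r₀ := Metric.ball_mem_nhds _ (by positivity)
  have hr0 : r₀ ∈ Metric.ball r₀ ε := Metric.mem_ball_self hε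
  have hd0 : ∀ᵐ x ∂μ, HasDerivAt (F · x) (deriv (F · x) r₀) r₀ := by
    filter_upwards [hd] with x hx using (hx r₀ hr0).hasDerivAt
  -- the derivative is a pointwise limit of difference quotients, hence measurable
  have hmeas : MeasureTheory.AEStronglyMeasurable (fun x => deriv (F · x) r₀) μ := by
    have hu : Tendsto (fun n : ℕ => (ε / 2) * (1 / ((n : ℝ) + 1))) atTop (nhds ((ε / 2) * 0)) :=
      tendsto_one_div_add_atTop_nhds_zero_nat.const_mul _
    rw [mul_zero] at hu
    have hpos : ∀ n : ℕ, 0 < (ε / 2) * (1 / ((n : ℝ) + 1)) := fun n => by positivity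
    have hlt : ∀ n : ℕ, (ε / 2) * (1 / ((n : ℝ) + 1)) < ε := fun n => by
      have : 1 / ((n : ℝ) + 1) ≤ 1 := by
        rw [div_le_one (by positivity)]; linarith [Nat.cast_nonneg (α := ℝ) n]
      nlinarith
    refine aestronglyMeasurable_of_tendsto_ae atTop
      (f := fun (n : ℕ) x => (((ε / 2) * (1 / ((n : ℝ) + 1)) : ℝ) : ℂ)⁻¹ •
        (F (r₀ + (((ε / 2) * (1 / ((n : ℝ) + 1)) : ℝ) : ℂ)) x - F r₀ x)) ?_ ?_
    · intro n
      have h : MeasureTheory.AEStronglyMeasurable (fun x =>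
          F (r₀ + (((ε / 2) * (1 / ((n : ℝ) + 1)) : ℝ) : ℂ)) x - F r₀ x) μ :=
        (hm _ ?_).sub (hm _ hr0)
      · exact h.const_smul (((ε / 2) * (1 / ((n : ℝ) + 1)) : ℝ) : ℂ)⁻¹
      simp only [Metric.mem_ball, dist_self_add_left, Complex.norm_real, Real.norm_eq_abs]
      rw [abs_of_pos (hpos n)]
      exact hlt n
    · filter_upwards [hd0] with x hx
      have h1 := hasDerivAt_iff_tendsto_slope_zero.mp hx
      refine h1.comp ?_
      rw [tendsto_nhdsWithin_iff]
      constructor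
      · have := (Complex.continuous_ofReal.tendsto 0).comp hu
        rwa [Complex.ofReal_zero] at this
      · refine Eventually.of_forall fun n => ?_
        have := (hpos n).ne'
        simp only [Set.mem_compl_iff, Set.mem_singleton_iff, Complex.ofReal_eq_zero]
        exact this
  refine (hasDerivAt_integral_of_dominated_loc_of_deriv_le (F' := fun r x => deriv (F · x) r)
    (bound := fun x => b x / (ε / 4)) hs ?_ ?_ hmeas ?_ (hb.div_const _) ?_).2.differentiableAt
  · filter_upwards [Metric.ball_mem_nhds r₀ hε] with r hr using hm r hr
  · refine hb.mono' (hm _ hr0) ?_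
    filter_upwards [hbd] with x hx using hx _ hr0
  · filter_upwards [hbd, hd] with x hx hdx r hr
    have hsub : Metric.closedBall r (ε / 4) ⊆ Metric.ball r₀ ε := by
      intro y hy
      rw [Metric.mem_ball] at hr ⊢
      rw [Metric.mem_closedBall] at hy
      have := dist_triangle y r r₀
      linarith
    refine Complex.norm_deriv_le_of_forall_mem_sphere_norm_le (by positivity) ?_ ?_
    · refine DifferentiableOn.diffContOnCl ?_
      rw [closure_ball _ (by positivity)]
      exact fun y hy => (hdx y (hsub hy)).differentiableWithinAt
    · exact fun y hy => hx y (hsub (Metric.sphere_subset_closedBall hy))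
  · filter_upwards [hd] with x hx r hr
    exact (hx r (Metric.ball_subset_ball (by linarith) hr)).hasDerivAt

/-- The majorant, up to a constant factor, of `thetaRem` along a ray. -/
noncomputable def rayBound (x : ℝ) : ℝ := if x ≤ 1 then 1 else x ^ (-(1 / 2) : ℝ)

theorem integrableOn_rayBound {σ : ℝ} (h0 : 0 < σ) (h1 : σ < 1 / 2) :
    MeasureTheory.IntegrableOn (fun x : ℝ => x ^ (σ - 1) * rayBound x) (Set.Ioi 0) := by
  rw [← Set.Ioc_union_Ioi_eq_Ioi (zero_le_one' ℝ)]
  refine MeasureTheory.IntegrableOn.union ?_ ?_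
  · have h := (intervalIntegral.intervalIntegrable_rpow' (a := 0) (b := 1) (r := σ - 1)
      (by linarith))
    rw [intervalIntegrable_iff_integrableOn_Ioc_of_le zero_le_one] at h
    refine h.congr_fun (fun x hx => ?_) measurableSet_Ioc
    simp [rayBound, hx.2]
  · have h := integrableOn_Ioi_rpow_of_lt (a := σ - 1 - 1 / 2) (c := 1) (by linarith) one_pos
    refine h.congr_fun (fun x hx => ?_) measurableSet_Ioi
    have hx0 : (0 : ℝ) < x := lt_trans one_pos hx
    simp only [rayBound, if_neg (not_le.mpr (Set.mem_Ioi.mp hx))]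
    rw [← Real.rpow_add hx0]
    ring_nf

theorem norm_mellin_thetaRem_integrand_le {s r : ℂ} {x κ : ℝ} (hx : 0 < x) (hκ : 0 < κ)
    (hr : κ ≤ r.re) (hr1 : ‖r‖ ≤ 1 / κ) :
    ‖(x : ℂ) ^ (s - 1) • thetaRem (r * x)‖ ≤
      (1 / κ ^ 2 + 1) * (1 / κ) * (x ^ (s.re - 1) * rayBound x) := by
  rw [norm_smul, Complex.norm_cpow_eq_rpow_re_of_pos hx]
  have h := norm_thetaRem_mul_le hx hκ hr hr1
  have h2 : (s - 1).re = s.re - 1 := by simp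
  rw [h2]
  calc _ ≤ x ^ (s.re - 1) * ((1 / κ ^ 2 + 1) * (1 / κ) * rayBound x) := by
        gcongr
        exact h
    _ = _ := by ring

theorem aestronglyMeasurable_mellin_thetaRem_integrand {s r : ℂ} (hr : 0 < r.re) :
    MeasureTheory.AEStronglyMeasurable (fun x : ℝ => (x : ℂ) ^ (s - 1) • thetaRem (r * x))
      (MeasureTheory.volume.restrict (Set.Ioi 0)) := by
  refine ContinuousOn.aestronglyMeasurable ?_ measurableSet_Ioi
  refine continuousOn_of_forall_continuousAt fun x hx => ?_
  have hx0 : (0 : ℝ) < x := hx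
  refine ContinuousAt.mul (f := fun x : ℝ => (x : ℂ) ^ (s - 1)) ?_ ?_
  · exact Complex.continuousAt_ofReal_cpow_const _ _ (Or.inr hx0.ne')
  · have h : 0 < (r * x).re := by simp; positivity
    exact (differentiableAt_thetaRem h).continuousAt.comp (f := fun x : ℝ => r * (x : ℂ))
      (by fun_prop)

theorem mellinConvergent_thetaRem {s r : ℂ} (hr : 0 < r.re) (h0 : 0 < s.re) (h1 : s.re < 1 / 2) :
    MellinConvergent (fun x : ℝ => thetaRem (r * x)) s := by
  obtain ⟨κ, hκ, hk1, hk2⟩ : ∃ κ : ℝ, 0 < κ ∧ κ ≤ r.re ∧ ‖r‖ ≤ 1 / κ := by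
    have hn : 0 < ‖r‖ := hr.trans_le (Complex.re_le_norm r)
    refine ⟨min r.re (1 / ‖r‖), by positivity, min_le_left _ _, ?_⟩
    rw [le_div_iff₀ (by positivity)]
    calc ‖r‖ * min r.re (1 / ‖r‖) ≤ ‖r‖ * (1 / ‖r‖) := by gcongr; exact min_le_right _ _
      _ = 1 := by field_simp
  refine MeasureTheory.Integrable.mono' ((integrableOn_rayBound h0 h1).const_mul
    ((1 / κ ^ 2 + 1) * (1 / κ))) (aestronglyMeasurable_mellin_thetaRem_integrand hr) ?_
  filter_upwards [MeasureTheory.ae_restrict_mem measurableSet_Ioi] with x hx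
  exact norm_mellin_thetaRem_integrand_le hx hκ hk1 hk2

theorem differentiableAt_mellin_thetaRem_ray {s r₀ : ℂ} (hr : 0 < r₀.re) (h0 : 0 < s.re)
    (h1 : s.re < 1 / 2) :
    DifferentiableAt ℂ (fun r : ℂ => mellin (fun x : ℝ => thetaRem (r * x)) s) r₀ := by
  have hn : 0 < ‖r₀‖ := hr.trans_le (Complex.re_le_norm r₀)
  set κ := min (r₀.re / 2) (1 / (2 * ‖r₀‖)) with hκdef
  have hκ : 0 < κ := by positivity
  have hball : ∀ r ∈ Metric.ball r₀ (r₀.re / 2), κ ≤ r.re ∧ ‖r‖ ≤ 1 / κ := by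
    intro r hr'
    rw [Metric.mem_ball, dist_eq_norm] at hr'
    constructor
    · have h2 := (Complex.abs_re_le_norm (r - r₀)).trans_lt hr'
      rw [Complex.sub_re, abs_lt] at h2
      have := min_le_left (r₀.re / 2) (1 / (2 * ‖r₀‖))
      linarith
    · have h3 : ‖r‖ ≤ 2 * ‖r₀‖ := by
        have h4 := norm_sub_norm_le r r₀
        have h5 := Complex.re_le_norm r₀
        linarith
      rw [le_div_iff₀ hκ]
      calc ‖r‖ * κ ≤ (2 * ‖r₀‖) * (1 / (2 * ‖r₀‖)) := by
            gcongr; exact min_le_right _ _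
        _ = 1 := by field_simp
  refine differentiableAt_integral_of_dominated (ε := r₀.re / 2) (by positivity)
    ((integrableOn_rayBound h0 h1).const_mul ((1 / κ ^ 2 + 1) * (1 / κ))) ?_ ?_ ?_
  · intro r hr'
    exact aestronglyMeasurable_mellin_thetaRem_integrand (hκ.trans_le (hball r hr').1)
  · filter_upwards [MeasureTheory.ae_restrict_mem measurableSet_Ioi] with x hx r hr'
    exact norm_mellin_thetaRem_integrand_le hx hκ (hball r hr').1 (hball r hr').2
  · filter_upwards [MeasureTheory.ae_restrict_mem measurableSet_Ioi] with x hx r hr'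
    have hx0 : (0 : ℝ) < x := hx
    have hre : 0 < (r * x).re := by
      have := hκ.trans_le (hball r hr').1
      simp; positivity
    refine DifferentiableAt.const_mul (𝔸 := ℂ) ?_ _
    exact (differentiableAt_thetaRem hre).comp (f := fun r : ℂ => r * (x : ℂ)) r (by fun_prop)

/-- Rotation of the path of integration: `∫ thetaRem (r x) x ^ (s - 1) dx` is `r ^ (-s)` times its
value at `r = 1`, for every `r` in the right half plane, since this is so for `r > 0`. -/
theorem mellin_thetaRem_ray {s r : ℂ} (hr : 0 < r.re) (h0 : 0 < s.re) (h1 : s.re < 1 / 2) :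
    mellin (fun x : ℝ => thetaRem (r * x)) s = r ^ (-s) * mellin (fun x : ℝ => thetaRem x) s := by
  set U : Set ℂ := {r | 0 < r.re} with hU
  have hUo : IsOpen U := isOpen_lt continuous_const Complex.continuous_re
  have hUc : IsPreconnected U := (convex_halfSpace_re_gt 0).isPreconnected
  have hA : AnalyticOnNhd ℂ (fun r : ℂ => mellin (fun x : ℝ => thetaRem (r * x)) s) U :=
    DifferentiableOn.analyticOnNhd (fun r hr =>
      (differentiableAt_mellin_thetaRem_ray hr h0 h1).differentiableWithinAt) hUo
  have hB : AnalyticOnNhd ℂ (fun r : ℂ => r ^ (-s) * mellin (fun x : ℝ => thetaRem x) s) U := by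
    refine DifferentiableOn.analyticOnNhd (fun r hr => ?_) hUo
    exact ((differentiableAt_id.cpow_const (Or.inl hr)).mul_const _).differentiableWithinAt
  refine hA.eqOn_of_preconnected_of_frequently_eq hB hUc (z₀ := 1) (by simp [hU]) ?_ hr
  have hmap : Tendsto (fun n : ℕ => ((1 + 1 / ((n : ℝ) + 1) : ℝ) : ℂ)) atTop
      (nhdsWithin 1 {1}ᶜ) := by
    rw [tendsto_nhdsWithin_iff]
    constructor
    · have h := (tendsto_one_div_add_atTop_nhds_zero_nat (𝕜 := ℝ)).const_add 1
      have := (Complex.continuous_ofReal.tendsto _).comp h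
      rwa [add_zero, Complex.ofReal_one] at this
    · refine Eventually.of_forall fun n => ?_
      have : 0 < 1 / ((n : ℝ) + 1) := by positivity
      simp only [Set.mem_compl_iff, Set.mem_singleton_iff]
      norm_cast
      simp; positivity
  refine hmap.frequently (Frequently.of_forall fun n => ?_)
  have hp : (0 : ℝ) < 1 + 1 / ((n : ℝ) + 1) := by positivity
  have := mellin_comp_mul_left (fun x : ℝ => thetaRem x) s hp
  simpa only [Complex.ofReal_mul, smul_eq_mul] using this

/-- In the critical strip the completed zeta function is a Mellin transform of `thetaRem`. -/
theorem mellin_thetaRem {s : ℂ} (h0 : 0 < s.re) (h1 : s.re < 1 / 2) :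
    mellin (fun x : ℝ => thetaRem x) s = 2 * completedRiemannZeta (2 * s) := by
  set P := HurwitzZeta.hurwitzEvenFEPair 0 with hP
  have hconv : MellinConvergent (fun x : ℝ => thetaRem x) s := by
    simpa using mellinConvergent_thetaRem (r := 1) (by simp) h0 h1
  have hmod : MellinConvergent P.f_modif s := (P.isStrongFEPair_toStrongFEPair.hasMellin s).1
  have hker : ∀ x : ℝ, P.f x = jacobiTheta (Complex.I * x) := by
    intro x
    have := HurwitzZeta.evenKernel_def 0 x
    simp only [hP, HurwitzZeta.hurwitzEvenFEPair, Function.comp]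
    simpa [jacobiTheta_eq_jacobiTheta₂] using this
  have hf0 : P.f₀ = 1 := by simp [hP, HurwitzZeta.hurwitzEvenFEPair]
  have hg0 : P.g₀ = 1 := by simp [hP, HurwitzZeta.hurwitzEvenFEPair]
  have heps : P.ε = 1 := by simp [hP, HurwitzZeta.hurwitzEvenFEPair]
  have hk : P.k = 1 / 2 := by simp [hP, HurwitzZeta.hurwitzEvenFEPair]
  have hs0 : s ≠ 0 := by rintro rfl; simp at h0
  have hs1 : (1 / 2 : ℂ) - s ≠ 0 := by
    intro h
    have := congrArg Complex.re h
    simp at this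
    linarith
  have hdiff : mellin P.f_modif s - mellin (fun x : ℝ => thetaRem x) s = 1 / s + 1 / (1 / 2 - s) := by
    unfold mellin
    rw [← MeasureTheory.integral_sub hmod hconv]
    have hsplit := MeasureTheory.setIntegral_union (μ := MeasureTheory.volume)
      (f := fun t : ℝ => (t : ℂ) ^ (s - 1) • P.f_modif t - (t : ℂ) ^ (s - 1) • thetaRem t)
      (s := Set.Ioc 0 1) (t := Set.Ioi 1) (Set.Ioc_disjoint_Ioi le_rfl) measurableSet_Ioi
      ((hmod.sub hconv).mono_set Set.Ioc_subset_Ioi_self)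
      ((hmod.sub hconv).mono_set (Set.Ioi_subset_Ioi zero_le_one))
    rw [Set.Ioc_union_Ioi_eq_Ioi (zero_le_one' ℝ)] at hsplit
    rw [hsplit]
    congr 1
    · rw [MeasureTheory.integral_Ioc_eq_integral_Ioo]
      rw [MeasureTheory.setIntegral_congr_fun (g := fun t : ℝ => (t : ℂ) ^ (s - 1))
        measurableSet_Ioo, ← MeasureTheory.integral_Ioc_eq_integral_Ioo,
        ← intervalIntegral.integral_of_le zero_le_one, integral_cpow (Or.inl (by simpa using h0))]
      · simp [hs0]
      · intro t ht
        have h2 : t ∉ Set.Ioi 1 := by simpa using ht.2.le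
        simp only [WeakFEPair.f_modif, Pi.add_apply, Set.indicator_of_mem ht,
          Set.indicator_of_notMem h2, hker, hg0, heps, hk, thetaRem,
          one_div_ofReal_cpow_half ht.1, smul_eq_mul]
        ring
    · rw [MeasureTheory.setIntegral_congr_fun (g := fun t : ℝ => (t : ℂ) ^ (s - 1 - 1 / 2))
        measurableSet_Ioi, integral_Ioi_cpow_of_lt (by simp; linarith) one_pos]
      · have e : s - 1 - 1 / 2 + 1 = -(1 / 2 - s) := by ring
        rw [e, Complex.ofReal_one, Complex.one_cpow, neg_div_neg_eq]
      · intro t ht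
        have ht0 : (0 : ℝ) < t := lt_trans one_pos ht
        have h2 : t ∉ Set.Ioo (0 : ℝ) 1 := fun h => absurd h.2 (not_lt.mpr (le_of_lt ht))
        simp only [WeakFEPair.f_modif, Pi.add_apply, Set.indicator_of_mem ht,
          Set.indicator_of_notMem h2, hker, hf0, thetaRem, smul_eq_mul]
        rw [Complex.cpow_sub (s - 1) (1 / 2) (by exact_mod_cast ht0.ne')]
        ring
  have hL : completedRiemannZeta (2 * s) = P.Λ s / 2 := by
    change P.Λ (2 * s / 2) / 2 = _
    rw [mul_div_cancel_left₀ _ (two_ne_zero' ℂ)]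
  have hL2 : P.Λ s = mellin P.f_modif s - 1 / s - 1 / (1 / 2 - s) := by
    rw [WeakFEPair.Λ, WeakFEPair.Λ₀, hf0, hg0, heps, hk]
    simp
  rw [hL, hL2]
  linear_combination -hdiff

/-- On `(0, 1)` the completed zeta function is the integral of a negative function. -/
theorem completedRiemannZeta_ofReal_ne_zero {σ : ℝ} (h0 : 0 < σ) (h1 : σ < 1) :
    completedRiemannZeta σ ≠ 0 := by
  intro h
  have hre : ((σ : ℂ) / 2).re = σ / 2 := by simp
  have hm := mellin_thetaRem (s := (σ : ℂ) / 2) (by rw [hre]; linarith) (by rw [hre]; linarith)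
  rw [mul_div_cancel₀ _ (two_ne_zero' ℂ), h, mul_zero] at hm
  have hconv : MellinConvergent (fun x : ℝ => thetaRem x) ((σ : ℂ) / 2) := by
    simpa using mellinConvergent_thetaRem (r := 1) (s := (σ : ℂ) / 2) (by simp)
      (by rw [hre]; linarith) (by rw [hre]; linarith)
  have hint : MeasureTheory.IntegrableOn (fun x : ℝ => -(x ^ (σ / 2 - 1) * (thetaRem x).re))
      (Set.Ioi 0) := by
    refine (MeasureTheory.Integrable.re hconv).neg.congr ?_
    filter_upwards [MeasureTheory.ae_restrict_mem measurableSet_Ioi] with x hx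
    have hx0 : (0 : ℝ) < x := hx
    have e : (x : ℂ) ^ ((σ : ℂ) / 2 - 1) = ((x ^ (σ / 2 - 1) : ℝ) : ℂ) := by
      rw [Complex.ofReal_cpow hx0.le]; push_cast; rfl
    simp [e]
  have hpos : ∀ x ∈ Set.Ioi (0 : ℝ), 0 < -(x ^ (σ / 2 - 1) * (thetaRem x).re) := by
    intro x hx
    have hx0 : (0 : ℝ) < x := hx
    have := thetaRem_ofReal_re_neg hx0
    have h2 : 0 < x ^ (σ / 2 - 1) := by positivity
    nlinarith
  have hI : ∫ x in Set.Ioi (0 : ℝ), -(x ^ (σ / 2 - 1) * (thetaRem x).re) = 0 := by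
    have h2 := congrArg Complex.re hm
    unfold mellin at h2
    have h3 := integral_re hconv
    simp only [RCLike.re_to_complex] at h3
    rw [← h3, Complex.zero_re] at h2
    rw [MeasureTheory.integral_neg, neg_eq_zero]
    refine Eq.trans ?_ h2
    refine MeasureTheory.setIntegral_congr_fun measurableSet_Ioi fun x hx => ?_
    have hx0 : (0 : ℝ) < x := hx
    have e : (x : ℂ) ^ ((σ : ℂ) / 2 - 1) = ((x ^ (σ / 2 - 1) : ℝ) : ℂ) := by
      rw [Complex.ofReal_cpow hx0.le]; push_cast; rfl
    simp [e]
  rw [MeasureTheory.setIntegral_eq_zero_iff_of_nonneg_ae ?_ hint] at hI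
  · have h5 : ∀ᵐ x ∂(MeasureTheory.volume.restrict (Set.Ioi (0 : ℝ))), False := by
      filter_upwards [hI, MeasureTheory.ae_restrict_mem measurableSet_Ioi] with x h1 hx
      exact (hpos x hx).ne' h1
    rw [eventually_false_iff_eq_bot, MeasureTheory.ae_eq_bot, MeasureTheory.Measure.restrict_eq_zero,
      Real.volume_Ioi] at h5
    simp at h5
  · filter_upwards [MeasureTheory.ae_restrict_mem measurableSet_Ioi] with x hx
    exact (hpos x hx).le

/-- The zeta function has no zero on the real interval `(0, 1)`. -/
theorem riemannZeta_ofReal_ne_zero {σ : ℝ} (h0 : 0 < σ) (h1 : σ < 1) : riemannZeta σ ≠ 0 := by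
  rw [riemannZeta_def_of_ne_zero (by exact_mod_cast h0.ne')]
  refine div_ne_zero (completedRiemannZeta_ofReal_ne_zero h0 h1) ?_
  exact Complex.Gammaℝ_ne_zero_of_re_pos (by simpa using h0)

/-! ### A zero of zeta on the critical line -/

/-- Near the cusp `z = i` of the boundary of the right half plane the theta function vanishes to
order greater than one; here it is evaluated on the unit circle. -/
theorem norm_jacobiTheta_neg_exp_le {δ : ℝ} (h0 : 0 < δ) (h1 : δ < Real.pi / 2) :
    ‖jacobiTheta (-Complex.exp (-(δ * Complex.I)))‖ ≤ 68 * δ ^ (3 / 2 : ℝ) := by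
  set τ : ℂ := 1 - Complex.exp (-(δ * Complex.I)) with hτ
  have hexp : Complex.exp (-(δ * Complex.I)) = Real.cos δ - Real.sin δ * Complex.I := by
    rw [← neg_mul, ← Complex.ofReal_neg, Complex.exp_mul_I, ← Complex.ofReal_cos,
      ← Complex.ofReal_sin, Real.cos_neg, Real.sin_neg]
    push_cast; ring
  have him : τ.im = Real.sin δ := by
    rw [hτ, hexp]
    simp only [Complex.sub_im, Complex.one_im, Complex.ofReal_im,
      Complex.im_ofReal_mul, Complex.I_im]
    ring
  have hsin : δ / 2 ≤ Real.sin δ := by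
    have := Real.mul_le_sin h0.le h1.le
    have h4 := Real.pi_lt_four
    have : 1 / 2 ≤ 2 / Real.pi := by
      rw [div_le_div_iff₀ (by norm_num) Real.pi_pos]; linarith
    nlinarith
  have him0 : 0 < τ.im := by rw [him]; linarith
  have hnorm : ‖τ‖ ≤ δ := by
    have h := Real.norm_exp_I_mul_ofReal_sub_one_le (x := -δ)
    rw [Real.norm_eq_abs, abs_neg, abs_of_pos h0] at h
    have e : -(δ * Complex.I) = Complex.I * ((-δ : ℝ) : ℂ) := by push_cast; ring
    rw [hτ, ← norm_neg, neg_sub, e]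
    exact h
  set z : ℂ := -Complex.I * τ with hz
  have hIz : Complex.I * z = τ := by
    rw [hz, ← mul_assoc, mul_neg, Complex.I_mul_I]; ring
  have hzre : z.re = Real.sin δ := by rw [← him, hz]; simp
  have hzn : ‖z‖ = ‖τ‖ := by rw [hz]; simp
  have hzre0 : 0 < z.re := by rw [hzre]; linarith
  have hz0 : z ≠ 0 := by rintro h; rw [h] at hzre0; simp at hzre0
  have hn0 : 0 < ‖z‖ := norm_pos_iff.mpr hz0
  have h4re : 0 < (4 * z).re := by simp [hzre0]
  have hhalf : (4 * z) ^ (1 / 2 : ℂ) = 2 * z ^ (1 / 2 : ℂ) := by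
    have h2 : Complex.log 4 = 2 * Complex.log 2 := by
      rw [show (4 : ℂ) = ((4 : ℝ) : ℂ) by norm_num, show (2 : ℂ) = ((2 : ℝ) : ℂ) by norm_num,
        ← Complex.ofReal_log (by norm_num), ← Complex.ofReal_log (by norm_num),
        show (4 : ℝ) = 2 ^ 2 by norm_num, Real.log_pow]
      push_cast; ring
    have h3 : Complex.log (4 * z) = Complex.log 4 + Complex.log z := by
      have := Complex.log_ofReal_mul (r := 4) (by norm_num) hz0
      rw [Complex.ofReal_log (by norm_num)] at this
      simpa using this
    rw [Complex.cpow_def_of_ne_zero (by simpa using hz0), Complex.cpow_def_of_ne_zero hz0, h3, h2,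
      show (2 * Complex.log 2 + Complex.log z) * (1 / 2) = Complex.log 2 + Complex.log z * (1 / 2) by
        ring, Complex.exp_add, Complex.exp_log two_ne_zero]
  have hfe : jacobiTheta (τ - 1) = 1 / z ^ (1 / 2 : ℂ) *
      ((jacobiTheta (Complex.I * (1 / (4 * z))) - 1) - (jacobiTheta (Complex.I * (1 / z)) - 1)) := by
    have e := jacobiTheta_sub_one_add him0
    have e1 := jacobiTheta_I_mul hzre0
    have e2 := jacobiTheta_I_mul h4re
    rw [hhalf] at e2
    rw [hIz] at e1
    rw [show Complex.I * (4 * z) = 4 * τ by rw [← hIz]; ring] at e2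
    have hne : z ^ (1 / 2 : ℂ) ≠ 0 := by simp [Complex.cpow_eq_zero_iff, hz0]
    rw [e1, e2] at e
    rw [eq_sub_of_add_eq e]
    field_simp
    ring
  have hre1 : (1 / z).re = Real.sin δ / ‖z‖ ^ 2 := by rw [re_one_div, hzre]
  have hre4 : (1 / (4 * z)).re = (Real.sin δ / ‖z‖ ^ 2) / 4 := by
    rw [re_one_div]
    simp [hzre]
    ring
  have hq0 : 0 < Real.sin δ / ‖z‖ ^ 2 := by
    have : 0 < Real.sin δ := by linarith
    positivity
  have b1 := norm_jacobiTheta_sub_one_le_inv_sq (τ := Complex.I * (1 / z))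
    (by rw [im_I_mul, hre1]; exact hq0)
  have b4 := norm_jacobiTheta_sub_one_le_inv_sq (τ := Complex.I * (1 / (4 * z)))
    (by rw [im_I_mul, hre4]; positivity)
  rw [im_I_mul, hre1] at b1
  rw [im_I_mul, hre4] at b4
  have hq : δ / 2 / ‖z‖ ^ 2 ≤ Real.sin δ / ‖z‖ ^ 2 := by gcongr
  have hq' : 0 < δ / 2 / ‖z‖ ^ 2 := by positivity
  have hpt : -Complex.exp (-(δ * Complex.I)) = τ - 1 := by rw [hτ]; ring
  rw [hpt, hfe, norm_mul, norm_div, norm_one, norm_cpow_half]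
  have hzδ : ‖z‖ ≤ δ := by rw [hzn]; exact hnorm
  calc 1 / ‖z‖ ^ (1 / 2 : ℝ) * ‖(jacobiTheta (Complex.I * (1 / (4 * z))) - 1) -
        (jacobiTheta (Complex.I * (1 / z)) - 1)‖
      ≤ 1 / ‖z‖ ^ (1 / 2 : ℝ) * (1 / (Real.sin δ / ‖z‖ ^ 2 / 4) ^ 2 + 1 / (Real.sin δ / ‖z‖ ^ 2) ^ 2) := by
        gcongr
        exact (norm_sub_le _ _).trans (add_le_add b4 b1)
    _ ≤ 1 / ‖z‖ ^ (1 / 2 : ℝ) * (1 / (δ / 2 / ‖z‖ ^ 2 / 4) ^ 2 + 1 / (δ / 2 / ‖z‖ ^ 2) ^ 2) := by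
        gcongr
    _ = 68 * (‖z‖ ^ (4 : ℝ) / ‖z‖ ^ (1 / 2 : ℝ)) / δ ^ 2 := by
        have : ‖z‖ ^ (4 : ℝ) = ‖z‖ ^ 4 := by exact_mod_cast Real.rpow_natCast ‖z‖ 4
        rw [this]
        have : ‖z‖ ^ (1 / 2 : ℝ) ≠ 0 := by positivity
        field_simp
        ring
    _ = 68 * ‖z‖ ^ (7 / 2 : ℝ) / δ ^ 2 := by
        rw [← Real.rpow_sub hn0]; norm_num
    _ ≤ 68 * δ ^ (7 / 2 : ℝ) / δ ^ 2 := by gcongr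
    _ = 68 * δ ^ (3 / 2 : ℝ) := by
        have : δ ^ (7 / 2 : ℝ) = δ ^ (3 / 2 : ℝ) * δ ^ 2 := by
          rw [← Real.rpow_natCast δ 2, ← Real.rpow_add h0]; norm_num
        rw [this]; field_simp

/-- Twice the completed zeta function on the critical line, at height `2 t`. -/
noncomputable def critZeta (t : ℝ) : ℂ := mellin (fun x : ℝ => thetaRem x) (1 / 4 + t * Complex.I)

theorem critZeta_eq (t : ℝ) :
    critZeta t = 2 * completedRiemannZeta (1 / 2 + 2 * t * Complex.I) := by
  rw [critZeta, mellin_thetaRem (by simp) (by simp; norm_num)]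
  congr 2; ring

theorem critZeta_neg (t : ℝ) : critZeta (-t) = critZeta t := by
  rw [critZeta_eq, critZeta_eq, ← completedRiemannZeta_one_sub]
  congr 2; push_cast; ring

theorem critZeta_im (t : ℝ) : (critZeta t).im = 0 := by
  rw [← Complex.conj_eq_iff_im]
  rw [← critZeta_neg t]
  nth_rw 1 [critZeta_neg t]
  unfold critZeta mellin
  rw [← integral_conj]
  refine MeasureTheory.setIntegral_congr_fun measurableSet_Ioi fun x hx => ?_
  have hx0 : (0 : ℝ) < x := hx
  simp only [smul_eq_mul, map_mul]
  congr 1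
  · have h := Complex.cpow_conj (x : ℂ) (1 / 4 + t * Complex.I - 1)
      (by rw [Complex.arg_ofReal_of_nonneg hx0.le]; exact Real.pi_pos.ne)
    rw [Complex.conj_ofReal] at h
    rw [← h]
    congr 1
    simp [map_ofNat]
  · rw [Complex.conj_eq_iff_im]; exact thetaRem_ofReal_im hx0

theorem continuous_critZeta : Continuous critZeta := by
  have : critZeta = fun t : ℝ => 2 * completedRiemannZeta (1 / 2 + 2 * t * Complex.I) :=
    funext critZeta_eq
  rw [this]
  refine continuous_const.mul (continuous_iff_continuousAt.mpr fun t => ?_)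
  refine ContinuousAt.comp (f := fun t : ℝ => (1 / 2 + 2 * t * Complex.I : ℂ)) ?_ (by fun_prop)
  refine (differentiableAt_completedZeta ?_ ?_).continuousAt
  · intro h; have := congrArg Complex.re h; simp at this
  · intro h; have := congrArg Complex.re h; norm_num at this

theorem exp_mul_I_re_pos {β : ℝ} (h : |β| < Real.pi / 2) : 0 < (Complex.exp (β * Complex.I)).re := by
  rw [Complex.exp_ofReal_mul_I_re]
  exact Real.cos_pos_of_mem_Ioo (abs_lt.mp h)

theorem exp_mul_I_cpow {β : ℝ} (h : |β| < Real.pi / 2) (s : ℂ) :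
    Complex.exp (β * Complex.I) ^ s = Complex.exp (β * Complex.I * s) := by
  have h2 := abs_lt.mp h
  rw [Complex.cpow_def_of_ne_zero (Complex.exp_ne_zero _), Complex.log_exp]
  · simp; linarith [Real.pi_pos]
  · simp; linarith [Real.pi_pos]

theorem mellin_thetaRem_exp {β : ℝ} (h : |β| < Real.pi / 2) (t : ℝ) :
    mellin (fun x : ℝ => thetaRem (Complex.exp (β * Complex.I) * x)) (1 / 4 + t * Complex.I) =
      Complex.exp (-(β / 4) * Complex.I) * (Real.exp (β * t) : ℂ) * critZeta t := by
  rw [mellin_thetaRem_ray (exp_mul_I_re_pos h) (by simp) (by simp; norm_num), exp_mul_I_cpow h,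
    critZeta, Complex.ofReal_exp, ← Complex.exp_add]
  congr 2
  push_cast
  linear_combination (-β * t : ℂ) * Complex.I_mul_I

/-- The completed zeta function decays on the critical line faster than `exp (-β t)` for every
`β < π / 2`, by turning the path of integration through the angle `β`. -/
theorem exists_norm_critZeta_mul_exp_le {β : ℝ} (h : |β| < Real.pi / 2) :
    ∃ C : ℝ, ∀ t : ℝ, Real.exp (β * t) * ‖critZeta t‖ ≤ C := by
  have hre := exp_mul_I_re_pos h
  set r := Complex.exp (β * Complex.I) with hr
  refine ⟨∫ x in Set.Ioi (0 : ℝ), ‖(x : ℂ) ^ ((1 / 4 : ℂ) - 1) • thetaRem (r * x)‖, fun t => ?_⟩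
  have e := congrArg norm (mellin_thetaRem_exp h t)
  rw [norm_mul, norm_mul, Complex.norm_real, Real.norm_eq_abs, Real.abs_exp] at e
  have e1 : ‖Complex.exp (-(β / 4) * Complex.I)‖ = 1 := by
    have := Complex.norm_exp_ofReal_mul_I (-(β / 4))
    push_cast at this
    exact this
  rw [e1, one_mul] at e
  rw [← e]
  refine (MeasureTheory.norm_integral_le_integral_norm _).trans (le_of_eq ?_)
  refine MeasureTheory.setIntegral_congr_fun measurableSet_Ioi fun x hx => ?_
  have hx0 : (0 : ℝ) < x := hx
  simp only [norm_smul, Complex.norm_cpow_eq_rpow_re_of_pos hx0, ← hr]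
  simp

theorem exists_norm_critZeta_le {β : ℝ} (h0 : 0 ≤ β) (h : β < Real.pi / 2) :
    ∃ C : ℝ, ∀ t : ℝ, ‖critZeta t‖ ≤ C * Real.exp (-β * |t|) := by
  obtain ⟨C, hC⟩ := exists_norm_critZeta_mul_exp_le (β := β) (by rwa [abs_of_nonneg h0])
  refine ⟨C, fun t => ?_⟩
  have key : ‖critZeta |t|‖ ≤ C * Real.exp (-β * |t|) := by
    have := hC |t|
    have hp := Real.exp_pos (-β * |t|)
    calc ‖critZeta |t|‖ = (Real.exp (β * |t|) * ‖critZeta |t|‖) * Real.exp (-β * |t|) := by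
          rw [mul_right_comm, ← Real.exp_add]; simp
      _ ≤ _ := by gcongr
  rcases abs_choice t with h | h
  · rwa [h] at key ⊢
  · rwa [h, critZeta_neg, ← h] at key

theorem integrable_exp_mul_critZeta {β : ℝ} (h : |β| < Real.pi / 2) :
    MeasureTheory.Integrable (fun t : ℝ => (Real.exp (β * t) : ℂ) * critZeta t) := by
  obtain ⟨β', hb1, hb2⟩ := exists_between h
  obtain ⟨C, hC⟩ := exists_norm_critZeta_le (β := β') ((abs_nonneg β).trans hb1.le) hb2
  have hint : MeasureTheory.Integrable (fun t : ℝ => C * Real.exp (-(β' - |β|) * |t|)) := by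
    refine MeasureTheory.Integrable.const_mul ?_ C
    have ha : 0 < β' - |β| := sub_pos.mpr hb1
    rw [← MeasureTheory.integrableOn_univ, ← Set.Iic_union_Ioi (a := (0 : ℝ))]
    refine MeasureTheory.IntegrableOn.union ?_ ?_
    · refine (integrableOn_exp_mul_Iic ha 0).congr_fun (fun x hx => ?_) measurableSet_Iic
      simp only [abs_of_nonpos (Set.mem_Iic.mp hx)]
      ring_nf
    · refine (integrableOn_exp_mul_Ioi (neg_lt_zero.mpr ha) 0).congr_fun (fun x hx => ?_)
        measurableSet_Ioi
      simp only [abs_of_pos (Set.mem_Ioi.mp hx)]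
  refine hint.mono' ?_ (Eventually.of_forall fun t => ?_)
  · refine Continuous.aestronglyMeasurable ?_
    exact (Complex.continuous_ofReal.comp (by fun_prop)).mul continuous_critZeta
  · rw [norm_mul, Complex.norm_real, Real.norm_eq_abs, Real.abs_exp]
    have h1 : Real.exp (β * t) ≤ Real.exp (|β| * |t|) := by
      rw [← abs_mul]; exact Real.exp_le_exp.mpr (le_abs_self _)
    have hC0 : 0 ≤ C * Real.exp (-β' * |t|) := (norm_nonneg _).trans (hC t)
    calc _ ≤ Real.exp (|β| * |t|) * (C * Real.exp (-β' * |t|)) := by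
          gcongr; exact hC t
      _ = C * (Real.exp (|β| * |t|) * Real.exp (-β' * |t|)) := by ring
      _ = _ := by rw [← Real.exp_add]; ring_nf

/-- Mellin inversion along the ray `arg z = β`, at the point of modulus one. -/
theorem integral_exp_mul_critZeta {β : ℝ} (h : |β| < Real.pi / 2) :
    ∫ t : ℝ, (Real.exp (β * t) : ℂ) * critZeta t =
      2 * Real.pi * (Complex.exp (β / 4 * Complex.I) * thetaRem (Complex.exp (β * Complex.I))) := by
  have hre := exp_mul_I_re_pos h
  set r := Complex.exp (β * Complex.I) with hr
  have hmell : ∀ y : ℝ, mellin (fun x : ℝ => thetaRem (r * x)) (((1 / 4 : ℝ) : ℂ) + y * Complex.I) =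
      Complex.exp (-(β / 4) * Complex.I) * ((Real.exp (β * y) : ℂ) * critZeta y) := by
    intro y
    have := mellin_thetaRem_exp h y
    rw [← mul_assoc, ← this]
    push_cast
    rfl
  have hinv := mellinInv_mellin_eq (1 / 4) (fun x : ℝ => thetaRem (r * x)) one_pos
    (mellinConvergent_thetaRem hre (by simp) (by simp; norm_num)) ?_ ?_
  · unfold mellinInv at hinv
    simp only [hmell, Complex.ofReal_one, Complex.one_cpow, one_smul, mul_one] at hinv
    rw [MeasureTheory.integral_const_mul, Complex.real_smul] at hinv
    rw [← hinv]
    have e : Complex.exp (β / 4 * Complex.I) * Complex.exp (-(β / 4) * Complex.I) = 1 := by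
      rw [← Complex.exp_add]; simp
    have hpi : (Real.pi : ℂ) ≠ 0 := by exact_mod_cast Real.pi_ne_zero
    set J := ∫ t : ℝ, (Real.exp (β * t) : ℂ) * critZeta t
    have e3 : (2 * Real.pi : ℂ) * ((1 / (2 * Real.pi) : ℝ) : ℂ) = 1 := by
      push_cast
      field_simp
    linear_combination (-J) * e - J * (Complex.exp (β / 4 * Complex.I) *
      Complex.exp (-(β / 4) * Complex.I)) * e3
  · have := (integrable_exp_mul_critZeta h).const_mul (Complex.exp (-(β / 4) * Complex.I))
    refine this.congr (Eventually.of_forall fun y => ?_)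
    exact (hmell y).symm
  · refine ContinuousAt.comp (x := (1 : ℝ)) (g := thetaRem)
      (f := fun x : ℝ => r * (x : ℂ)) ?_ (by fun_prop)
    exact (differentiableAt_thetaRem (by simpa using hre)).continuousAt

theorem integrable_exp_mul_critZeta_re {β : ℝ} (h : |β| < Real.pi / 2) :
    MeasureTheory.Integrable (fun t : ℝ => Real.exp (β * t) * (critZeta t).re) := by
  refine (integrable_exp_mul_critZeta h).re.congr (Eventually.of_forall fun t => ?_)
  simp only [RCLike.re_to_complex, Complex.re_ofReal_mul]

theorem integral_cosh_mul_critZeta_re {β : ℝ} (h : |β| < Real.pi / 2) :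
    ∫ t : ℝ, Real.cosh (β * t) * (critZeta t).re =
      2 * Real.pi * (Complex.exp (β / 4 * Complex.I) * thetaRem (Complex.exp (β * Complex.I))).re := by
  have h1 : ∫ t : ℝ, Real.exp (β * t) * (critZeta t).re =
      2 * Real.pi * (Complex.exp (β / 4 * Complex.I) * thetaRem (Complex.exp (β * Complex.I))).re := by
    have e := congrArg Complex.re (integral_exp_mul_critZeta h)
    have e2 := integral_re (integrable_exp_mul_critZeta h)
    simp only [RCLike.re_to_complex] at e2
    rw [← e2] at e
    simp only [Complex.re_ofReal_mul] at e
    rw [e, show (2 * Real.pi : ℂ) = ((2 * Real.pi : ℝ) : ℂ) by push_cast; ring,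
      Complex.re_ofReal_mul]
  have h2 : ∫ t : ℝ, Real.exp (-β * t) * (critZeta t).re =
      ∫ t : ℝ, Real.exp (β * t) * (critZeta t).re := by
    rw [← MeasureTheory.integral_neg_eq_self]
    congr 1
    ext t
    rw [critZeta_neg]
    ring_nf
  rw [← h1]
  have h3 : (fun t : ℝ => Real.cosh (β * t) * (critZeta t).re) = fun t : ℝ =>
      (1 / 2) * (Real.exp (β * t) * (critZeta t).re + Real.exp (-β * t) * (critZeta t).re) := by
    ext t
    rw [Real.cosh_eq]; ring_nf
  rw [h3, MeasureTheory.integral_const_mul, MeasureTheory.integral_add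
    (integrable_exp_mul_critZeta_re h) (integrable_exp_mul_critZeta_re (by rwa [abs_neg])), h2]
  ring

theorem integrable_cosh_mul_critZeta_re {β : ℝ} (h : |β| < Real.pi / 2) :
    MeasureTheory.Integrable (fun t : ℝ => Real.cosh (β * t) * (critZeta t).re) := by
  have h3 : (fun t : ℝ => Real.cosh (β * t) * (critZeta t).re) = fun t : ℝ =>
      (1 / 2) * (Real.exp (β * t) * (critZeta t).re + Real.exp (-β * t) * (critZeta t).re) := by
    ext t
    rw [Real.cosh_eq]; ring_nf
  rw [h3]
  exact ((integrable_exp_mul_critZeta_re h).add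
    (integrable_exp_mul_critZeta_re (by rwa [abs_neg]))).const_mul _

/-- As the ray approaches the imaginary axis, the inversion formula degenerates to
`-2 cos (π / 8)`, with an error of higher order than the distance `δ` of the angles. -/
theorem abs_exp_mul_thetaRem_re_add_le {δ : ℝ} (h0 : 0 < δ) (h1 : δ < Real.pi / 2) :
    |(Complex.exp (((Real.pi / 2 - δ : ℝ) : ℂ) / 4 * Complex.I) *
      thetaRem (Complex.exp (((Real.pi / 2 - δ : ℝ) : ℂ) * Complex.I))).re +
        2 * Real.cos (Real.pi / 8 - δ / 4)| ≤ 68 * δ ^ (3 / 2 : ℝ) := by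
  set β : ℝ := Real.pi / 2 - δ with hβ
  have hb : |β| < Real.pi / 2 := by rw [abs_lt]; constructor <;> linarith
  have harg : Complex.I * Complex.exp (β * Complex.I) = -Complex.exp (-(δ * Complex.I)) := by
    have e : (β : ℂ) * Complex.I = Real.pi / 2 * Complex.I + -(δ * Complex.I) := by
      rw [hβ]; push_cast; ring
    rw [e, Complex.exp_add, Complex.exp_pi_div_two_mul_I, ← mul_assoc, Complex.I_mul_I]
    ring
  have hpart : Complex.exp ((β : ℂ) / 4 * Complex.I) * thetaRem (Complex.exp (β * Complex.I)) =
      Complex.exp ((β : ℂ) / 4 * Complex.I) * jacobiTheta (-Complex.exp (-(δ * Complex.I))) -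
        ((2 * Real.cos (β / 4) : ℝ) : ℂ) := by
    unfold thetaRem
    rw [harg, one_div, ← Complex.cpow_neg, exp_mul_I_cpow hb]
    have e2 : Complex.exp ((β : ℂ) / 4 * Complex.I) * Complex.exp (β * Complex.I * (-(1 / 2))) =
        Complex.exp (-(β / 4 : ℂ) * Complex.I) := by
      rw [← Complex.exp_add]; ring_nf
    rw [mul_sub, mul_sub, e2]
    push_cast
    rw [Complex.two_cos]
    ring
  have hre : (Complex.exp ((β : ℂ) / 4 * Complex.I) * thetaRem (Complex.exp (β * Complex.I))).re +
      2 * Real.cos (Real.pi / 8 - δ / 4) =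
      (Complex.exp ((β : ℂ) / 4 * Complex.I) * jacobiTheta (-Complex.exp (-(δ * Complex.I)))).re := by
    rw [hpart, Complex.sub_re, Complex.ofReal_re, hβ]
    ring_nf
  rw [hre]
  refine (Complex.abs_re_le_norm _).trans ?_
  rw [norm_mul]
  have e1 : ‖Complex.exp ((β : ℂ) / 4 * Complex.I)‖ = 1 := by
    have := Complex.norm_exp_ofReal_mul_I (β / 4)
    push_cast at this
    exact this
  rw [e1, one_mul]
  exact norm_jacobiTheta_neg_exp_le h0 h1

theorem tendsto_two_mul_cos_sub : Tendsto (fun δ : ℝ => 2 * Real.cos (Real.pi / 8 - δ / 4) -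
    68 * δ ^ (3 / 2 : ℝ)) (nhdsWithin 0 (Set.Ioi 0)) (nhds (2 * Real.cos (Real.pi / 8))) := by
  have hc : Continuous fun δ : ℝ => 2 * Real.cos (Real.pi / 8 - δ / 4) - 68 * δ ^ (3 / 2 : ℝ) := by
    have : Continuous fun δ : ℝ => δ ^ (3 / 2 : ℝ) := Real.continuous_rpow_const (by norm_num)
    fun_prop
  have := hc.tendsto 0
  rw [Real.zero_rpow (by norm_num)] at this
  simp only [zero_div, sub_zero, mul_zero] at this
  exact this.mono_left nhdsWithin_le_nhds

theorem cos_pi_div_eight_pos : 0 < Real.cos (Real.pi / 8) :=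
  Real.cos_pos_of_mem_Ioo ⟨by linarith [Real.pi_pos], by linarith [Real.pi_pos]⟩

/-- If `critZeta` were nonnegative, so would be the integrals of `cosh (β t) critZeta t`, whose
limit for `β → π / 2` is a negative multiple of `cos (π / 8)`. -/
theorem not_forall_critZeta_nonneg : ¬ ∀ t, 0 ≤ (critZeta t).re := by
  intro h
  have hle : ∀ᶠ δ : ℝ in nhdsWithin 0 (Set.Ioi 0),
      2 * Real.cos (Real.pi / 8 - δ / 4) - 68 * δ ^ (3 / 2 : ℝ) ≤ 0 := by
    filter_upwards [Ioo_mem_nhdsGT (show (0 : ℝ) < Real.pi / 2 by positivity)] with δ hδ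
    have hb : |Real.pi / 2 - δ| < Real.pi / 2 := by
      rw [abs_lt]; constructor <;> linarith [hδ.1, hδ.2]
    have h1 := integral_cosh_mul_critZeta_re hb
    have h2 : 0 ≤ ∫ t : ℝ, Real.cosh ((Real.pi / 2 - δ) * t) * (critZeta t).re :=
      MeasureTheory.integral_nonneg fun t => mul_nonneg (Real.cosh_pos _).le (h t)
    rw [h1] at h2
    have h3 := nonneg_of_mul_nonneg_right h2 (by positivity : 0 < 2 * Real.pi)
    have h4 := (abs_le.mp (abs_exp_mul_thetaRem_re_add_le hδ.1 hδ.2)).2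
    linarith
  have := le_of_tendsto tendsto_two_mul_cos_sub hle
  linarith [cos_pi_div_eight_pos]

/-- If `critZeta` were nonpositive, the integrals of `cosh (β t) critZeta t` would decrease in `β`,
whereas for `β` near `π / 2` they behave like `-cos (β / 4)`, which increases. -/
theorem not_forall_critZeta_nonpos : ¬ ∀ t, (critZeta t).re ≤ 0 := by
  intro h
  set H : ℝ → ℝ := fun δ => -(Complex.exp (((Real.pi / 2 - δ : ℝ) : ℂ) / 4 * Complex.I) *
      thetaRem (Complex.exp (((Real.pi / 2 - δ : ℝ) : ℂ) * Complex.I))).re with hH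
  -- `H` decreases with `δ`, because `cosh (β t)` increases with `β`
  have hanti : ∀ δ₁ δ₂ : ℝ, 0 < δ₁ → δ₁ ≤ δ₂ → δ₂ < Real.pi / 2 → H δ₂ ≤ H δ₁ := by
    intro δ₁ δ₂ h1 h12 h2
    have hb1 : |Real.pi / 2 - δ₁| < Real.pi / 2 := by rw [abs_lt]; constructor <;> linarith
    have hb2 : |Real.pi / 2 - δ₂| < Real.pi / 2 := by rw [abs_lt]; constructor <;> linarith
    have e1 := integral_cosh_mul_critZeta_re hb1
    have e2 := integral_cosh_mul_critZeta_re hb2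
    have hle : ∫ t : ℝ, Real.cosh ((Real.pi / 2 - δ₁) * t) * (critZeta t).re ≤
        ∫ t : ℝ, Real.cosh ((Real.pi / 2 - δ₂) * t) * (critZeta t).re := by
      refine MeasureTheory.integral_mono (integrable_cosh_mul_critZeta_re hb1)
        (integrable_cosh_mul_critZeta_re hb2) fun t => ?_
      refine mul_le_mul_of_nonpos_right ?_ (h t)
      rw [Real.cosh_le_cosh, abs_mul, abs_mul]
      gcongr ?_ * _
      rw [abs_of_pos (by linarith), abs_of_pos (by linarith)]
      linarith
    rw [e1, e2] at hle
    have := le_of_mul_le_mul_left hle (by positivity : 0 < 2 * Real.pi)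
    simp only [hH]
    linarith
  -- letting `δ₁ → 0` bounds `H` by its limit `2 cos (π / 8)`
  have hbound : ∀ δ : ℝ, 0 < δ → δ < Real.pi / 2 → H δ ≤ 2 * Real.cos (Real.pi / 8) := by
    intro δ h1 h2
    have hc : Tendsto (fun δ : ℝ => 2 * Real.cos (Real.pi / 8 - δ / 4) + 68 * δ ^ (3 / 2 : ℝ))
        (nhdsWithin 0 (Set.Ioi 0)) (nhds (2 * Real.cos (Real.pi / 8))) := by
      have hc : Continuous fun δ : ℝ =>
          2 * Real.cos (Real.pi / 8 - δ / 4) + 68 * δ ^ (3 / 2 : ℝ) := by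
        have : Continuous fun δ : ℝ => δ ^ (3 / 2 : ℝ) := Real.continuous_rpow_const (by norm_num)
        fun_prop
      have := hc.tendsto 0
      rw [Real.zero_rpow (by norm_num)] at this
      simp only [zero_div, sub_zero, mul_zero, add_zero] at this
      exact this.mono_left nhdsWithin_le_nhds
    refine ge_of_tendsto hc ?_
    filter_upwards [Ioo_mem_nhdsGT h1] with δ' hδ'
    refine (hanti δ' δ hδ'.1 hδ'.2.le h2).trans ?_
    have h4 := (abs_le.mp (abs_exp_mul_thetaRem_re_add_le hδ'.1 (hδ'.2.trans h2))).1
    simp only [hH]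
    linarith
  -- but `2 cos (π / 8 - δ / 4)` has a positive derivative at `0`
  have hd : HasDerivAt (fun δ : ℝ => 2 * Real.cos (Real.pi / 8 - δ / 4) - 68 * δ ^ (3 / 2 : ℝ))
      (1 / 2 * Real.sin (Real.pi / 8)) 0 := by
    have h1 : HasDerivAt (fun δ : ℝ => Real.pi / 8 - δ / 4) (-(1 / 4)) 0 :=
      ((hasDerivAt_id (0 : ℝ)).div_const 4).const_sub _
    have h2 := (h1.cos.const_mul 2).sub
      ((Real.hasDerivAt_rpow_const (x := 0) (p := 3 / 2) (Or.inr (by norm_num))).const_mul 68)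
    rw [Real.zero_rpow (by norm_num)] at h2
    refine h2.congr_deriv ?_
    simp
    ring
  have hsl := hd.tendsto_slope_zero_right
  have hneg : 1 / 2 * Real.sin (Real.pi / 8) ≤ 0 := by
    refine le_of_tendsto hsl ?_
    filter_upwards [Ioo_mem_nhdsGT (show (0 : ℝ) < Real.pi / 2 by positivity)] with δ hδ
    have h4 := (abs_le.mp (abs_exp_mul_thetaRem_re_add_le hδ.1 hδ.2)).2
    have h5 := hbound δ hδ.1 hδ.2
    simp only [hH] at h5
    rw [zero_add, Real.zero_rpow (by norm_num), smul_eq_mul]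
    refine mul_nonpos_of_nonneg_of_nonpos (inv_nonneg.mpr hδ.1.le) ?_
    simp only [zero_div, sub_zero, mul_zero]
    linarith
  have : 0 < Real.sin (Real.pi / 8) :=
    Real.sin_pos_of_pos_of_lt_pi (by positivity) (by linarith [Real.pi_pos])
  linarith

/-- The zeta function vanishes somewhere on the critical line (Hardy). -/
theorem exists_riemannZeta_half_add_eq_zero :
    ∃ t : ℝ, t ≠ 0 ∧ riemannZeta (1 / 2 + t * Complex.I) = 0 := by
  have hex : ∃ t : ℝ, 0 < t ∧ critZeta t = 0 := by
    by_contra! hne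
    have hre : ∀ t : ℝ, 0 < t → (critZeta t).re ≠ 0 := fun t ht h =>
      hne t ht (Complex.ext h (critZeta_im t))
    have hcont : Continuous fun t : ℝ => (critZeta t).re := Complex.continuous_re.comp continuous_critZeta
    have hsym : ∀ t : ℝ, (critZeta t).re = (critZeta |t|).re := by
      intro t
      rcases abs_choice t with h | h <;> rw [h]
      rw [critZeta_neg]
    have hext : ∀ (p : ℝ → Prop), IsClosed {x | p x} → (∀ t : ℝ, 0 < t → p (critZeta t).re) →
        ∀ t, p (critZeta t).re := by
      intro p hp hpos t
      have hz : p (critZeta 0).re := by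
        have h1 : Tendsto (fun t : ℝ => (critZeta t).re) (nhdsWithin 0 (Set.Ioi 0))
          (nhds (critZeta 0).re) := (hcont.tendsto 0).mono_left nhdsWithin_le_nhds
        exact hp.mem_of_tendsto h1 (eventually_mem_nhdsWithin.mono fun t ht => hpos t ht)
      rw [hsym]
      rcases (abs_nonneg t).eq_or_lt with h | h
      · rwa [← h]
      · exact hpos _ h
    by_cases h1 : ∀ t : ℝ, 0 < t → 0 ≤ (critZeta t).re
    · exact not_forall_critZeta_nonneg (hext (fun x => 0 ≤ x) isClosed_Ici h1)
    · push Not at h1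
      obtain ⟨a, ha, ha'⟩ := h1
      refine not_forall_critZeta_nonpos (hext (fun x => x ≤ 0) isClosed_Iic fun b hb => ?_)
      by_contra! hb'
      obtain ⟨c, hc, hc0⟩ := (isPreconnected_Ioi (a := (0 : ℝ))).intermediate_value
        (Set.mem_Ioi.mpr ha) (Set.mem_Ioi.mpr hb) hcont.continuousOn ⟨ha'.le, hb'.le⟩
      exact hre c hc hc0
  obtain ⟨t, ht, h0⟩ := hex
  refine ⟨2 * t, by positivity, ?_⟩
  rw [critZeta_eq] at h0
  have h1 : completedRiemannZeta (1 / 2 + ((2 * t : ℝ) : ℂ) * Complex.I) = 0 := by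
    push_cast
    simpa using h0
  rw [riemannZeta_def_of_ne_zero, h1, zero_div]
  intro h; have := congrArg Complex.re h; simp at this

/-! ### Landau's theorem and oscillation -/

theorem integrable_of_hasSum_of_summable_integral {α : Type*} [MeasurableSpace α]
    {μ : MeasureTheory.Measure α} {F : ℕ → α → ℝ} {f : α → ℝ}
    (hF : ∀ n, MeasureTheory.Integrable (F n) μ) (h0 : ∀ n, 0 ≤ᵐ[μ] F n)
    (hs : Summable fun n => ∫ x, F n x ∂μ) (hf : ∀ᵐ x ∂μ, HasSum (fun n => F n x) (f x))
    (hm : MeasureTheory.AEStronglyMeasurable f μ) : MeasureTheory.Integrable f μ := by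
  refine ⟨hm, ?_⟩
  rw [MeasureTheory.hasFiniteIntegral_iff_enorm]
  have hall : ∀ᵐ x ∂μ, ∀ n, 0 ≤ F n x := MeasureTheory.ae_all_iff.mpr h0
  have e1 : ∫⁻ x, ‖f x‖ₑ ∂μ = ∫⁻ x, ∑' n, ENNReal.ofReal (F n x) ∂μ := by
    refine MeasureTheory.lintegral_congr_ae ?_
    filter_upwards [hf, hall] with x hx hx0
    rw [← ENNReal.ofReal_tsum_of_nonneg hx0 hx.summable, hx.tsum_eq,
      Real.enorm_of_nonneg (hx.nonneg hx0)]
  rw [e1, MeasureTheory.lintegral_tsum fun n => (hF n).1.aemeasurable.ennreal_ofReal]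
  have e2 : ∀ n, ∫⁻ x, ENNReal.ofReal (F n x) ∂μ = ENNReal.ofReal (∫ x, F n x ∂μ) := fun n =>
    (MeasureTheory.ofReal_integral_eq_lintegral_ofReal (hF n) (h0 n)).symm
  simp only [e2]
  rw [← ENNReal.ofReal_tsum_of_nonneg (fun n => MeasureTheory.integral_nonneg_of_ae (h0 n)) hs]
  exact ENNReal.ofReal_lt_top

open ProbabilityTheory in
/-- **Landau's theorem** for Laplace transforms of measures on a half-line: if the transform of a
positive measure continues analytically along the real axis down to `a`, then the defining integral
converges down to `a`. The random variable `X` is the negative of the usual integration variable. -/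
theorem landau_complexMGF {Ω : Type*} [MeasurableSpace Ω] {μ : MeasureTheory.Measure Ω} {X : Ω → ℝ}
    (hX : AEMeasurable X μ) (hX0 : ∀ᵐ ω ∂μ, X ω ≤ 0) {a b : ℝ} {g : ℂ → ℂ} {U : Set ℂ}
    (hU : IsOpen U) (hreal : ∀ σ : ℝ, a < σ → (σ : ℂ) ∈ U) (hg : DifferentiableOn ℂ g U)
    (hint : ∀ σ : ℝ, b < σ → σ ∈ integrableExpSet X μ)
    (heq : ∀ σ : ℝ, b < σ → g σ = complexMGF X μ σ) :
    ∀ σ : ℝ, a < σ → σ ∈ integrableExpSet X μ ∧ g σ = complexMGF X μ σ := by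
  have hup : ∀ t t' : ℝ, t ∈ integrableExpSet X μ → t ≤ t' → t' ∈ integrableExpSet X μ := by
    intro t t' ht htt'
    refine MeasureTheory.Integrable.mono ht ?_ ?_
    · exact (hX.const_mul t').exp.aestronglyMeasurable
    · filter_upwards [hX0] with ω hω
      rw [Real.norm_eq_abs, Real.norm_eq_abs, Real.abs_exp, Real.abs_exp, Real.exp_le_exp]
      nlinarith
  -- the two functions agree wherever both are analytic
  have hid : ∀ s : ℝ, a ≤ s → Set.Ioi s ⊆ integrableExpSet X μ → ∀ σ : ℝ, s < σ →
      g σ = complexMGF X μ σ := by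
    intro s has hs σ hσ
    have hint' : Set.Ioi s ⊆ interior (integrableExpSet X μ) := interior_maximal hs isOpen_Ioi
    have hA : AnalyticOnNhd ℝ (fun x : ℝ => g x) (Set.Ioi s) := by
      intro x hx
      have h1 : AnalyticAt ℂ g (x : ℂ) := hg.analyticAt (hU.mem_nhds (hreal x (has.trans_lt hx)))
      exact (h1.restrictScalars (𝕜 := ℝ)).comp (Complex.ofRealCLM.analyticAt x)
    have hB : AnalyticOnNhd ℝ (fun x : ℝ => complexMGF X μ x) (Set.Ioi s) := by
      intro x hx
      have h1 : AnalyticAt ℂ (complexMGF X μ) (x : ℂ) :=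
        analyticAt_complexMGF (by simpa using hint' hx)
      exact (h1.restrictScalars (𝕜 := ℝ)).comp (Complex.ofRealCLM.analyticAt x)
    have hz : max s b + 1 ∈ Set.Ioi s := by
      have := le_max_left s b
      exact Set.mem_Ioi.mpr (by linarith)
    refine hA.eqOn_of_preconnected_of_eventuallyEq hB isPreconnected_Ioi hz ?_ hσ
    filter_upwards [lt_mem_nhds (show b < max s b + 1 by linarith [le_max_right s b])] with x hx
    exact heq x hx
  suffices hmain : ∀ σ : ℝ, a < σ → σ ∈ integrableExpSet X μ from fun σ hσ =>
    ⟨hmain σ hσ, hid a le_rfl (fun x hx => hmain x hx) σ hσ⟩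
  by_contra! hcon
  obtain ⟨σ₀, hσ₀, hnot⟩ := hcon
  have hbdd : BddBelow (integrableExpSet X μ) := ⟨σ₀, fun x hx => by
    by_contra! hlt
    exact hnot (hup x σ₀ hx hlt.le)⟩
  have hne : (integrableExpSet X μ).Nonempty := ⟨b + 1, hint _ (by linarith)⟩
  set s := sInf (integrableExpSet X μ) with hs
  have hσs : σ₀ ≤ s := le_csInf hne fun x hx => by
    by_contra! hlt
    exact hnot (hup x σ₀ hx hlt.le)
  have hIoi : Set.Ioi s ⊆ integrableExpSet X μ := by
    intro x hx
    obtain ⟨y, hy, hyx⟩ := exists_lt_of_csInf_lt hne hx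
    exact hup y x hy hyx.le
  have hIint : Set.Ioi s ⊆ interior (integrableExpSet X μ) := interior_maximal hIoi isOpen_Ioi
  obtain ⟨ε, hε, hball⟩ := Metric.isOpen_iff.mp hU s (hreal s (hσ₀.trans_le hσs))
  -- expand at `s + r` in powers of `z - (s + r)`; the disc of convergence contains `s - r`
  set r := ε / 4 with hr
  have hr0 : 0 < r := by positivity
  have hgball : DifferentiableOn ℂ g (Metric.ball ((s + r : ℝ) : ℂ) (3 * r)) := by
    refine hg.mono fun z hz => hball ?_
    rw [Metric.mem_ball] at hz ⊢
    have h1 := dist_triangle z ((s + r : ℝ) : ℂ) (s : ℂ)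
    have h2 : dist ((s + r : ℝ) : ℂ) (s : ℂ) = r := by
      rw [dist_eq_norm]; push_cast
      rw [add_sub_cancel_left, Complex.norm_real, Real.norm_of_nonneg hr0.le]
    linarith
  have hmem : ((s - r : ℝ) : ℂ) ∈ Metric.ball ((s + r : ℝ) : ℂ) (3 * r) := by
    rw [Metric.mem_ball, dist_eq_norm, ← Complex.ofReal_sub, Complex.norm_real, Real.norm_eq_abs]
    rw [show s - r - (s + r) = -(2 * r) by ring, abs_neg, abs_of_pos (by positivity)]
    linarith
  have hT := Complex.hasSum_taylorSeries_on_ball hgball hmem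
  have hb0 : ((s + r : ℝ) : ℂ).re ∈ interior (integrableExpSet X μ) := by
    rw [Complex.ofReal_re]; exact hIint (Set.mem_Ioi.mpr (by linarith))
  have hev : g =ᶠ[nhds ((s + r : ℝ) : ℂ)] complexMGF X μ := by
    have h1 : AnalyticAt ℂ g ((s + r : ℝ) : ℂ) :=
      hg.analyticAt (hU.mem_nhds (hreal _ (by linarith)))
    refine (h1.frequently_eq_iff_eventually_eq (analyticAt_complexMGF hb0)).mp ?_
    have hmap : Tendsto (fun n : ℕ => ((s + r + 1 / ((n : ℝ) + 1) : ℝ) : ℂ)) atTop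
        (nhdsWithin ((s + r : ℝ) : ℂ) {((s + r : ℝ) : ℂ)}ᶜ) := by
      rw [tendsto_nhdsWithin_iff]
      constructor
      · have h := (tendsto_one_div_add_atTop_nhds_zero_nat (𝕜 := ℝ)).const_add (s + r)
        rw [add_zero] at h
        exact (Complex.continuous_ofReal.tendsto _).comp h
      · refine Eventually.of_forall fun n => ?_
        have : 0 < 1 / ((n : ℝ) + 1) := by positivity
        simp only [Set.mem_compl_iff, Set.mem_singleton_iff, Complex.ofReal_inj]
        linarith
    refine hmap.frequently (Frequently.of_forall fun n => ?_)
    have : 0 < 1 / ((n : ℝ) + 1) := by positivity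
    exact hid s (hσ₀.le.trans hσs) hIoi _ (by linarith)
  set F : ℕ → Ω → ℝ := fun n ω =>
    (2 * r * |X ω|) ^ n / (n.factorial : ℝ) * Real.exp ((s + r) * X ω) with hF
  have hFint : ∀ n, MeasureTheory.Integrable (F n) μ := by
    intro n
    have h := integrable_pow_abs_mul_exp_of_mem_interior_integrableExpSet
      (by simpa using hb0 : s + r ∈ interior (integrableExpSet X μ)) n
    refine (h.const_mul ((2 * r) ^ n / (n.factorial : ℝ))).congr (Eventually.of_forall fun ω => ?_)
    simp only [hF, mul_pow]
    ring
  have hterm : ∀ n : ℕ, ((n.factorial : ℂ)⁻¹ • (((s - r : ℝ) : ℂ) - ((s + r : ℝ) : ℂ)) ^ n •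
      iteratedDeriv n g ((s + r : ℝ) : ℂ)) = ((∫ ω, F n ω ∂μ : ℝ) : ℂ) := by
    intro n
    rw [hev.iteratedDeriv_eq, iteratedDeriv_complexMGF hb0, smul_eq_mul, smul_eq_mul,
      ← MeasureTheory.integral_const_mul, ← MeasureTheory.integral_const_mul, ← integral_complex_ofReal]
    refine MeasureTheory.integral_congr_ae ?_
    filter_upwards [hX0] with ω hω
    simp only [hF, abs_of_nonpos hω]
    rw [show ((s - r : ℝ) : ℂ) - ((s + r : ℝ) : ℂ) = -(2 * r) by push_cast; ring]
    push_cast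
    rw [mul_pow, neg_pow, neg_pow (X ω : ℂ), mul_pow]
    have : (-1 : ℂ) ^ n * (-1) ^ n = 1 := by rw [← mul_pow]; simp
    field_simp
  have hsum : Summable fun n => ∫ ω, F n ω ∂μ := by
    have := hT.summable
    simp only [hterm] at this
    exact Complex.summable_ofReal.mp this
  have hfin : MeasureTheory.Integrable (fun ω => Real.exp ((s - r) * X ω)) μ := by
    refine integrable_of_hasSum_of_summable_integral hFint
      (fun n => Eventually.of_forall fun ω => ?_) hsum ?_
      (hX.const_mul _).exp.aestronglyMeasurable
    · simp only [hF, Pi.zero_apply]; positivity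
    · filter_upwards [hX0] with ω hω
      have h1 := (NormedSpace.expSeries_div_hasSum_exp (2 * r * |X ω|)).mul_right
        (Real.exp ((s + r) * X ω))
      have e : 2 * r * |X ω| + (s + r) * X ω = (s - r) * X ω := by
        rw [abs_of_nonpos hω]; ring
      rw [← Real.exp_eq_exp_ℝ, ← Real.exp_add, e] at h1
      exact h1
  have := csInf_le hbdd hfin
  linarith

theorem integrableOn_cpow_Ioi_one {z : ℂ} (hz : z.re < -1) :
    MeasureTheory.IntegrableOn (fun x : ℝ => (x : ℂ) ^ z) (Set.Ioi 1) :=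
  integrableOn_Ioi_cpow_of_lt hz one_pos

theorem integral_cpow_Ioi_one {z : ℂ} (hz : 0 < z.re) :
    ∫ x in Set.Ioi (1 : ℝ), (x : ℂ) ^ (-z - 1) = 1 / z := by
  rw [integral_Ioi_cpow_of_lt (by simp; linarith) one_pos]
  simp only [Complex.ofReal_one, Complex.one_cpow, sub_add_cancel]
  rw [neg_div_neg_eq]

open ProbabilityTheory in
/-- The quantitative step of the oscillation theorem: a one-sided bound `E x ≤ c x ^ θ` for large
`x` controls the transform of `E` on the line `re w = θ`. A pole of `D / Z` at a zero `w₀` of `Z` on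
this line has residue at most `c`, and there are no poles to its right. -/
theorem norm_le_of_eventually_le {E : ℝ → ℝ} (hE : Measurable E)
    (hbd : ∀ Y : ℝ, ∃ C : ℝ, ∀ x ∈ Set.Icc 1 Y, |E x| ≤ C) {θ b : ℝ} (hθ : 0 < θ) (hθb : θ ≤ b)
    (hint : ∀ w : ℂ, b < w.re →
      MeasureTheory.IntegrableOn (fun x : ℝ => (E x : ℂ) * (x : ℂ) ^ (-w - 1)) (Set.Ioi 1))
    {Z D : ℂ → ℂ} (hZ : DifferentiableOn ℂ Z {w | 0 < w.re})
    (hD : DifferentiableOn ℂ D {w | 0 < w.re}) (hZ0 : ∀ σ : ℝ, θ ≤ σ → Z σ ≠ 0)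
    (hZD : ∀ w : ℂ, b < w.re →
      Z w * ∫ x in Set.Ioi (1 : ℝ), (E x : ℂ) * (x : ℂ) ^ (-w - 1) = D w)
    {c : ℝ} (hc : 0 < c) (hle : ∀ᶠ x in atTop, E x ≤ c * x ^ θ)
    {w₀ : ℂ} (hw₀ : θ ≤ w₀.re) (hz₀ : Z w₀ = 0) : ‖D w₀‖ ≤ ‖deriv Z w₀‖ * c := by
  obtain ⟨Y, hY⟩ := eventually_atTop.mp hle
  obtain ⟨C', hC'⟩ := hbd Y
  set C := max C' 0 with hCdef
  have hC0 : 0 ≤ C := le_max_right _ _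
  -- adding a constant makes the bound hold from `1` on
  have hf0 : ∀ x : ℝ, 1 < x → 0 ≤ c * x ^ θ + C - E x := by
    intro x hx
    have hxp : 0 ≤ c * x ^ θ := by have : 0 < x := by linarith
                                   positivity
    rcases le_total Y x with h | h
    · linarith [hY x h]
    · have := (le_abs_self _).trans (hC' x ⟨hx.le, h⟩)
      linarith [le_max_left C' 0]
  set f : ℝ → ℝ := fun x => c * x ^ θ + C - E x with hf
  have hfm : Measurable f := by
    have : Measurable fun x : ℝ => x ^ θ := measurable_id.pow_const θ
    fun_prop
  set ν : MeasureTheory.Measure ℝ := MeasureTheory.volume.restrict (Set.Ioi 1) with hν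
  set dens : ℝ → ENNReal := fun x => ENNReal.ofReal (f x * x⁻¹) with hdens
  have hdm : Measurable dens := by fun_prop
  set μ : MeasureTheory.Measure ℝ := ν.withDensity dens with hμ
  set X : ℝ → ℝ := fun x => -Real.log x with hX
  have hXm : Measurable X := Real.measurable_log.neg
  have hac : ∀ p : ℝ → Prop, (∀ x, 1 < x → p x) → ∀ᵐ x ∂ν, p x := by
    intro p hp
    filter_upwards [MeasureTheory.ae_restrict_mem measurableSet_Ioi] with x hx using hp x hx
  have hX0 : ∀ᵐ x ∂μ, X x ≤ 0 := by
    refine (MeasureTheory.withDensity_absolutelyContinuous ν dens) (hac _ fun x hx => ?_)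
    simp only [hX]
    linarith [Real.log_nonneg hx.le]
  have hdt : ∀ x : ℝ, 1 < x → (dens x).toReal = f x * x⁻¹ := by
    intro x hx
    refine ENNReal.toReal_ofReal (mul_nonneg (hf0 x hx) (by positivity))
  have hfin : ∀ᵐ x ∂ν, dens x < ⊤ := Eventually.of_forall fun x => ENNReal.ofReal_lt_top
  have hker : ∀ x : ℝ, 1 < x → ∀ w : ℂ, (dens x).toReal • Complex.exp (w * X x) =
      c * (x : ℂ) ^ (-(w - θ) - 1) + C * (x : ℂ) ^ (-w - 1) - (E x : ℂ) * (x : ℂ) ^ (-w - 1) := by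
    intro x hx w
    have hx0 : (0 : ℝ) < x := by linarith
    have hxc : (x : ℂ) ≠ 0 := by exact_mod_cast hx0.ne'
    have e1 : Complex.exp (w * X x) = (x : ℂ) ^ (-w) := by
      rw [Complex.cpow_def_of_ne_zero hxc, ← Complex.ofReal_log hx0.le]
      simp only [hX]; push_cast; ring_nf
    have e2 : (x : ℂ) ^ (-w - 1) = (x : ℂ) ^ (-w) * (x : ℂ)⁻¹ := by
      rw [Complex.cpow_sub _ _ hxc, Complex.cpow_one, div_eq_mul_inv]
    have e3 : (x : ℂ) ^ (-(w - θ) - 1) = ((x ^ θ : ℝ) : ℂ) * (x : ℂ) ^ (-w - 1) := by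
      rw [Complex.ofReal_cpow hx0.le, ← Complex.cpow_add _ _ hxc]; ring_nf
    rw [hdt x hx, e1, e3, e2, Complex.real_smul, hf]
    push_cast
    ring
  have hI1 : ∀ w : ℂ, b < w.re → MeasureTheory.Integrable
      (fun x : ℝ => (c : ℂ) * (x : ℂ) ^ (-(w - θ) - 1)) ν := fun w hw =>
    (integrableOn_cpow_Ioi_one (by simp; linarith)).const_mul _
  have hI2 : ∀ w : ℂ, b < w.re → MeasureTheory.Integrable
      (fun x : ℝ => (C : ℂ) * (x : ℂ) ^ (-w - 1)) ν := fun w hw =>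
    (integrableOn_cpow_Ioi_one (by simp; linarith)).const_mul _
  have hIall : ∀ w : ℂ, b < w.re → MeasureTheory.Integrable (fun x => Complex.exp (w * X x)) μ := by
    intro w hw
    rw [hμ, MeasureTheory.integrable_withDensity_iff_integrable_smul' hdm hfin]
    refine (((hI1 w hw).add (hI2 w hw)).sub (hint w hw)).congr (hac _ fun x hx => ?_)
    exact (hker x hx w).symm
  have hmgf : ∀ w : ℂ, b < w.re → complexMGF X μ w = c / (w - θ) + C / w -
      ∫ x in Set.Ioi (1 : ℝ), (E x : ℂ) * (x : ℂ) ^ (-w - 1) := by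
    intro w hw
    have h1 : 0 < (w - θ).re := by simp; linarith
    have h2 : 0 < w.re := by linarith
    rw [complexMGF, hμ, integral_withDensity_eq_integral_toReal_smul hdm hfin]
    rw [MeasureTheory.integral_congr_ae (hac _ fun x hx => hker x hx w)]
    have hi := hint w hw
    have h12 : MeasureTheory.Integrable (fun x : ℝ =>
        (c : ℂ) * (x : ℂ) ^ (-(w - θ) - 1) + C * (x : ℂ) ^ (-w - 1)) ν := (hI1 w hw).add (hI2 w hw)
    rw [MeasureTheory.integral_sub h12 hi,
      MeasureTheory.integral_add (hI1 w hw) (hI2 w hw), MeasureTheory.integral_const_mul,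
      MeasureTheory.integral_const_mul, hν, integral_cpow_Ioi_one h1, integral_cpow_Ioi_one h2]
    ring
  -- the continuation of the transform of `f`
  set g : ℂ → ℂ := fun w => c / (w - θ) + C / w - D w / Z w with hg
  set U : Set ℂ := {w | θ < w.re} ∩ Z ⁻¹' {0}ᶜ with hU
  have hHo : IsOpen {w : ℂ | θ < w.re} := isOpen_lt continuous_const Complex.continuous_re
  have hHsub : {w : ℂ | θ < w.re} ⊆ {w | 0 < w.re} := fun w hw => hθ.trans hw
  have hUo : IsOpen U :=
    (hZ.mono hHsub).continuousOn.isOpen_inter_preimage hHo isOpen_compl_singleton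
  have hne1 : ∀ w : ℂ, θ < w.re → w - θ ≠ 0 := by
    intro w hw h
    have := congrArg Complex.re h
    simp at this
    linarith
  have hne2 : ∀ w : ℂ, θ < w.re → w ≠ 0 := by
    rintro w hw rfl
    simp at hw
    linarith
  have hpol : DifferentiableOn ℂ (fun w : ℂ => c / (w - θ) + C / w) {w | θ < w.re} := by
    intro w hw
    refine DifferentiableAt.differentiableWithinAt ?_
    refine DifferentiableAt.add ?_ ?_
    · exact (differentiableAt_const _).div (by fun_prop) (hne1 w hw)
    · exact (differentiableAt_const _).div (by fun_prop) (hne2 w hw)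
  have hgd : DifferentiableOn ℂ g U := by
    refine DifferentiableOn.sub (hpol.mono Set.inter_subset_left) ?_
    refine DifferentiableOn.div (hD.mono fun w hw => hHsub hw.1) (hZ.mono fun w hw => hHsub hw.1) ?_
    exact fun w hw => hw.2
  have hL := landau_complexMGF (b := b) hXm.aemeasurable hX0 hUo
    (fun σ hσ => ⟨by simpa using hσ, hZ0 σ hσ.le⟩) hgd
    (fun σ hσ => by
      have h := (hIall σ (by simpa using hσ)).norm
      refine h.congr (Eventually.of_forall fun x => ?_)
      simp only [← Complex.ofReal_mul]
      rw [Complex.norm_exp_ofReal])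
    (fun σ hσ => by
      rw [hmgf σ (by simpa using hσ), ← mul_div_cancel_left₀ (∫ x in Set.Ioi (1 : ℝ), _)
        (hZ0 σ (hθb.trans hσ.le)), hZD σ (by simpa using hσ)])
  have hintr : Set.Ioi θ ⊆ interior (integrableExpSet X μ) :=
    interior_maximal (fun σ hσ => (hL σ hσ).1) isOpen_Ioi
  -- the identity holds on the whole half plane
  have hid : ∀ w : ℂ, θ < w.re → Z w * (complexMGF X μ w - (c / (w - θ) + C / w)) = -D w := by
    have hA : AnalyticOnNhd ℂ (fun w => Z w * (complexMGF X μ w - (c / (w - θ) + C / w)))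
        {w | θ < w.re} := by
      refine DifferentiableOn.analyticOnNhd ?_ hHo
      refine (hZ.mono hHsub).mul (DifferentiableOn.sub ?_ hpol)
      exact differentiableOn_complexMGF.mono fun w hw => hintr hw
    have hB : AnalyticOnNhd ℂ (fun w => -D w) {w | θ < w.re} :=
      DifferentiableOn.analyticOnNhd (hD.mono hHsub).neg hHo
    refine fun w hw => hA.eqOn_of_preconnected_of_eventuallyEq hB
      (convex_halfSpace_re_gt θ).isPreconnected (z₀ := ((b + 1 : ℝ) : ℂ)) ?_ ?_ hw
    · change θ < ((b + 1 : ℝ) : ℂ).re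
      rw [Complex.ofReal_re]; linarith
    · have hopen : IsOpen {w : ℂ | b < w.re} := isOpen_lt continuous_const Complex.continuous_re
      filter_upwards [hopen.mem_nhds (show ((b + 1 : ℝ) : ℂ) ∈ {w : ℂ | b < w.re} by simp)] with w hw
      rw [← hZD w hw, hmgf w hw]
      ring
  rcases hw₀.lt_or_eq with hlt | heq
  · have h := hid w₀ hlt
    rw [hz₀, zero_mul] at h
    rw [neg_eq_zero.mp h.symm, norm_zero]
    positivity
  -- on the boundary line, approach `w₀` horizontally
  have hw₀θ : w₀ ≠ θ := by
    rintro rfl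
    exact hZ0 θ le_rfl hz₀
  set S : ℝ → ℝ := fun ε => C / (θ + ε) + ‖D ((θ + ε : ℝ) : ℂ) / Z ((θ + ε : ℝ) : ℂ)‖ +
    c / ‖w₀ + ε - θ‖ + C / ‖w₀ + ε‖ with hS
  have hkey : ∀ ε : ℝ, 0 < ε → ‖D (w₀ + ε)‖ ≤ ‖(ε : ℂ)⁻¹ • (Z (w₀ + ε) - Z w₀)‖ * (c + ε * S ε) := by
    intro ε hε
    have hre : (w₀ + ε).re = θ + ε := by simp [heq]
    have h1 := hid (w₀ + ε) (by rw [hre]; linarith)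
    have h2 : ‖complexMGF X μ (w₀ + ε)‖ ≤ c / ε + C / (θ + ε) +
        ‖D ((θ + ε : ℝ) : ℂ) / Z ((θ + ε : ℝ) : ℂ)‖ := by
      refine norm_complexMGF_le_mgf.trans ?_
      rw [hre, ← re_complexMGF_ofReal, ← (hL (θ + ε) (by linarith)).2]
      refine (Complex.re_le_norm _).trans ?_
      simp only [hg]
      refine (norm_sub_le _ _).trans (add_le_add_left ((norm_add_le _ _).trans (le_of_eq ?_)) _)
      rw [norm_div, norm_div, Complex.norm_of_nonneg hc.le, Complex.norm_of_nonneg hC0]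
      rw [show ((θ + ε : ℝ) : ℂ) - θ = (ε : ℂ) by push_cast; ring, Complex.norm_of_nonneg hε.le,
        Complex.norm_of_nonneg (by linarith : 0 ≤ θ + ε)]
    have h3 : ‖(c : ℂ) / (w₀ + ε - θ) + C / (w₀ + ε)‖ ≤ c / ‖w₀ + ε - θ‖ + C / ‖w₀ + ε‖ := by
      refine (norm_add_le _ _).trans (le_of_eq ?_)
      rw [norm_div, norm_div, Complex.norm_of_nonneg hc.le, Complex.norm_of_nonneg hC0]
    rw [← norm_neg, ← h1, norm_mul, hz₀, sub_zero, norm_smul, norm_inv, Complex.norm_of_nonneg hε.le]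
    have h4 : ‖complexMGF X μ (w₀ + ε) - (c / (w₀ + ε - θ) + C / (w₀ + ε))‖ ≤ c / ε + S ε := by
      refine (norm_sub_le _ _).trans ?_
      simp only [hS]
      linarith
    calc _ ≤ ‖Z (w₀ + ε)‖ * (c / ε + S ε) := by gcongr
      _ = _ := by field_simp
  have hw₀re : 0 < w₀.re := hθ.trans_le hw₀
  have hHzero : IsOpen {w : ℂ | 0 < w.re} := isOpen_lt continuous_const Complex.continuous_re
  have hDc : ContinuousAt D w₀ := (hD.differentiableAt (hHzero.mem_nhds hw₀re)).continuousAt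
  have hZd : HasDerivAt Z (deriv Z w₀) w₀ := (hZ.differentiableAt (hHzero.mem_nhds hw₀re)).hasDerivAt
  have hof : Tendsto (fun ε : ℝ => (ε : ℂ)) (nhdsWithin 0 (Set.Ioi 0)) (nhdsWithin 0 {0}ᶜ) := by
    rw [tendsto_nhdsWithin_iff]
    constructor
    · have := (Complex.continuous_ofReal.tendsto 0).mono_left
        (nhdsWithin_le_nhds (s := Set.Ioi (0 : ℝ)))
      simpa using this
    · filter_upwards [self_mem_nhdsWithin] with ε hε
      simpa using (ne_of_gt (Set.mem_Ioi.mp hε))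
  have hof0 : Tendsto (fun ε : ℝ => w₀ + (ε : ℂ)) (nhdsWithin 0 (Set.Ioi 0)) (nhds w₀) := by
    have := (hof.mono_right nhdsWithin_le_nhds).const_add w₀
    rwa [add_zero] at this
  have hlim1 : Tendsto (fun ε : ℝ => ‖D (w₀ + ε)‖) (nhdsWithin 0 (Set.Ioi 0)) (nhds ‖D w₀‖) :=
    (hDc.tendsto.comp hof0).norm
  have hlim2 : Tendsto (fun ε : ℝ => ‖(ε : ℂ)⁻¹ • (Z (w₀ + ε) - Z w₀)‖) (nhdsWithin 0 (Set.Ioi 0))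
      (nhds ‖deriv Z w₀‖) := (hZd.tendsto_slope_zero.comp hof).norm
  have hlimS : Tendsto (fun ε : ℝ => c + ε * S ε) (nhdsWithin 0 (Set.Ioi 0)) (nhds c) := by
    have hSc : ContinuousAt S 0 := by
      have hθre : ((θ : ℂ)).re = θ := Complex.ofReal_re θ
      have hDθ : ContinuousAt D ((θ + 0 : ℝ) : ℂ) := by
        rw [add_zero]
        exact (hD.differentiableAt (hHzero.mem_nhds (by simpa using hθ))).continuousAt
      have hZθ : ContinuousAt Z ((θ + 0 : ℝ) : ℂ) := by
        rw [add_zero]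
        exact (hZ.differentiableAt (hHzero.mem_nhds (by simpa using hθ))).continuousAt
      have hlin : ContinuousAt (fun ε : ℝ => ((θ + ε : ℝ) : ℂ)) 0 := by fun_prop
      have hDZ : ContinuousAt (fun ε : ℝ => D ((θ + ε : ℝ) : ℂ) / Z ((θ + ε : ℝ) : ℂ)) 0 := by
        refine ContinuousAt.div (ContinuousAt.comp (g := D) hDθ hlin)
          (ContinuousAt.comp (g := Z) hZθ hlin) ?_
        rw [add_zero]; exact hZ0 θ le_rfl
      have hn0 : w₀ ≠ 0 := by rintro rfl; simp at hw₀re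
      refine ContinuousAt.add (ContinuousAt.add (ContinuousAt.add ?_ hDZ.norm) ?_) ?_
      · exact continuousAt_const.div (by fun_prop) (by rw [add_zero]; exact hθ.ne')
      · refine continuousAt_const.div (by fun_prop) ?_
        simpa [sub_eq_zero] using hw₀θ
      · exact continuousAt_const.div (by fun_prop) (by simpa using hn0)
    have h0 : ContinuousAt (fun ε : ℝ => c + ε * S ε) 0 :=
      continuousAt_const.add (continuousAt_id.mul hSc)
    have := h0.tendsto.mono_left (nhdsWithin_le_nhds (s := Set.Ioi (0 : ℝ)))
    simpa using this
  refine le_of_tendsto_of_tendsto hlim1 (hlim2.mul hlimS) ?_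
  filter_upwards [self_mem_nhdsWithin] with ε hε using hkey ε hε

/-- **Oscillation theorem.** Suppose the transform `∫ E x x ^ (-w - 1) dx` equals `D / Z` with `D`,
`Z` holomorphic for `re w > 0` and `Z` free of real zeros in `[θ, ∞)`. If `E` is eventually at most
`c x ^ θ` for every `c > 0`, then `D` vanishes at all zeros of `Z` with `re w ≥ θ`. -/
theorem eq_zero_of_forall_eventually_le {E : ℝ → ℝ} (hE : Measurable E)
    (hbd : ∀ Y : ℝ, ∃ C : ℝ, ∀ x ∈ Set.Icc 1 Y, |E x| ≤ C) {θ b : ℝ} (hθ : 0 < θ) (hθb : θ ≤ b)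
    (hint : ∀ w : ℂ, b < w.re →
      MeasureTheory.IntegrableOn (fun x : ℝ => (E x : ℂ) * (x : ℂ) ^ (-w - 1)) (Set.Ioi 1))
    {Z D : ℂ → ℂ} (hZ : DifferentiableOn ℂ Z {w | 0 < w.re})
    (hD : DifferentiableOn ℂ D {w | 0 < w.re}) (hZ0 : ∀ σ : ℝ, θ ≤ σ → Z σ ≠ 0)
    (hZD : ∀ w : ℂ, b < w.re →
      Z w * ∫ x in Set.Ioi (1 : ℝ), (E x : ℂ) * (x : ℂ) ^ (-w - 1) = D w)
    (hle : ∀ c : ℝ, 0 < c → ∀ᶠ x in atTop, E x ≤ c * x ^ θ)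
    {w₀ : ℂ} (hw₀ : θ ≤ w₀.re) (hz₀ : Z w₀ = 0) : D w₀ = 0 := by
  have hlim : Tendsto (fun c : ℝ => ‖deriv Z w₀‖ * c) (nhdsWithin 0 (Set.Ioi 0)) (nhds 0) := by
    have h : Continuous fun c : ℝ => ‖deriv Z w₀‖ * c := by fun_prop
    have := (h.tendsto 0).mono_left (nhdsWithin_le_nhds (s := Set.Ioi (0 : ℝ)))
    simpa using this
  have h0 : ‖D w₀‖ ≤ 0 := by
    refine ge_of_tendsto hlim ?_
    filter_upwards [self_mem_nhdsWithin] with c hc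
    exact norm_le_of_eventually_le hE hbd hθ hθb hint hZ hD hZ0 hZD hc (hle c hc) hw₀ hz₀
  exact norm_le_zero_iff.mp h0

/-! ### Euler products -/

/-- The coefficient `a_p` in the Euler factor `1 + (1 + a_p) p ^ (-w)` attached to the singular
series: `a_2 = -1` and `a_p = 2 / (p - 2)` for odd `p`. -/
noncomputable def eulerCoeff (p : ℕ) : ℝ := if p = 2 then -1 else 2 / ((p : ℝ) - 2)

theorem eulerCoeff_two : eulerCoeff 2 = -1 := by simp [eulerCoeff]

theorem eulerCoeff_of_two_lt {p : ℕ} (hp : 2 < p) : eulerCoeff p = 2 / ((p : ℝ) - 2) := by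
  rw [eulerCoeff, if_neg (by omega)]

theorem abs_eulerCoeff_le {p : ℕ} (hp : 2 ≤ p) : |eulerCoeff p| ≤ 6 / p := by
  rcases hp.eq_or_lt with h | h
  · subst h
    rw [eulerCoeff_two]; norm_num
  · have h3 : (3 : ℝ) ≤ p := by exact_mod_cast h
    rw [eulerCoeff_of_two_lt h, abs_of_pos (by apply div_pos <;> linarith),
      div_le_div_iff₀ (by linarith) (by linarith)]
    linarith

theorem norm_natCast_cpow {n : ℕ} (hn : 0 < n) (w : ℂ) : ‖(n : ℂ) ^ w‖ = (n : ℝ) ^ w.re :=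
  Complex.norm_natCast_cpow_of_pos hn w

theorem le_norm_natCast_cpow_add_one {n : ℕ} (hn : 2 ≤ n) {σ : ℝ} (hσ : 0 < σ) {w : ℂ}
    (hw : σ ≤ w.re) : (1 - (2 : ℝ) ^ (-σ)) * (n : ℝ) ^ σ ≤ ‖(n : ℂ) ^ w + 1‖ := by
  have hn' : (2 : ℝ) ≤ n := by exact_mod_cast hn
  have h1 : ‖(n : ℂ) ^ w‖ - 1 ≤ ‖(n : ℂ) ^ w + 1‖ := by
    have := norm_sub_norm_le ((n : ℂ) ^ w) (-1)
    simpa using this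
  rw [norm_natCast_cpow (by omega)] at h1
  have h2 : (n : ℝ) ^ σ ≤ (n : ℝ) ^ w.re := Real.rpow_le_rpow_of_exponent_le (by linarith) hw
  have h3 : 1 ≤ (2 : ℝ) ^ (-σ) * (n : ℝ) ^ σ := by
    have : (2 : ℝ) ^ σ ≤ (n : ℝ) ^ σ := Real.rpow_le_rpow (by norm_num) hn' hσ.le
    calc (1 : ℝ) = (2 : ℝ) ^ (-σ) * 2 ^ σ := by
          rw [← Real.rpow_add (by norm_num)]; simp
      _ ≤ _ := by gcongr
  nlinarith

theorem one_sub_two_rpow_pos {σ : ℝ} (hσ : 0 < σ) : 0 < 1 - (2 : ℝ) ^ (-σ) := by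
  have : (2 : ℝ) ^ (-σ) < 1 := Real.rpow_lt_one_of_one_lt_of_neg (by norm_num) (by linarith)
  linarith

theorem natCast_cpow_add_one_ne_zero {n : ℕ} (hn : 2 ≤ n) {w : ℂ} (hw : 0 < w.re) :
    (n : ℂ) ^ w + 1 ≠ 0 := by
  have h := le_norm_natCast_cpow_add_one hn hw le_rfl
  have h0 : (0 : ℝ) < n := by exact_mod_cast (by omega : 0 < n)
  have : 0 < (1 - (2 : ℝ) ^ (-w.re)) * (n : ℝ) ^ w.re :=
    mul_pos (one_sub_two_rpow_pos hw) (Real.rpow_pos_of_pos h0 _)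
  exact norm_pos_iff.1 (this.trans_le h)

theorem summable_primes_rpow {σ : ℝ} (hσ : 0 < σ) (C : ℝ) :
    Summable fun p : Nat.Primes => C * (p : ℝ) ^ (-1 - σ) :=
  (Nat.Primes.summable_rpow.2 (by linarith)).mul_left C

/-- The deviation from `1` of the Euler factor at `p` of `correctionProduct`. -/
noncomputable def correctionTerm (p : Nat.Primes) (w : ℂ) : ℂ :=
  (eulerCoeff p : ℂ) / ((p : ℂ) ^ w + 1)

/-- The Euler product `Q(w) = ∏_p (1 + a_p / (p ^ w + 1))`, which converges absolutely for
`0 < re w` and relates the Dirichlet series of the singular series to the zeta function. -/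
noncomputable def correctionProduct (w : ℂ) : ℂ := ∏' p : Nat.Primes, (1 + correctionTerm p w)

theorem norm_correctionTerm_le {σ : ℝ} (hσ : 0 < σ) {w : ℂ} (hw : σ ≤ w.re) (p : Nat.Primes) :
    ‖correctionTerm p w‖ ≤ 6 / (1 - (2 : ℝ) ^ (-σ)) * (p : ℝ) ^ (-1 - σ) := by
  have hp : 2 ≤ (p : ℕ) := p.2.two_le
  have h0 : (0 : ℝ) < (p : ℕ) := by exact_mod_cast (by omega : 0 < (p : ℕ))
  have h1 := le_norm_natCast_cpow_add_one hp hσ hw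
  have h2 := one_sub_two_rpow_pos hσ
  have h3 : (0 : ℝ) < ((p : ℕ) : ℝ) ^ σ := Real.rpow_pos_of_pos h0 _
  rw [correctionTerm, norm_div, Complex.norm_real, Real.norm_eq_abs]
  calc |eulerCoeff p| / ‖((p : ℕ) : ℂ) ^ w + 1‖
      ≤ (6 / (p : ℕ)) / ((1 - (2 : ℝ) ^ (-σ)) * ((p : ℕ) : ℝ) ^ σ) := by
        gcongr
        exact abs_eulerCoeff_le hp
    _ = _ := by
        rw [sub_eq_add_neg (-1 : ℝ) σ, Real.rpow_add h0, Real.rpow_neg_one, Real.rpow_neg h0.le]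
        field_simp

theorem summable_norm_correctionTerm {w : ℂ} (hw : 0 < w.re) :
    Summable fun p : Nat.Primes => ‖correctionTerm p w‖ :=
  (summable_primes_rpow hw _).of_nonneg_of_le (fun _ => norm_nonneg _)
    (norm_correctionTerm_le hw le_rfl)

theorem hasProd_correctionProduct {w : ℂ} (hw : 0 < w.re) :
    HasProd (fun p : Nat.Primes => 1 + correctionTerm p w) (correctionProduct w) :=
  (multipliable_one_add_of_summable (summable_norm_correctionTerm hw)).hasProd

theorem correctionProduct_ne_zero {w : ℂ} (hw : 0 < w.re)
    (h : ∀ p : Nat.Primes, 1 + correctionTerm p w ≠ 0) : correctionProduct w ≠ 0 :=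
  tprod_one_add_ne_zero_of_summable h (summable_norm_correctionTerm hw)

theorem differentiable_natCast_cpow {n : ℕ} (hn : 0 < n) :
    Differentiable ℂ fun w : ℂ => (n : ℂ) ^ w := fun w =>
  differentiableAt_id.const_cpow (Or.inl (by exact_mod_cast hn.ne'))

theorem differentiableOn_correctionTerm (p : Nat.Primes) :
    DifferentiableOn ℂ (correctionTerm p) {w | 0 < w.re} := by
  intro w hw
  refine DifferentiableAt.differentiableWithinAt ?_
  refine DifferentiableAt.div (differentiableAt_const _) ?_
    (natCast_cpow_add_one_ne_zero p.2.two_le hw)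
  exact (differentiable_natCast_cpow p.2.pos w).add_const _

theorem differentiableOn_correctionProduct :
    DifferentiableOn ℂ correctionProduct {w | 0 < w.re} := by
  intro w hw
  have hw' : 0 < w.re := hw
  set U : Set ℂ := {z | w.re / 2 < z.re}
  have hU : IsOpen U := isOpen_lt continuous_const Complex.continuous_re
  have hsub : U ⊆ {z | 0 < z.re} := fun z (hz : w.re / 2 < z.re) => by
    change 0 < z.re; linarith
  have key := Summable.hasProdLocallyUniformlyOn_one_add hU
    (f := correctionTerm) (summable_primes_rpow (half_pos hw') (6 / (1 - (2 : ℝ) ^ (-(w.re / 2)))))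
    (Eventually.of_forall fun p z (hz : w.re / 2 < z.re) =>
      norm_correctionTerm_le (half_pos hw') hz.le p)
    (fun p => (differentiableOn_correctionTerm p).continuousOn.mono hsub)
  rw [hasProdLocallyUniformlyOn_iff_tendstoLocallyUniformlyOn] at key
  have hd : DifferentiableOn ℂ correctionProduct U := by
    refine TendstoLocallyUniformlyOn.differentiableOn key (Eventually.of_forall fun s => ?_) hU
    exact DifferentiableOn.fun_finsetProd fun p _ =>
      ((differentiableOn_correctionTerm p).mono hsub).const_add 1
  exact (hd.differentiableAt (hU.mem_nhds (show w.re / 2 < w.re by linarith))).differentiableWithinAt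

/-- Euler product of `1 / ζ(s)`. -/
theorem hasProd_one_sub_prime_cpow {s : ℂ} (hs : 1 < s.re) :
    HasProd (fun p : Nat.Primes => 1 - (p : ℂ) ^ (-s)) (riemannZeta s)⁻¹ := by
  have h := Tendsto.inv₀ (riemannZeta_eulerProduct_hasProd hs)
    (riemannZeta_ne_zero_of_one_lt_re hs)
  refine h.congr fun t => ?_
  rw [← Finset.prod_inv_distrib]
  simp

theorem prime_cpow_neg_eq_inv {p : ℕ} (w : ℂ) : (p : ℂ) ^ (-w) = ((p : ℂ) ^ w)⁻¹ :=
  Complex.cpow_neg _ _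

/-- Euler product of `Q(w) / ζ(2w)`, convergent in the larger half plane `1 / 2 < re w`. -/
theorem hasProd_correctionProduct_div_zeta {w : ℂ} (hw : 1 / 2 < w.re) :
    HasProd (fun p : Nat.Primes =>
      1 + ((eulerCoeff p : ℂ) * (p : ℂ) ^ (-w) - (1 + eulerCoeff p) * ((p : ℂ) ^ (-w)) ^ 2))
      (correctionProduct w / riemannZeta (2 * w)) := by
  have h1 := hasProd_one_sub_prime_cpow (s := 2 * w) (by simp; linarith)
  have h2 := (hasProd_correctionProduct (w := w) (by linarith)).mul h1
  rw [div_eq_mul_inv]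
  refine h2.congr_fun fun p => ?_
  have hp0 : (p : ℂ) ^ w ≠ 0 := by simp [Complex.cpow_eq_zero_iff, p.2.ne_zero]
  have hp1 := natCast_cpow_add_one_ne_zero p.2.two_le (w := w) (by linarith)
  have h3 : (p : ℂ) ^ (-(2 * w)) = (((p : ℂ) ^ w)⁻¹) ^ 2 := by
    rw [← prime_cpow_neg_eq_inv, ← Complex.cpow_nat_mul]; congr 1; push_cast; ring
  rw [h3, prime_cpow_neg_eq_inv, correctionTerm]
  field_simp
  ring

/-- Euler product of `ζ(w) Q(w) / ζ(2w)`. -/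
theorem hasProd_one_add_eulerCoeff {w : ℂ} (hw : 1 < w.re) :
    HasProd (fun p : Nat.Primes => 1 + (1 + (eulerCoeff p : ℂ)) * (p : ℂ) ^ (-w))
      (riemannZeta w * correctionProduct w / riemannZeta (2 * w)) := by
  have h2 := (riemannZeta_eulerProduct_hasProd hw).mul
    (hasProd_correctionProduct_div_zeta (w := w) (by linarith))
  rw [mul_div_assoc]
  refine h2.congr_fun fun p => ?_
  have : 1 - (p : ℂ) ^ (-w) ≠ 0 := by
    intro h
    have h' : ‖(p : ℂ) ^ (-w)‖ = 1 := by rw [← sub_eq_zero.1 h]; simp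
    rw [norm_natCast_cpow p.2.pos] at h'
    have : ((p : ℕ) : ℝ) ^ (-w).re < 1 := Real.rpow_lt_one_of_one_lt_of_neg
      (by exact_mod_cast p.2.one_lt) (by simp; linarith)
    linarith
  field_simp
  ring

/-! ### The Dirichlet series of the singular series -/

/-- The arithmetic factor `h(n) = ∏_{p ∣ n, p > 2} (p - 1) / (p - 2)` of the singular series. -/
noncomputable def singularFactor (n : ℕ) : ℝ :=
  ∏ p ∈ n.primeFactors.filter (fun p => 2 < p), ((p : ℝ) - 1) / ((p : ℝ) - 2)

theorem singularFactor_one : singularFactor 1 = 1 := by simp [singularFactor]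

theorem singularFactor_mul {m n : ℕ} (h : m.Coprime n) :
    singularFactor (m * n) = singularFactor m * singularFactor n := by
  unfold singularFactor
  rw [h.primeFactors_mul, Finset.filter_union, Finset.prod_union]
  exact (h.disjoint_primeFactors).mono (Finset.filter_subset _ _) (Finset.filter_subset _ _)

theorem singularFactor_prime_pow {p : ℕ} (hp : p.Prime) (e : ℕ) :
    singularFactor (p ^ (e + 1)) = 1 + (1 + eulerCoeff p) / p := by
  unfold singularFactor
  rw [Nat.primeFactors_prime_pow (Nat.succ_ne_zero e) hp, Finset.filter_singleton]
  rcases hp.two_le.eq_or_lt with h | h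
  · subst h; simp [eulerCoeff_two]
  · have h3 : (2 : ℝ) < p := by exact_mod_cast h
    have : (p : ℝ) - 2 ≠ 0 := by linarith
    have : (p : ℝ) ≠ 0 := by linarith
    rw [if_pos h, Finset.prod_singleton, eulerCoeff_of_two_lt h]
    field_simp
    ring

theorem singularFactor_nonneg (n : ℕ) : 0 ≤ singularFactor n := by
  refine Finset.prod_nonneg fun p hp => ?_
  have : (2 : ℝ) < p := by exact_mod_cast (Finset.mem_filter.1 hp).2
  apply div_nonneg <;> linarith

theorem singularFactor_le {n : ℕ} (hn : n ≠ 0) : singularFactor n ≤ n := by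
  have h1 : singularFactor n ≤ ∏ p ∈ n.primeFactors.filter (fun p => 2 < p), (p : ℝ) := by
    refine Finset.prod_le_prod (fun p hp => ?_) (fun p hp => ?_)
    · have : (2 : ℝ) < p := by exact_mod_cast (Finset.mem_filter.1 hp).2
      apply div_nonneg <;> linarith
    · have : (3 : ℝ) ≤ p := by exact_mod_cast (Finset.mem_filter.1 hp).2
      rw [div_le_iff₀ (by linarith)]
      nlinarith
  refine h1.trans ?_
  have h2 : ∏ p ∈ n.primeFactors.filter (fun p => 2 < p), p ≤ n :=
    Nat.le_of_dvd (Nat.pos_of_ne_zero hn)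
      ((Finset.prod_dvd_prod_of_subset _ _ _ (Finset.filter_subset _ _)).trans
        (Nat.prod_primeFactors_dvd n))
  rw [← Nat.cast_prod]
  exact_mod_cast h2

theorem singularSeries_two_mul (m : ℕ) :
    singularSeries (2 * m) = 2 * twinPrimeConst * singularFactor m := by
  rw [singularSeries, if_pos (even_two_mul m)]
  change _ = _ * ∏ p ∈ _, _
  congr 1
  rcases eq_or_ne m 0 with rfl | hm
  · simp
  · congr 1
    rw [Nat.primeFactors_mul two_ne_zero hm, Nat.prime_two.primeFactors, Finset.filter_union]
    rw [Finset.filter_singleton, if_neg (lt_irrefl 2), Finset.empty_union]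

theorem singularSeries_of_odd {k : ℕ} (hk : ¬ Even k) : singularSeries k = 0 := if_neg hk

theorem norm_singularFactor_mul_cpow_le {s : ℂ} (hs : s ≠ 0) (n : ℕ) :
    ‖(singularFactor n : ℂ) * (n : ℂ) ^ (-s)‖ ≤ (n : ℝ) ^ (1 - s.re) := by
  rcases Nat.eq_zero_or_pos n with rfl | hn
  · simp [Complex.zero_cpow (neg_ne_zero.2 hs), Real.rpow_nonneg]
  · have h0 : (0 : ℝ) < n := by exact_mod_cast hn
    rw [norm_mul, Complex.norm_real, Real.norm_of_nonneg (singularFactor_nonneg n),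
      norm_natCast_cpow hn, sub_eq_add_neg, Real.rpow_add h0, Real.rpow_one, Complex.neg_re]
    gcongr
    exact singularFactor_le hn.ne'

theorem summable_norm_singularFactor_mul_cpow {s : ℂ} (hs : 2 < s.re) :
    Summable fun n : ℕ => ‖(singularFactor n : ℂ) * (n : ℂ) ^ (-s)‖ := by
  refine Summable.of_nonneg_of_le (fun _ => norm_nonneg _)
    (norm_singularFactor_mul_cpow_le (by rintro rfl; simp at hs; linarith)) ?_
  exact Real.summable_nat_rpow.2 (by linarith)

/-- The Dirichlet series of `singularFactor` is `ζ(s) ζ(s + 1) Q(s + 1) / ζ(2s + 2)`. -/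
theorem tsum_singularFactor {s : ℂ} (hs : 2 < s.re) :
    ∑' n : ℕ, (singularFactor n : ℂ) * (n : ℂ) ^ (-s) =
      riemannZeta s * (riemannZeta (s + 1) * correctionProduct (s + 1) /
        riemannZeta (2 * (s + 1))) := by
  have hs0 : s ≠ 0 := by rintro rfl; simp at hs; linarith
  have h1 := EulerProduct.eulerProduct_hasProd
    (f := fun n : ℕ => (singularFactor n : ℂ) * (n : ℂ) ^ (-s))
    (by simp [singularFactor_one])
    (fun {m n} hmn => by
      rw [singularFactor_mul hmn, Nat.cast_mul, Complex.natCast_mul_natCast_cpow]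
      push_cast; ring)
    (summable_norm_singularFactor_mul_cpow hs)
    (by simp [Complex.zero_cpow (neg_ne_zero.2 hs0)])
  have h2 := (riemannZeta_eulerProduct_hasProd (s := s) (by linarith)).mul
    (hasProd_one_add_eulerCoeff (w := s + 1) (by simp; linarith))
  refine h1.unique (h2.congr_fun fun p => ?_)
  set y : ℂ := (p : ℂ) ^ (-s) with hy
  have hp0 : ((p : ℕ) : ℂ) ≠ 0 := by exact_mod_cast p.2.ne_zero
  have hy1 : ‖y‖ < 1 := by
    rw [hy, norm_natCast_cpow p.2.pos]
    exact Real.rpow_lt_one_of_one_lt_of_neg (by exact_mod_cast p.2.one_lt) (by simp; linarith)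
  have hy1' : 1 - y ≠ 0 := by
    intro h
    rw [← sub_eq_zero.1 h] at hy1
    simp at hy1
  have hterm : ∀ e : ℕ, (singularFactor ((p : ℕ) ^ (e + 1)) : ℂ) *
      (((p : ℕ) ^ (e + 1) : ℕ) : ℂ) ^ (-s) =
      (1 + (1 + (eulerCoeff p : ℂ)) / (p : ℕ)) * y * y ^ e := by
    intro e
    have : (((p : ℕ) ^ (e + 1) : ℕ) : ℂ) ^ (-s) = y ^ (e + 1) := by
      rw [Nat.cast_pow, ← Complex.natCast_cpow_natCast_mul, ← Complex.cpow_nat_mul]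
    rw [this, singularFactor_prime_pow p.2]
    push_cast
    ring
  have hw : ((p : ℕ) : ℂ) ^ (-(s + 1)) = y / (p : ℕ) := by
    rw [neg_add, ← sub_eq_add_neg, Complex.cpow_sub _ _ hp0, Complex.cpow_one]
  have hsum : HasSum (fun e : ℕ => (singularFactor ((p : ℕ) ^ (e + 1)) : ℂ) *
      (((p : ℕ) ^ (e + 1) : ℕ) : ℂ) ^ (-s))
      ((1 + (1 + (eulerCoeff p : ℂ)) / (p : ℕ)) * y * (1 - y)⁻¹) := by
    simp only [hterm]
    exact (hasSum_geometric_of_norm_lt_one hy1).mul_left _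
  have htot := (hasSum_nat_add_iff (f := fun e : ℕ => (singularFactor ((p : ℕ) ^ e) : ℂ) *
      (((p : ℕ) ^ e : ℕ) : ℂ) ^ (-s)) 1).1 hsum
  rw [htot.tsum_eq, hw]
  simp only [Finset.range_one, Finset.sum_singleton, pow_zero, singularFactor_one, Nat.cast_one,
    Complex.one_cpow, Complex.ofReal_one]
  field_simp
  ring

/-! ### Special values of the Euler products -/

/-- An infinite product over all primes splits off the factor at `2`. -/
theorem hasProd_primes_of_hasProd_oddPrime {f : ℕ → ℂ} {a : ℂ}
    (h : HasProd (fun p : OddPrime => f p) a) :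
    HasProd (fun p : Nat.Primes => f p) (f 2 * a) := by
  have hinj : Function.Injective
      (fun p : OddPrime => (⟨(p : ℕ), p.2.1⟩ : Nat.Primes)) := by
    intro p q hpq
    exact Subtype.ext (congrArg (fun x : Nat.Primes => (x : ℕ)) hpq)
  set two : Nat.Primes := ⟨2, Nat.prime_two⟩ with htwo
  have h1 : HasProd (fun p : Nat.Primes => if p = two then 1 else f p) a := by
    refine (hinj.hasProd_iff ?_).1 ?_
    · intro x hx
      rw [if_pos]
      by_contra hne
      refine hx ⟨⟨x, x.2, lt_of_le_of_ne x.2.two_le fun h => hne ?_⟩, rfl⟩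
      exact Subtype.ext h.symm
    · refine h.congr_fun fun p => ?_
      have : (⟨(p : ℕ), p.2.1⟩ : Nat.Primes) ≠ two := by
        intro hh
        have := congrArg (fun x : Nat.Primes => (x : ℕ)) hh
        have h2 := p.2.2
        simp only [htwo] at this
        omega
      exact if_neg this
  have h2 : HasProd (fun p : Nat.Primes => if p = two then f 2 else 1) (f 2) := by
    have := hasProd_ite_eq two (f 2)
    exact this
  refine (h2.mul h1).congr_fun fun p => ?_
  by_cases hp : p = two
  · rw [if_pos hp, if_pos hp, mul_one, hp]
  · rw [if_neg hp, if_neg hp, one_mul]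

theorem hasProd_twinPrimeConst :
    HasProd (fun p : OddPrime => ((1 - 1 / (((p : ℕ) : ℝ) - 1) ^ 2 : ℝ) : ℂ)) twinPrimeConst :=
  multipliable_twinPrimeConst.hasProd.map Complex.ofRealHom.toMonoidHom Complex.continuous_ofReal

/-- If the factors of a product over primes are inverse, at odd primes, to those of the twin prime
constant, then the product is determined by its factor at `2`. -/
theorem twinPrimeConst_mul_eq {g : ℕ → ℂ} {b : ℂ} (hb : HasProd (fun p : Nat.Primes => g p) b)
    (hg : ∀ p : ℕ, p.Prime → 2 < p → g p = ((p : ℂ) - 1) ^ 2 / (p * (p - 2))) :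
    (twinPrimeConst : ℂ) * b = g 2 := by
  have h1 := hasProd_primes_of_hasProd_oddPrime
    (f := fun p : ℕ => if p = 2 then (1 : ℂ) else ((1 - 1 / ((p : ℝ) - 1) ^ 2 : ℝ) : ℂ))
    (a := twinPrimeConst) (by
      refine hasProd_twinPrimeConst.congr_fun fun p => ?_
      have := p.2.2
      rw [if_neg (by omega)])
  have h2 := h1.mul hb
  rw [if_pos rfl, one_mul] at h2
  refine h2.unique ?_
  have h3 := hasProd_ite_eq (⟨2, Nat.prime_two⟩ : Nat.Primes) (g 2)
  refine h3.congr_fun fun p => ?_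
  by_cases hp : p = ⟨2, Nat.prime_two⟩
  · subst hp; simp
  · have hp2 : (p : ℕ) ≠ 2 := fun h => hp (Subtype.ext h)
    have hlt : 2 < (p : ℕ) := lt_of_le_of_ne p.2.two_le (Ne.symm hp2)
    rw [if_neg hp2, if_neg hp, hg p p.2 hlt]
    have c2 : ((p : ℕ) : ℂ) - 2 ≠ 0 := by
      rw [sub_ne_zero]; exact_mod_cast hp2
    have c1 : ((p : ℕ) : ℂ) - 1 ≠ 0 := by
      rw [sub_ne_zero]; exact_mod_cast p.2.ne_one
    have c0 : ((p : ℕ) : ℂ) ≠ 0 := by exact_mod_cast p.2.ne_zero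
    push_cast
    field_simp
    ring

theorem ofReal_eulerCoeff_of_two_lt {p : ℕ} (hp : 2 < p) :
    (eulerCoeff p : ℂ) = 2 / ((p : ℂ) - 2) := by
  rw [eulerCoeff_of_two_lt hp]; push_cast; rfl

theorem twinPrimeConst_mul_at_two :
    (twinPrimeConst : ℂ) * (riemannZeta 2 * correctionProduct 2 / riemannZeta (2 * 2)) = 1 := by
  have h := twinPrimeConst_mul_eq
    (g := fun p : ℕ => 1 + (1 + (eulerCoeff p : ℂ)) * (p : ℂ) ^ (-2 : ℂ))
    (hasProd_one_add_eulerCoeff (w := 2) (by simp)) (fun p hp h2 => by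
      have c2 : (p : ℂ) - 2 ≠ 0 := by rw [sub_ne_zero]; exact_mod_cast h2.ne'
      have c0 : (p : ℂ) ≠ 0 := by exact_mod_cast hp.ne_zero
      rw [ofReal_eulerCoeff_of_two_lt h2, prime_cpow_neg_eq_inv, Complex.cpow_ofNat]
      field_simp
      ring)
  rw [h, eulerCoeff_two]
  simp

theorem twinPrimeConst_mul_at_one :
    2 * (twinPrimeConst : ℂ) * (correctionProduct 1 / riemannZeta (2 * 1)) = 1 := by
  have h := twinPrimeConst_mul_eq
    (g := fun p : ℕ => 1 + ((eulerCoeff p : ℂ) * (p : ℂ) ^ (-1 : ℂ) -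
      (1 + eulerCoeff p) * ((p : ℂ) ^ (-1 : ℂ)) ^ 2))
    (hasProd_correctionProduct_div_zeta (w := 1) (by norm_num)) (fun p hp h2 => by
      have c2 : (p : ℂ) - 2 ≠ 0 := by rw [sub_ne_zero]; exact_mod_cast h2.ne'
      have c0 : (p : ℂ) ≠ 0 := by exact_mod_cast hp.ne_zero
      rw [ofReal_eulerCoeff_of_two_lt h2, prime_cpow_neg_eq_inv, Complex.cpow_one]
      field_simp
      ring)
  rw [mul_assoc, h, eulerCoeff_two, prime_cpow_neg_eq_inv, Complex.cpow_one]
  norm_num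

/-- The deviation from `1` of the Euler factor at `p` of `Q(w) / ζ(2w)`. -/
noncomputable def quotientTerm (p : Nat.Primes) (w : ℂ) : ℂ :=
  (eulerCoeff p : ℂ) * (p : ℂ) ^ (-w) - (1 + eulerCoeff p) * ((p : ℂ) ^ (-w)) ^ 2

theorem norm_quotientTerm_le {σ : ℝ} {w : ℂ} (hw : 1 / 2 + σ ≤ w.re) (hσ : 0 < σ)
    (hσ1 : σ ≤ 1 / 2) (p : Nat.Primes) :
    ‖quotientTerm p w‖ ≤ 10 * (p : ℝ) ^ (-1 - σ) := by
  have h2 : (2 : ℝ) ≤ (p : ℕ) := by exact_mod_cast p.2.two_le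
  have h0 : (0 : ℝ) < (p : ℕ) := by linarith
  have ha := abs_eulerCoeff_le p.2.two_le
  have ha' : |1 + eulerCoeff p| ≤ 4 := by
    have : (6 : ℝ) / (p : ℕ) ≤ 3 := by rw [div_le_iff₀ h0]; linarith
    calc |1 + eulerCoeff p| ≤ |1| + |eulerCoeff p| := abs_add_le _ _
      _ ≤ 4 := by rw [abs_one]; linarith
  have hz : ‖((p : ℕ) : ℂ) ^ (-w)‖ ≤ ((p : ℕ) : ℝ) ^ (-(1 / 2) - σ) := by
    rw [norm_natCast_cpow p.2.pos]
    exact Real.rpow_le_rpow_of_exponent_le (by linarith) (by simp; linarith)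
  have e1 : 6 / ((p : ℕ) : ℝ) * ((p : ℕ) : ℝ) ^ (-(1 / 2) - σ) ≤
      6 * ((p : ℕ) : ℝ) ^ (-1 - σ) := by
    rw [div_eq_mul_inv, mul_assoc, ← Real.rpow_neg_one, ← Real.rpow_add h0]
    gcongr
    · linarith
    · linarith
  have e2 : (((p : ℕ) : ℝ) ^ (-(1 / 2) - σ)) ^ 2 ≤ ((p : ℕ) : ℝ) ^ (-1 - σ) := by
    rw [← Real.rpow_mul_natCast h0.le]
    apply Real.rpow_le_rpow_of_exponent_le (by linarith)
    push_cast; linarith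
  calc ‖quotientTerm p w‖ ≤ ‖(eulerCoeff p : ℂ) * ((p : ℕ) : ℂ) ^ (-w)‖ +
        ‖(1 + (eulerCoeff p : ℂ)) * (((p : ℕ) : ℂ) ^ (-w)) ^ 2‖ := norm_sub_le _ _
    _ = |eulerCoeff p| * ‖((p : ℕ) : ℂ) ^ (-w)‖ +
        |1 + eulerCoeff p| * ‖((p : ℕ) : ℂ) ^ (-w)‖ ^ 2 := by
        rw [norm_mul, norm_mul, norm_pow, Complex.norm_real, Real.norm_eq_abs,
          ← Complex.ofReal_one, ← Complex.ofReal_add, Complex.norm_real, Real.norm_eq_abs]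
    _ ≤ 6 / (p : ℕ) * ((p : ℕ) : ℝ) ^ (-(1 / 2) - σ) +
        4 * (((p : ℕ) : ℝ) ^ (-(1 / 2) - σ)) ^ 2 := by gcongr
    _ ≤ 10 * (p : ℝ) ^ (-1 - σ) := by linarith

theorem hasDerivAt_natCast_cpow_neg {n : ℕ} (hn : 0 < n) (w : ℂ) :
    HasDerivAt (fun w : ℂ => (n : ℂ) ^ (-w)) (-(Real.log n : ℂ) * (n : ℂ) ^ (-w)) w := by
  have h := (hasDerivAt_neg w).const_cpow (c := (n : ℂ)) (Or.inl (by exact_mod_cast hn.ne'))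
  refine h.congr_deriv ?_
  rw [Complex.natCast_log]; ring

theorem hasDerivAt_quotientTerm (p : Nat.Primes) (w : ℂ) :
    HasDerivAt (quotientTerm p) (-(Real.log p : ℂ) * (eulerCoeff p * (p : ℂ) ^ (-w) -
      2 * (1 + eulerCoeff p) * ((p : ℂ) ^ (-w)) ^ 2)) w := by
  have h := hasDerivAt_natCast_cpow_neg p.2.pos w
  refine ((h.const_mul (eulerCoeff p : ℂ)).sub
    ((h.pow 2).const_mul (1 + (eulerCoeff p : ℂ)))).congr_deriv ?_
  push_cast
  ring

/-- The prime `2`. -/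
def primeTwo : Nat.Primes := ⟨2, Nat.prime_two⟩

theorem quotientTerm_one_two : quotientTerm primeTwo 1 = -(1 / 2) := by
  change ((eulerCoeff 2 : ℝ) : ℂ) * ((2 : ℕ) : ℂ) ^ (-1 : ℂ) -
    (1 + ((eulerCoeff 2 : ℝ) : ℂ)) * (((2 : ℕ) : ℂ) ^ (-1 : ℂ)) ^ 2 = _
  rw [eulerCoeff_two, prime_cpow_neg_eq_inv, Complex.cpow_one]
  norm_num

theorem deriv_quotientTerm_one_two :
    deriv (quotientTerm primeTwo) 1 = (Real.log 2 : ℂ) / 2 := by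
  rw [(hasDerivAt_quotientTerm _ 1).deriv]
  change -((Real.log (2 : ℕ) : ℝ) : ℂ) * (((eulerCoeff 2 : ℝ) : ℂ) * ((2 : ℕ) : ℂ) ^ (-1 : ℂ) -
    2 * (1 + ((eulerCoeff 2 : ℝ) : ℂ)) * (((2 : ℕ) : ℂ) ^ (-1 : ℂ)) ^ 2) = _
  rw [eulerCoeff_two, prime_cpow_neg_eq_inv, Complex.cpow_one]
  push_cast
  ring

/-- At odd primes the linear coefficient of the Euler factor of `Q(w) / ζ(2w)` at `w = 1`
vanishes. -/
theorem deriv_quotientTerm_one {p : Nat.Primes} (hp : 2 < (p : ℕ)) :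
    deriv (quotientTerm p) 1 = 0 := by
  rw [(hasDerivAt_quotientTerm _ 1).deriv]
  have c2 : ((p : ℕ) : ℂ) - 2 ≠ 0 := by rw [sub_ne_zero]; exact_mod_cast hp.ne'
  have c0 : ((p : ℕ) : ℂ) ≠ 0 := by exact_mod_cast p.2.ne_zero
  rw [ofReal_eulerCoeff_of_two_lt hp, prime_cpow_neg_eq_inv, Complex.cpow_one]
  field_simp
  ring

theorem one_add_quotientTerm_one_ne_zero (p : Nat.Primes) : 1 + quotientTerm p 1 ≠ 0 := by
  rcases p.2.two_le.eq_or_lt with h | h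
  · have : p = primeTwo := Subtype.ext h.symm
    rw [this, quotientTerm_one_two]; norm_num
  · have c2 : ((p : ℕ) : ℂ) - 2 ≠ 0 := by rw [sub_ne_zero]; exact_mod_cast h.ne'
    have c1 : ((p : ℕ) : ℂ) - 1 ≠ 0 := by rw [sub_ne_zero]; exact_mod_cast p.2.ne_one
    have c0 : ((p : ℕ) : ℂ) ≠ 0 := by exact_mod_cast p.2.ne_zero
    have : 1 + quotientTerm p 1 = ((p : ℕ) - 1 : ℂ) ^ 2 / ((p : ℕ) * ((p : ℕ) - 2)) := by
      rw [quotientTerm, ofReal_eulerCoeff_of_two_lt h, prime_cpow_neg_eq_inv, Complex.cpow_one]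
      field_simp
      ring
    rw [this]
    exact div_ne_zero (pow_ne_zero _ c1) (mul_ne_zero c0 c2)

theorem logDeriv_one_add_quotientTerm_one (p : Nat.Primes) :
    logDeriv (fun w => 1 + quotientTerm p w) 1 =
      if p = primeTwo then (Real.log 2 : ℂ) else 0 := by
  rw [logDeriv_apply, deriv_const_add]
  split_ifs with h
  · rw [h, deriv_quotientTerm_one_two, quotientTerm_one_two]
    ring
  · have hlt : 2 < (p : ℕ) := lt_of_le_of_ne p.2.two_le fun hh => h (Subtype.ext hh.symm)
    rw [deriv_quotientTerm_one hlt, zero_div]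

/-- The logarithmic derivative of `Q(w) / ζ(2w)` at `w = 1` is `log 2`: only `p = 2` contributes. -/
theorem hasDerivAt_correctionProduct_div_zeta_one :
    HasDerivAt (fun w => correctionProduct w / riemannZeta (2 * w))
      (Real.log 2 * (correctionProduct 1 / riemannZeta (2 * 1))) 1 := by
  set U : Set ℂ := {z | 3 / 4 < z.re} with hUdef
  have hU : IsOpen U := isOpen_lt continuous_const Complex.continuous_re
  have h1U : (1 : ℂ) ∈ U := by change (3 / 4 : ℝ) < (1 : ℂ).re; norm_num
  have hd : ∀ p, Differentiable ℂ (quotientTerm p) := fun p w =>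
    (hasDerivAt_quotientTerm p w).differentiableAt
  have hbound : ∀ p : Nat.Primes, ∀ z ∈ U,
      ‖quotientTerm p z‖ ≤ 10 * (p : ℝ) ^ (-1 - (1 / 4 : ℝ)) := fun p z hz =>
    norm_quotientTerm_le (by have : (3 / 4 : ℝ) < z.re := hz; linarith) (by norm_num) (by norm_num) p
  have hsum := summable_primes_rpow (σ := 1 / 4) (by norm_num) 10
  have hmult : MultipliableLocallyUniformlyOn (fun p w => 1 + quotientTerm p w) U :=
    Summable.multipliableLocallyUniformlyOn_one_add hU hsum
      (Eventually.of_forall hbound) (fun p => (hd p).continuous.continuousOn)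
  have hH : ∀ w ∈ U, ∏' p : Nat.Primes, (1 + quotientTerm p w) =
      correctionProduct w / riemannZeta (2 * w) := fun w hw =>
    (hasProd_correctionProduct_div_zeta (by have : (3 / 4 : ℝ) < w.re := hw; linarith)).tprod_eq
  have hne : ∏' p : Nat.Primes, (1 + quotientTerm p 1) ≠ 0 :=
    tprod_one_add_ne_zero_of_summable one_add_quotientTerm_one_ne_zero
      (hsum.of_nonneg_of_le (fun _ => norm_nonneg _) fun p => hbound p 1 h1U)
  have hlog := logDeriv_tprod_eq_tsum hU h1U
    (f := fun p w => 1 + quotientTerm p w) one_add_quotientTerm_one_ne_zero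
    (fun p => ((hd p).const_add 1).differentiableOn)
    (by
      simp only [logDeriv_one_add_quotientTerm_one]
      exact (hasSum_ite_eq _ _).summable) hmult hne
  simp only [logDeriv_one_add_quotientTerm_one, tsum_ite_eq] at hlog
  have hEq : (fun w => ∏' p : Nat.Primes, (1 + quotientTerm p w)) =ᶠ[nhds 1]
      fun w => correctionProduct w / riemannZeta (2 * w) := by
    filter_upwards [hU.mem_nhds h1U] with w hw using hH w hw
  have hlog' : deriv (fun w => correctionProduct w / riemannZeta (2 * w)) 1 /
      (correctionProduct 1 / riemannZeta (2 * 1)) = Real.log 2 := by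
    rw [← hEq.deriv_eq, ← hH 1 h1U]
    exact hlog
  rw [hH 1 h1U] at hne
  have hz : riemannZeta (2 * 1) ≠ 0 := fun h => hne (by rw [h, div_zero])
  have hdiff : DifferentiableAt ℂ (fun w => correctionProduct w / riemannZeta (2 * w)) 1 := by
    refine DifferentiableAt.div ?_ ?_ hz
    · exact differentiableOn_correctionProduct.differentiableAt
        ((isOpen_lt continuous_const Complex.continuous_re).mem_nhds (by simp))
    · exact DifferentiableAt.comp (g := riemannZeta) (1 : ℂ)
        (differentiableAt_riemannZeta (by norm_num)) ((differentiableAt_id).const_mul 2)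
  refine hdiff.hasDerivAt.congr_deriv ?_
  rw [← hlog', div_mul_cancel₀ _ hne]

/-! ### The Mellin transform of the error term -/

theorem integrableOn_sub_mul_cpow {a : ℝ} (ha : 0 < a) {w : ℂ} (hw : 1 < w.re) :
    MeasureTheory.IntegrableOn (fun x : ℝ => ((x - a : ℝ) : ℂ) * (x : ℂ) ^ (-w - 1)) (Set.Ioi a) ∧
    ∫ x in Set.Ioi a, ((x - a : ℝ) : ℂ) * (x : ℂ) ^ (-w - 1) = (a : ℂ) ^ (1 - w) / (w * (w - 1)) := by
  have ha0 : (a : ℂ) ≠ 0 := by exact_mod_cast ha.ne'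
  have hw0 : w ≠ 0 := by rintro rfl; simp at hw; linarith
  have hw1 : w - 1 ≠ 0 := by
    intro h; rw [sub_eq_zero.1 h] at hw; simp at hw
  have h1 : MeasureTheory.IntegrableOn (fun x : ℝ => (x : ℂ) ^ (-w)) (Set.Ioi a) :=
    integrableOn_Ioi_cpow_of_lt (by simp; linarith) ha
  have h2 : MeasureTheory.IntegrableOn (fun x : ℝ => (a : ℂ) * (x : ℂ) ^ (-w - 1)) (Set.Ioi a) :=
    (integrableOn_Ioi_cpow_of_lt (by simp; linarith) ha).const_mul _
  have hcongr : Set.EqOn (fun x : ℝ => (x : ℂ) ^ (-w) - (a : ℂ) * (x : ℂ) ^ (-w - 1))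
      (fun x : ℝ => ((x - a : ℝ) : ℂ) * (x : ℂ) ^ (-w - 1)) (Set.Ioi a) := by
    intro x hx
    have hx0 : (x : ℂ) ≠ 0 := by exact_mod_cast (ha.trans hx).ne'
    simp only [Complex.cpow_sub _ _ hx0, Complex.cpow_one]
    push_cast
    field_simp
  refine ⟨(MeasureTheory.IntegrableOn.congr_fun (h1.sub h2) hcongr measurableSet_Ioi), ?_⟩
  rw [← MeasureTheory.setIntegral_congr_fun measurableSet_Ioi hcongr,
    MeasureTheory.integral_sub h1 h2, MeasureTheory.integral_const_mul,
    integral_Ioi_cpow_of_lt (by simp; linarith) ha, integral_Ioi_cpow_of_lt (by simp; linarith) ha]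
  have e1 : -w + 1 = 1 - w := by ring
  have e2 : -w - 1 + 1 = -w := by ring
  have hw1' : 1 - w ≠ 0 := by rw [← neg_sub]; exact neg_ne_zero.2 hw1
  rw [e1, e2, Complex.cpow_sub _ _ ha0, Complex.cpow_one, Complex.cpow_neg]
  have haw : (a : ℂ) ^ w ≠ 0 := by simp [Complex.cpow_eq_zero_iff, ha0]
  field_simp
  ring

/-- The Mellin transform on `(1, ∞)` of the tent function `max (x - a) 0`. -/
theorem mellin_max_sub {a : ℝ} (ha : 1 ≤ a) {w : ℂ} (hw : 1 < w.re) :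
    MeasureTheory.IntegrableOn (fun x : ℝ => ((max (x - a) 0 : ℝ) : ℂ) * (x : ℂ) ^ (-w - 1))
      (Set.Ioi 1) ∧
    ∫ x in Set.Ioi (1 : ℝ), ((max (x - a) 0 : ℝ) : ℂ) * (x : ℂ) ^ (-w - 1) =
      (a : ℂ) ^ (1 - w) / (w * (w - 1)) := by
  obtain ⟨h1, h2⟩ := integrableOn_sub_mul_cpow (a := a) (by linarith) hw
  have hcongr : Set.EqOn (fun x : ℝ => ((x - a : ℝ) : ℂ) * (x : ℂ) ^ (-w - 1))
      (fun x : ℝ => ((max (x - a) 0 : ℝ) : ℂ) * (x : ℂ) ^ (-w - 1)) (Set.Ioi a) := by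
    intro x hx
    have : a < x := hx
    simp only
    rw [max_eq_left (by linarith)]
  have hzero : ∀ x ∈ Set.Ioi (1 : ℝ) \ Set.Ioi a,
      ((max (x - a) 0 : ℝ) : ℂ) * (x : ℂ) ^ (-w - 1) = 0 := by
    rintro x ⟨-, hx⟩
    have : x ≤ a := not_lt.1 hx
    rw [max_eq_right (by linarith)]
    simp
  refine ⟨?_, ?_⟩
  · exact (h1.congr_fun hcongr measurableSet_Ioi).of_forall_sdiff_eq_zero measurableSet_Ioi hzero
  · rw [MeasureTheory.setIntegral_eq_of_subset_of_forall_sdiff_eq_zero measurableSet_Ioi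
      (Set.Ioi_subset_Ioi ha) hzero, ← MeasureTheory.setIntegral_congr_fun measurableSet_Ioi hcongr,
      h2]

theorem integral_norm_max_sub {a : ℝ} (ha : 1 ≤ a) {w : ℂ} (hw : 1 < w.re) :
    ∫ x in Set.Ioi (1 : ℝ), ‖((max (x - a) 0 : ℝ) : ℂ) * (x : ℂ) ^ (-w - 1)‖ =
      a ^ (1 - w.re) / (w.re * (w.re - 1)) := by
  have h := (mellin_max_sub ha (w := (w.re : ℂ)) (by simpa using hw)).2
  have hcongr : Set.EqOn (fun x : ℝ => ((max (x - a) 0 : ℝ) : ℂ) * (x : ℂ) ^ (-(w.re : ℂ) - 1))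
      (fun x : ℝ => ((‖((max (x - a) 0 : ℝ) : ℂ) * (x : ℂ) ^ (-w - 1)‖ : ℝ) : ℂ)) (Set.Ioi 1) := by
    intro x hx
    have hx0 : (0 : ℝ) < x := one_pos.trans hx
    simp only
    rw [norm_mul, Complex.norm_real, Real.norm_of_nonneg (le_max_right _ _),
      Complex.norm_cpow_eq_rpow_re_of_pos hx0, Complex.ofReal_mul, Complex.ofReal_cpow hx0.le]
    simp
  rw [MeasureTheory.setIntegral_congr_fun measurableSet_Ioi hcongr, integral_complex_ofReal] at h
  have h' : ((a ^ (1 - w.re) / (w.re * (w.re - 1)) : ℝ) : ℂ) =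
      (a : ℂ) ^ (1 - (w.re : ℂ)) / (w.re * (w.re - 1)) := by
    push_cast
    rw [Complex.ofReal_cpow (by linarith)]
    push_cast
    rfl
  rw [← h'] at h
  exact_mod_cast h

theorem integrableOn_log_mul_cpow {z : ℂ} (hz : 0 < z.re) :
    MeasureTheory.IntegrableOn (fun x : ℝ => (Real.log x : ℂ) * (x : ℂ) ^ (-z - 1)) (Set.Ioi 1) := by
  have hdom : MeasureTheory.IntegrableOn
      (fun x : ℝ => (z.re / 2)⁻¹ * x ^ (-(z.re / 2) - 1)) (Set.Ioi 1) :=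
    (integrableOn_Ioi_rpow_of_lt (by linarith) one_pos).const_mul _
  refine hdom.mono' ?_ ?_
  · refine ContinuousOn.aestronglyMeasurable ?_ measurableSet_Ioi
    intro x hx
    have hx0 : (0 : ℝ) < x := one_pos.trans hx
    refine ContinuousAt.continuousWithinAt (ContinuousAt.mul ?_ ?_)
    · exact Complex.continuous_ofReal.continuousAt.comp (Real.continuousAt_log hx0.ne')
    · exact Complex.continuousAt_ofReal_cpow_const x _ (Or.inr hx0.ne')
  · filter_upwards [MeasureTheory.ae_restrict_mem measurableSet_Ioi] with x hx
    have hx1 : (1 : ℝ) < x := hx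
    have hx0 : (0 : ℝ) < x := one_pos.trans hx
    rw [norm_mul, Complex.norm_real, Real.norm_of_nonneg (Real.log_nonneg hx1.le),
      Complex.norm_cpow_eq_rpow_re_of_pos hx0]
    have h1 := Real.log_le_rpow_div hx0.le (half_pos hz)
    calc Real.log x * x ^ (-z - 1).re ≤ x ^ (z.re / 2) / (z.re / 2) * x ^ (-z.re - 1) := by
          simp only [Complex.sub_re, Complex.neg_re, Complex.one_re]
          gcongr
      _ = _ := by
          have : -(z.re / 2) - 1 = z.re / 2 + (-z.re - 1) := by ring
          rw [this, Real.rpow_add hx0]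
          ring

theorem integral_log_mul_cpow {z : ℂ} (hz : 0 < z.re) :
    ∫ x in Set.Ioi (1 : ℝ), (Real.log x : ℂ) * (x : ℂ) ^ (-z - 1) = 1 / z ^ 2 := by
  have hz0 : z ≠ 0 := by rintro rfl; simp at hz
  have hder : ∀ x ∈ Set.Ici (1 : ℝ), HasDerivAt
      (fun x : ℝ => -((x : ℂ) ^ (-z) * (Real.log x / z + 1 / z ^ 2)))
      ((Real.log x : ℂ) * (x : ℂ) ^ (-z - 1)) x := by
    intro x hx
    have hx0 : (0 : ℝ) < x := one_pos.trans_le hx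
    have hxc : (x : ℂ) ≠ 0 := by exact_mod_cast hx0.ne'
    have h1 : HasDerivAt (fun x : ℝ => (x : ℂ) ^ (-z)) (-z * (x : ℂ) ^ (-z - 1)) x := by
      have := (hasDerivAt_id (x : ℂ)).cpow_const (c := -z) (Or.inl (by simpa using hx0))
      simpa using this.comp_ofReal
    have h2 : HasDerivAt (fun x : ℝ => (Real.log x : ℂ) / z + 1 / z ^ 2) ((x⁻¹ : ℝ) / z) x :=
      ((Real.hasDerivAt_log hx0.ne').ofReal_comp.div_const z).add_const _
    refine (h1.mul h2).neg.congr_deriv ?_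
    rw [Complex.cpow_sub _ _ hxc, Complex.cpow_one]
    push_cast
    field_simp
    ring
  have hlim : Tendsto (fun x : ℝ => -((x : ℂ) ^ (-z) * (Real.log x / z + 1 / z ^ 2))) atTop
      (nhds 0) := by
    have hpow : Tendsto (fun x : ℝ => (x : ℂ) ^ (-z)) atTop (nhds 0) := by
      rw [tendsto_zero_iff_norm_tendsto_zero]
      refine (tendsto_rpow_neg_atTop hz).congr' ?_
      filter_upwards [eventually_gt_atTop 0] with x hx
      rw [Complex.norm_cpow_eq_rpow_re_of_pos hx, Complex.neg_re]
    have hlog : Tendsto (fun x : ℝ => (x : ℂ) ^ (-z) * (Real.log x : ℂ)) atTop (nhds 0) := by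
      rw [tendsto_zero_iff_norm_tendsto_zero]
      have := (isLittleO_log_rpow_atTop hz).tendsto_div_nhds_zero
      refine (this.norm.congr' ?_).trans (by simp)
      filter_upwards [eventually_gt_atTop 0] with x hx
      rw [norm_div, norm_mul, Complex.norm_real, Complex.norm_cpow_eq_rpow_re_of_pos hx,
        Complex.neg_re, Real.rpow_neg hx.le, Real.norm_of_nonneg (Real.rpow_nonneg hx.le _)]
      ring
    have := ((hlog.div_const z).add (hpow.mul_const (1 / z ^ 2))).neg
    simp only [zero_div, zero_mul, add_zero, neg_zero] at this
    refine this.congr fun x => ?_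
    ring
  rw [MeasureTheory.integral_Ioi_of_hasDerivAt_of_tendsto' hder (integrableOn_log_mul_cpow hz) hlim]
  simp

theorem hasSum_cesaroMean (x : ℝ) :
    HasSum (fun m : ℕ => 2 * twinPrimeConst * singularFactor (m + 1) *
      max (x - 2 * ((m : ℝ) + 1)) 0) (cesaroMean x) := by
  have h1 : HasSum (fun k : ℕ => max (x - ((k + 1 : ℕ) : ℝ)) 0 * singularSeries (k + 1))
      (cesaroMean x) := by
    have hE : cesaroMean x = ∑ k ∈ Finset.range ⌊x⌋₊,
        max (x - ((k + 1 : ℕ) : ℝ)) 0 * singularSeries (k + 1) := by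
      rw [cesaroMean, Finset.range_eq_Ico, Finset.sum_Ico_add' (fun k : ℕ =>
        max (x - (k : ℝ)) 0 * singularSeries k) 0 ⌊x⌋₊ 1]
      refine Finset.sum_congr rfl fun k hk => ?_
      replace hk := Finset.mem_Ico.1 hk
      have : (k : ℝ) ≤ x := (Nat.le_floor_iff' (by omega)).1 (by omega)
      rw [max_eq_left (by linarith)]
    rw [hE]
    refine hasSum_sum_of_ne_finset_zero fun k hk => ?_
    have : x < ((k + 1 : ℕ) : ℝ) := by
      refine Nat.lt_of_floor_lt ?_
      rw [Finset.mem_range] at hk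
      omega
    rw [max_eq_right (by linarith), zero_mul]
  have hinj : Function.Injective (fun m : ℕ => 2 * m + 1) := fun a b h => by
    simp only at h; omega
  rw [← hinj.hasSum_iff] at h1
  · refine h1.congr_fun fun m => ?_
    have e : 2 * m + 1 + 1 = 2 * (m + 1) := by ring
    simp only [Function.comp]
    rw [e, singularSeries_two_mul]
    push_cast
    ring
  · intro k hk
    rw [singularSeries_of_odd, mul_zero]
    rintro ⟨r, hr⟩
    exact hk ⟨r - 1, by simp only; omega⟩

theorem abs_singularSeries_le {k : ℕ} (hk : k ≠ 0) :
    |singularSeries k| ≤ 2 * |twinPrimeConst| * k := by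
  by_cases h : Even k
  · obtain ⟨m, rfl⟩ := h.two_dvd
    rw [singularSeries_two_mul, abs_mul, abs_mul, abs_two, abs_of_nonneg (singularFactor_nonneg m)]
    have hm : m ≠ 0 := by rintro rfl; simp at hk
    gcongr
    refine (singularFactor_le hm).trans ?_
    exact_mod_cast (by omega : m ≤ 2 * m)
  · rw [singularSeries_of_odd h, abs_zero]
    positivity

theorem abs_cesaroMean_le {x : ℝ} (hx : 0 ≤ x) :
    |cesaroMean x| ≤ 2 * |twinPrimeConst| * x ^ 3 := by
  have hk : ∀ k ∈ Finset.Icc 1 ⌊x⌋₊,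
      |(x - (k : ℝ)) * singularSeries k| ≤ x * (2 * |twinPrimeConst| * x) := by
    intro k hk
    rw [Finset.mem_Icc] at hk
    have hkx : (k : ℝ) ≤ x := (Nat.le_floor_iff' (by omega)).1 hk.2
    rw [abs_mul, abs_of_nonneg (by linarith)]
    have h0 : (0 : ℝ) ≤ k := Nat.cast_nonneg k
    calc (x - k) * |singularSeries k| ≤ x * (2 * |twinPrimeConst| * k) := by
          gcongr
          · linarith
          · exact abs_singularSeries_le (by omega)
      _ ≤ _ := by gcongr
  calc |cesaroMean x| ≤ ∑ k ∈ Finset.Icc 1 ⌊x⌋₊, |(x - (k : ℝ)) * singularSeries k| :=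
        Finset.abs_sum_le_sum_abs _ _
    _ ≤ ∑ k ∈ Finset.Icc 1 ⌊x⌋₊, x * (2 * |twinPrimeConst| * x) := Finset.sum_le_sum hk
    _ = ⌊x⌋₊ * (x * (2 * |twinPrimeConst| * x)) := by simp
    _ ≤ x * (x * (2 * |twinPrimeConst| * x)) := by
        gcongr
        exact Nat.floor_le hx
    _ = _ := by ring

theorem measurable_cesaroMean : Measurable cesaroMean := by
  refine measurable_of_tendsto_metrizable (f := fun n (x : ℝ) => ∑ m ∈ Finset.range n,
    2 * twinPrimeConst * singularFactor (m + 1) * max (x - 2 * ((m : ℝ) + 1)) 0) (fun n => ?_)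
    (tendsto_pi_nhds.2 fun x => (hasSum_cesaroMean x).tendsto_sum_nat)
  refine Finset.measurable_fun_sum _ fun m _ => ?_
  fun_prop

theorem measurable_cesaroError : Measurable cesaroError := by
  unfold cesaroError
  have := measurable_cesaroMean
  fun_prop

theorem exists_abs_cesaroError_le (Y : ℝ) :
    ∃ C : ℝ, ∀ x ∈ Set.Icc 1 Y, |cesaroError x| ≤ C := by
  have hcont : ContinuousOn (fun x : ℝ => 1 / 2 * x ^ 2 - 1 / 2 * x * Real.log x
    + 1 / 2 * (1 - Real.eulerMascheroniConstant - Real.log (2 * Real.pi)) * x) (Set.Icc 1 Y) := by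
    have : ContinuousOn Real.log (Set.Icc 1 Y) := Real.continuousOn_log.mono fun x hx => by
      have := hx.1
      simp only [Set.mem_compl_iff, Set.mem_singleton_iff]
      linarith
    fun_prop
  obtain ⟨C, hC⟩ := isCompact_Icc.exists_bound_of_continuousOn hcont
  refine ⟨2 * |twinPrimeConst| * Y ^ 3 + C, fun x hx => ?_⟩
  have h0 : 0 ≤ x := zero_le_one.trans hx.1
  rw [cesaroError]
  refine (abs_sub _ _).trans (add_le_add ((abs_cesaroMean_le h0).trans ?_) (hC x hx))
  gcongr
  exact hx.2

theorem integrableOn_cesaroMean {w : ℂ} (hw : 3 < w.re) :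
    MeasureTheory.IntegrableOn (fun x : ℝ => (cesaroMean x : ℂ) * (x : ℂ) ^ (-w - 1))
      (Set.Ioi 1) := by
  have hdom : MeasureTheory.IntegrableOn
      (fun x : ℝ => 2 * |twinPrimeConst| * x ^ (2 - w.re)) (Set.Ioi 1) :=
    (integrableOn_Ioi_rpow_of_lt (by linarith) one_pos).const_mul _
  refine hdom.mono' ?_ ?_
  · refine MeasureTheory.AEStronglyMeasurable.mul ?_
      (integrableOn_cpow_Ioi_one (by simp; linarith)).aestronglyMeasurable
    exact (Complex.measurable_ofReal.comp measurable_cesaroMean).aestronglyMeasurable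
  · filter_upwards [MeasureTheory.ae_restrict_mem measurableSet_Ioi] with x hx
    have hx0 : (0 : ℝ) < x := one_pos.trans hx
    rw [norm_mul, Complex.norm_real, Real.norm_eq_abs, Complex.norm_cpow_eq_rpow_re_of_pos hx0]
    calc |cesaroMean x| * x ^ (-w - 1).re ≤ 2 * |twinPrimeConst| * x ^ 3 * x ^ (-w.re - 1) := by
          simp only [Complex.sub_re, Complex.neg_re, Complex.one_re]
          gcongr
          exact abs_cesaroMean_le hx0.le
      _ = _ := by
          have : 2 - w.re = (3 : ℕ) + (-w.re - 1) := by push_cast; ring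
          rw [this, Real.rpow_add hx0, Real.rpow_natCast]
          ring

theorem hasSum_succ_singularFactor {s : ℂ} (hs : 2 < s.re) :
    HasSum (fun m : ℕ => (singularFactor (m + 1) : ℂ) * ((m + 1 : ℕ) : ℂ) ^ (-s))
      (riemannZeta s * (riemannZeta (s + 1) * correctionProduct (s + 1) /
        riemannZeta (2 * (s + 1)))) := by
  have hs0 : s ≠ 0 := by rintro rfl; simp at hs; linarith
  have h := (summable_norm_singularFactor_mul_cpow hs).of_norm.hasSum
  rw [tsum_singularFactor hs, ← hasSum_nat_add_iff' 1] at h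
  simpa [Complex.zero_cpow (neg_ne_zero.2 hs0)] using h

/-- The Mellin transform of the Cesàro mean. -/
theorem mellin_cesaroMean {w : ℂ} (hw : 3 < w.re) :
    ∫ x in Set.Ioi (1 : ℝ), (cesaroMean x : ℂ) * (x : ℂ) ^ (-w - 1) =
      2 * twinPrimeConst * 2 ^ (1 - w) * (riemannZeta (w - 1) *
        (riemannZeta w * correctionProduct w / riemannZeta (2 * w))) / (w * (w - 1)) := by
  have hm1 : ∀ m : ℕ, (1 : ℝ) ≤ 2 * ((m : ℝ) + 1) := fun m => by
    have : (0 : ℝ) ≤ m := Nat.cast_nonneg m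
    linarith
  have hcpow : ∀ m : ℕ, ((2 * ((m : ℝ) + 1) : ℝ) : ℂ) ^ (1 - w) =
      2 ^ (1 - w) * ((m + 1 : ℕ) : ℂ) ^ (-(w - 1)) := by
    intro m
    have h2 : ((2 * ((m : ℝ) + 1) : ℝ) : ℂ) = ((2 : ℕ) : ℂ) * ((m + 1 : ℕ) : ℂ) := by push_cast; rfl
    rw [h2, Complex.natCast_mul_natCast_cpow, neg_sub, Nat.cast_ofNat]
  set F : ℕ → ℝ → ℂ := fun m x => (2 * twinPrimeConst * singularFactor (m + 1) : ℂ) *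
    (((max (x - 2 * ((m : ℝ) + 1)) 0 : ℝ) : ℂ) * (x : ℂ) ^ (-w - 1)) with hF
  have hint : ∀ m, MeasureTheory.Integrable (F m)
      (MeasureTheory.volume.restrict (Set.Ioi 1)) := fun m =>
    (mellin_max_sub (hm1 m) (by linarith)).1.const_mul _
  have hsum := hasSum_succ_singularFactor (s := w - 1) (by simp; linarith)
  rw [sub_add_cancel] at hsum
  have hnorm : Summable fun m => ∫ x in Set.Ioi (1 : ℝ), ‖F m x‖ := by
    have h1 := (summable_nat_add_iff 1).2
      (summable_norm_singularFactor_mul_cpow (s := w - 1) (by simp; linarith))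
    refine (h1.mul_left (2 * |twinPrimeConst| * ‖(2 : ℂ) ^ (1 - w)‖ /
      (w.re * (w.re - 1)))).congr fun m => ?_
    have hsplit : ∀ x, ‖F m x‖ = ‖(2 * twinPrimeConst * singularFactor (m + 1) : ℂ)‖ *
        ‖((max (x - 2 * ((m : ℝ) + 1)) 0 : ℝ) : ℂ) * (x : ℂ) ^ (-w - 1)‖ := fun x => norm_mul _ _
    simp only [hsplit]
    rw [MeasureTheory.integral_const_mul, integral_norm_max_sub (hm1 m) (by linarith)]
    have h2 : (2 * ((m : ℝ) + 1)) ^ (1 - w.re) = ‖((2 * ((m : ℝ) + 1) : ℝ) : ℂ) ^ (1 - w)‖ := by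
      rw [Complex.norm_cpow_eq_rpow_re_of_pos (by linarith [hm1 m])]
      simp
    rw [h2, hcpow, norm_mul, norm_mul, norm_mul, norm_mul, Complex.norm_real, Complex.norm_real,
      Real.norm_eq_abs, Real.norm_eq_abs]
    simp only [Complex.norm_ofNat]
    ring
  have h1 := MeasureTheory.hasSum_integral_of_summable_integral_norm hint hnorm
  have h2 : ∀ x : ℝ, ∑' m, F m x = (cesaroMean x : ℂ) * (x : ℂ) ^ (-w - 1) := by
    intro x
    have := ((hasSum_cesaroMean x).mapL Complex.ofRealCLM).mul_right ((x : ℂ) ^ (-w - 1))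
    refine (this.congr_fun fun m => ?_).tsum_eq
    simp only [hF, Complex.ofRealCLM_apply]
    push_cast
    ring
  simp only [h2] at h1
  have h3 := hsum.mul_left (2 * twinPrimeConst * 2 ^ (1 - w) / (w * (w - 1)))
  rw [h1.unique (h3.congr_fun fun m => ?_)]
  · ring
  · simp only [hF]
    rw [MeasureTheory.integral_const_mul, (mellin_max_sub (hm1 m) (by linarith)).2, hcpow]
    ring

/-- The coefficient of `x` in the main term of the Cesàro mean. -/
noncomputable def linearCoeff : ℝ :=
  1 / 2 * (1 - Real.eulerMascheroniConstant - Real.log (2 * Real.pi))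

/-- The Mellin transform of the error term converges for `3 < re w`. -/
theorem mellin_cesaroError {w : ℂ} (hw : 3 < w.re) :
    MeasureTheory.IntegrableOn (fun x : ℝ => (cesaroError x : ℂ) * (x : ℂ) ^ (-w - 1))
      (Set.Ioi 1) ∧
    ∫ x in Set.Ioi (1 : ℝ), (cesaroError x : ℂ) * (x : ℂ) ^ (-w - 1) =
      2 * twinPrimeConst * 2 ^ (1 - w) * (riemannZeta (w - 1) *
        (riemannZeta w * correctionProduct w / riemannZeta (2 * w))) / (w * (w - 1)) -
      (1 / 2 * (1 / (w - 2)) - 1 / 2 * (1 / (w - 1) ^ 2) + linearCoeff * (1 / (w - 1))) := by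
  have r2 : (0 : ℝ) < (w - 2).re := by simp; linarith
  have r1 : (0 : ℝ) < (w - 1).re := by simp; linarith
  have i0 := integrableOn_cesaroMean hw
  have i1 : MeasureTheory.IntegrableOn (fun x : ℝ => 1 / 2 * (x : ℂ) ^ (-(w - 2) - 1))
      (Set.Ioi 1) := (integrableOn_cpow_Ioi_one (by simp; linarith)).const_mul _
  have i2 : MeasureTheory.IntegrableOn
      (fun x : ℝ => 1 / 2 * ((Real.log x : ℂ) * (x : ℂ) ^ (-(w - 1) - 1)))
      (Set.Ioi 1) := (integrableOn_log_mul_cpow r1).const_mul _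
  have i3 : MeasureTheory.IntegrableOn (fun x : ℝ => (linearCoeff : ℂ) * (x : ℂ) ^ (-(w - 1) - 1))
      (Set.Ioi 1) := (integrableOn_cpow_Ioi_one (by simp; linarith)).const_mul _
  have i12 : MeasureTheory.IntegrableOn (fun x : ℝ => 1 / 2 * (x : ℂ) ^ (-(w - 2) - 1) -
      1 / 2 * ((Real.log x : ℂ) * (x : ℂ) ^ (-(w - 1) - 1))) (Set.Ioi 1) := i1.sub i2
  have i123 : MeasureTheory.IntegrableOn (fun x : ℝ => 1 / 2 * (x : ℂ) ^ (-(w - 2) - 1) -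
      1 / 2 * ((Real.log x : ℂ) * (x : ℂ) ^ (-(w - 1) - 1)) +
      (linearCoeff : ℂ) * (x : ℂ) ^ (-(w - 1) - 1)) (Set.Ioi 1) := i12.add i3
  have hcongr : Set.EqOn (fun x : ℝ => (cesaroMean x : ℂ) * (x : ℂ) ^ (-w - 1) -
      (1 / 2 * (x : ℂ) ^ (-(w - 2) - 1) - 1 / 2 * ((Real.log x : ℂ) * (x : ℂ) ^ (-(w - 1) - 1)) +
        (linearCoeff : ℂ) * (x : ℂ) ^ (-(w - 1) - 1)))
      (fun x : ℝ => (cesaroError x : ℂ) * (x : ℂ) ^ (-w - 1)) (Set.Ioi 1) := by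
    intro x hx
    have hx0 : (x : ℂ) ≠ 0 := by exact_mod_cast (one_pos.trans hx).ne'
    have e1 : (x : ℂ) ^ (-(w - 2) - 1) = (x : ℂ) ^ 2 * (x : ℂ) ^ (-w - 1) := by
      rw [← Complex.cpow_ofNat, ← Complex.cpow_add _ _ hx0]; congr 1; ring
    have e2 : (x : ℂ) ^ (-(w - 1) - 1) = (x : ℂ) * (x : ℂ) ^ (-w - 1) := by
      rw [show -(w - 1) - 1 = 1 + (-w - 1) by ring, Complex.cpow_add _ _ hx0, Complex.cpow_one]
    simp only
    rw [e1, e2, cesaroError]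
    simp only [linearCoeff]
    push_cast
    ring
  refine ⟨(MeasureTheory.IntegrableOn.congr_fun (i0.sub i123) hcongr measurableSet_Ioi), ?_⟩
  rw [← MeasureTheory.setIntegral_congr_fun measurableSet_Ioi hcongr,
    MeasureTheory.integral_sub i0 i123, MeasureTheory.integral_add i12 i3,
    MeasureTheory.integral_sub i1 i2, MeasureTheory.integral_const_mul,
    MeasureTheory.integral_const_mul, MeasureTheory.integral_const_mul, mellin_cesaroMean hw,
    integral_cpow_Ioi_one r2, integral_cpow_Ioi_one r1, integral_log_mul_cpow r1]

/-! ### Analytic continuation of the transform -/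

theorem riemannZeta₁_eq {s : ℂ} (hs : s ≠ 1) : riemannZeta₁ s = (s - 1) * riemannZeta s := by
  rw [riemannZeta_eq_inv_sub_mul hs, mul_inv_cancel_left₀ (sub_ne_zero.2 hs)]

theorem hasDerivAt_riemannZeta₁_zero :
    HasDerivAt riemannZeta₁ (-(1 / 2) + Real.log (2 * Real.pi) / 2) 0 := by
  have h1 : HasDerivAt riemannZeta (-Real.log (2 * Real.pi) / 2 : ℂ) 0 := by
    have := (differentiableAt_riemannZeta zero_ne_one).hasDerivAt
    rw [deriv_riemannZeta_zero] at this
    refine this.congr_deriv ?_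
    rw [Complex.ofReal_log (by positivity)]
    push_cast
    rfl
  have h2 : HasDerivAt (fun s : ℂ => (s - 1) * riemannZeta s)
      (-(1 / 2) + Real.log (2 * Real.pi) / 2 : ℂ) 0 := by
    refine (((hasDerivAt_id (0 : ℂ)).sub_const 1).mul h1).congr_deriv ?_
    rw [riemannZeta_zero]
    simp only [id]
    ring
  refine h2.congr_of_eventuallyEq ?_
  filter_upwards [isOpen_ne.mem_nhds (zero_ne_one (α := ℂ))] with s hs using riemannZeta₁_eq hs

theorem riemannZeta₁_zero : riemannZeta₁ 0 = 1 / 2 := by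
  rw [riemannZeta₁_eq zero_ne_one, riemannZeta_zero]; norm_num

/-- The part of the numerator of the transform coming from the Dirichlet series, with the poles of
the zeta factors cleared. -/
noncomputable def mellinNumer (w : ℂ) : ℂ :=
  2 * twinPrimeConst * 2 ^ (1 - w) * riemannZeta₁ (w - 1) * riemannZeta₁ w * (2 * w - 1) *
    correctionProduct w / w

/-- The numerator of the transform of the main term over the denominator `(w - 2) (w - 1) ^ 2`. -/
noncomputable def polarPart (w : ℂ) : ℂ :=
  1 / 2 * (w - 1) ^ 2 - 1 / 2 * (w - 2) + linearCoeff * ((w - 1) * (w - 2))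

/-- The numerator of the transform of the error term over the denominator
`(2w - 1) ζ(2w) (w - 2) (w - 1) ^ 2`. -/
noncomputable def errorNumer (w : ℂ) : ℂ :=
  mellinNumer w - riemannZeta₁ (2 * w) * polarPart w

theorem isOpen_re_pos : IsOpen {w : ℂ | 0 < w.re} :=
  isOpen_lt continuous_const Complex.continuous_re

theorem differentiable_two_cpow : Differentiable ℂ fun w : ℂ => (2 : ℂ) ^ (1 - w) := fun _ =>
  ((differentiableAt_const 1).sub differentiableAt_id).const_cpow (Or.inl two_ne_zero)

theorem differentiableOn_errorNumer : DifferentiableOn ℂ errorNumer {w | 0 < w.re} := by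
  intro w hw
  have hQ := differentiableOn_correctionProduct.differentiableAt (isOpen_re_pos.mem_nhds hw)
  have hw0 : w ≠ 0 := by rintro rfl; simp at hw
  have hZ := differentiable_riemannZeta₁
  have h1 : DifferentiableAt ℂ (fun w => riemannZeta₁ (w - 1)) w :=
    (hZ.comp (differentiable_id.sub_const 1)) w
  have h2 : DifferentiableAt ℂ (fun w => riemannZeta₁ (2 * w)) w :=
    (hZ.comp (differentiable_id.const_mul 2)) w
  have h3 := differentiable_two_cpow w
  have h4 := hZ w
  refine DifferentiableAt.differentiableWithinAt ?_
  refine DifferentiableAt.sub (DifferentiableAt.div ?_ differentiableAt_id hw0)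
    (h2.mul ?_)
  · fun_prop
  · unfold polarPart
    fun_prop

theorem errorNumer_two : errorNumer 2 = 0 := by
  have h := twinPrimeConst_mul_at_two
  have hz2 : riemannZeta 2 ≠ 0 := riemannZeta_ne_zero_of_one_lt_re (by simp)
  have hz4 : riemannZeta (2 * 2) ≠ 0 := riemannZeta_ne_zero_of_one_lt_re (by norm_num)
  have e1 : (2 : ℂ) - 1 = 1 := by norm_num
  have e2 : (1 : ℂ) - 2 = -1 := by norm_num
  rw [errorNumer, mellinNumer, polarPart, e1, e2, riemannZeta₁_one,
    riemannZeta₁_eq (s := 2) (by norm_num), riemannZeta₁_eq (s := 2 * 2) (by norm_num),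
    Complex.cpow_neg_one]
  generalize riemannZeta (2 * 2) = z4 at *
  field_simp at h
  linear_combination 3 / 2 * h

/-- Near `w = 1` the numerator is `(2w - 1) ζ(2w)` times a function with a double zero. -/
theorem hasDerivAt_errorNumer_one : errorNumer 1 = 0 ∧ HasDerivAt errorNumer 0 1 := by
  have hone := twinPrimeConst_mul_at_one
  set W : ℂ → ℂ := fun w => 2 * twinPrimeConst * 2 ^ (1 - w) *
    (correctionProduct w / riemannZeta (2 * w)) with hWdef
  set R : ℂ → ℂ := fun w => W w * riemannZeta₁ (w - 1) * riemannZeta₁ w / w - polarPart w with hRdef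
  have hW1 : W 1 = 1 := by
    simp only [hWdef]
    rw [sub_self, Complex.cpow_zero, mul_one, hone]
  have hW : HasDerivAt W 0 1 := by
    have h2 : HasDerivAt (fun w : ℂ => (2 : ℂ) ^ (1 - w)) (-Real.log 2 : ℂ) 1 := by
      have := ((hasDerivAt_id (1 : ℂ)).const_sub 1).const_cpow (c := 2) (Or.inl two_ne_zero)
      refine this.congr_deriv ?_
      simp
    refine ((h2.const_mul (2 * twinPrimeConst : ℂ)).mul
      hasDerivAt_correctionProduct_div_zeta_one).congr_deriv ?_
    rw [sub_self, Complex.cpow_zero]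
    ring
  have hZ0 : HasDerivAt (fun w : ℂ => riemannZeta₁ (w - 1))
      (-(1 / 2) + Real.log (2 * Real.pi) / 2) 1 := by
    have h0 := hasDerivAt_riemannZeta₁_zero
    rw [← sub_self (1 : ℂ)] at h0
    exact h0.comp_sub_const 1 1
  have hZ1 : HasDerivAt riemannZeta₁ (Real.eulerMascheroniConstant : ℂ) 1 := by
    rw [← deriv_riemannZeta₁_one]
    exact (differentiable_riemannZeta₁ 1).hasDerivAt
  have hP : HasDerivAt polarPart (-(1 / 2) - linearCoeff) 1 := by
    have a1 : HasDerivAt (fun w : ℂ => w - 1) 1 1 := (hasDerivAt_id (1 : ℂ)).sub_const 1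
    have a2 : HasDerivAt (fun w : ℂ => w - 2) 1 1 := (hasDerivAt_id (1 : ℂ)).sub_const 2
    refine ((((a1.pow 2).const_mul (1 / 2 : ℂ)).sub (a2.const_mul (1 / 2 : ℂ))).add
      ((a1.mul a2).const_mul (linearCoeff : ℂ))).congr_deriv ?_
    norm_num
    ring
  have hR1 : R 1 = 0 := by
    simp only [hRdef, polarPart]
    rw [hW1, sub_self, riemannZeta₁_zero, riemannZeta₁_one]
    norm_num
  have hR : HasDerivAt R 0 1 := by
    refine ((((hW.mul hZ0).mul hZ1).div (hasDerivAt_id 1) one_ne_zero).sub hP).congr_deriv ?_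
    simp only [id, linearCoeff, Pi.mul_apply]
    rw [hW1, sub_self, riemannZeta₁_zero, riemannZeta₁_one]
    push_cast
    ring
  have hEq : ∀ w ∈ {w : ℂ | 3 / 4 < w.re}, errorNumer w = riemannZeta₁ (2 * w) * R w := by
    intro w hw
    have hw' : 3 / 4 < w.re := hw
    have hz : riemannZeta (2 * w) ≠ 0 := riemannZeta_ne_zero_of_one_lt_re (by simp; linarith)
    have hw1 : 2 * w ≠ 1 := by
      intro h
      have := congrArg Complex.re h
      simp at this
      linarith
    simp only [errorNumer, mellinNumer, hRdef, hWdef]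
    rw [riemannZeta₁_eq hw1]
    field_simp
  have hmem : {w : ℂ | 3 / 4 < w.re} ∈ nhds (1 : ℂ) :=
    (isOpen_lt continuous_const Complex.continuous_re).mem_nhds (by simp; norm_num)
  refine ⟨by rw [hEq 1 (mem_of_mem_nhds hmem), hR1, mul_zero], ?_⟩
  have hZ2 : HasDerivAt (fun w : ℂ => riemannZeta₁ (2 * w)) (deriv (fun w : ℂ =>
      riemannZeta₁ (2 * w)) 1) 1 :=
    ((differentiable_riemannZeta₁.comp (differentiable_id.const_mul 2)) 1).hasDerivAt
  refine ((hZ2.mul hR).congr_deriv (f' := _) (g' := 0) ?_).congr_of_eventuallyEq ?_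
  · rw [hR1]; ring
  · filter_upwards [hmem] with w hw using hEq w hw

/-- There is a holomorphic function on `0 < re w` continuing `(2w - 1) ζ(2w)` times the Mellin
transform of the error term. -/
theorem exists_continuation_mellin_cesaroError :
    ∃ D : ℂ → ℂ, DifferentiableOn ℂ D {w | 0 < w.re} ∧
      (∀ w : ℂ, errorNumer w = (w - 2) * (w - 1) ^ 2 * D w) ∧
      ∀ w : ℂ, 3 < w.re → riemannZeta₁ (2 * w) *
        ∫ x in Set.Ioi (1 : ℝ), (cesaroError x : ℂ) * (x : ℂ) ^ (-w - 1) = D w := by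
  obtain ⟨h1, h1'⟩ := hasDerivAt_errorNumer_one
  have m2 : {w : ℂ | 0 < w.re} ∈ nhds (2 : ℂ) := isOpen_re_pos.mem_nhds (by simp)
  have m1 : {w : ℂ | 0 < w.re} ∈ nhds (1 : ℂ) := isOpen_re_pos.mem_nhds (by simp)
  set A := dslope errorNumer 1 with hA
  set B := dslope A 1 with hB
  have eA : ∀ w, (w - 1) * A w = errorNumer w := fun w => sub_smul_dslope_of_zero h1 w
  have eB : ∀ w, (w - 1) * B w = A w := fun w =>
    sub_smul_dslope_of_zero (by rw [hA, dslope_same, h1'.deriv]) w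
  have hB2 : B 2 = 0 := by
    have h3 := eA 2
    rw [← eB 2, errorNumer_two] at h3
    norm_num at h3
    exact h3
  have eC : ∀ w, (w - 2) * dslope B 2 w = B w := fun w => sub_smul_dslope_of_zero hB2 w
  have hfac : ∀ w : ℂ, errorNumer w = (w - 2) * (w - 1) ^ 2 * dslope B 2 w := fun w => by
    rw [← eA, ← eB, ← eC]; ring
  refine ⟨dslope B 2, ?_, hfac, fun w hw => ?_⟩
  · exact (Complex.differentiableOn_dslope m2).2 ((Complex.differentiableOn_dslope m1).2
      ((Complex.differentiableOn_dslope m1).2 differentiableOn_errorNumer))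
  · have hne : ∀ c : ℝ, c ≤ 3 → w ≠ (c : ℂ) := by
      rintro c hc rfl
      simp at hw
      linarith
    have n0 : w ≠ 0 := by simpa using hne 0 (by norm_num)
    have n1 : w ≠ 1 := by simpa using hne 1 (by norm_num)
    have n2 : w ≠ 2 := by simpa using hne 2 (by norm_num)
    have n3 : w - 1 ≠ 1 := fun h => n2 (by linear_combination h)
    have n4 : 2 * w ≠ 1 := fun h => hne (1 / 2) (by norm_num) (by push_cast; linear_combination h / 2)
    have z2 : riemannZeta (2 * w) ≠ 0 := riemannZeta_ne_zero_of_one_lt_re (by simp; linarith)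
    have s1 := sub_ne_zero.2 n1
    have s2 := sub_ne_zero.2 n2
    have key := hfac w
    rw [errorNumer, mellinNumer, polarPart, riemannZeta₁_eq n3, riemannZeta₁_eq n1] at key
    rw [(mellin_cesaroError hw).2]
    have hcancel : (w - 2) * (w - 1) ^ 2 ≠ 0 := mul_ne_zero s2 (pow_ne_zero _ s1)
    apply mul_left_cancel₀ hcancel
    rw [← key, riemannZeta₁_eq n4]
    generalize riemannZeta (2 * w) = z at *
    field_simp
    ring

/-! ### Propagation of zeros and conclusion -/

/-- For rational exponents the absolute values on the two sides of `p ^ w = -p / (p - 2)` differ,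
since `p` and `p - 2` have no common prime factor. -/
theorem one_add_correctionTerm_ne_zero {w : ℂ} {q : ℚ} (hq : w.re = q) (h0 : 0 < w.re)
    (h1 : w.re < 1) (p : Nat.Primes) : 1 + correctionTerm p w ≠ 0 := by
  have hden := natCast_cpow_add_one_ne_zero p.2.two_le h0
  intro h
  rw [correctionTerm] at h
  have h2 : ((p : ℕ) : ℂ) ^ w = -(1 + (eulerCoeff p : ℂ)) := by
    field_simp at h
    linear_combination h
  rcases p.2.two_le.eq_or_lt with hp | hp
  · rw [← hp, eulerCoeff_two] at h2
    simp at h2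
  · have hp3 : (3 : ℝ) ≤ (p : ℕ) := by exact_mod_cast hp
    have hp0 : (0 : ℝ) < (p : ℕ) := by linarith
    have hp2 : (0 : ℝ) < (p : ℕ) - 2 := by linarith
    have h3 := congrArg norm h2
    rw [norm_natCast_cpow p.2.pos, norm_neg, eulerCoeff_of_two_lt hp, ← Complex.ofReal_one,
      ← Complex.ofReal_add, Complex.norm_real, Real.norm_of_nonneg (by positivity)] at h3
    -- the equation of absolute values reads `p ^ (1 - re w) = p - 2`
    have h4 : ((p : ℕ) : ℝ) ^ (((1 - q : ℚ)) : ℝ) = ((p : ℕ) - 2 : ℕ) := by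
      rw [Nat.cast_sub p.2.two_le]
      push_cast
      rw [← hq, Real.rpow_sub hp0, Real.rpow_one, h3]
      field_simp
      ring
    set r : ℚ := 1 - q with hr
    have hr0 : 0 < r := by
      have : (q : ℝ) < 1 := hq ▸ h1
      have : q < 1 := by exact_mod_cast this
      linarith
    have hnum : 0 < r.num := Rat.num_pos.2 hr0
    have hrm : (r : ℝ) * (r.den : ℝ) = (r.num.toNat : ℕ) := by
      have e : ((r.num.toNat : ℕ) : ℚ) = r.num := by
        exact_mod_cast Int.toNat_of_nonneg hnum.le
      have e2 : r * r.den = (r.num.toNat : ℕ) := by rw [e, Rat.mul_den_eq_num]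
      exact_mod_cast e2
    have h5 : (p : ℕ) ^ r.num.toNat = ((p : ℕ) - 2) ^ r.den := by
      have h6 : (((p : ℕ) : ℝ) ^ (r : ℝ)) ^ r.den = (((p : ℕ) - 2 : ℕ) : ℝ) ^ r.den := by rw [h4]
      rw [← Real.rpow_mul_natCast hp0.le, hrm, Real.rpow_natCast] at h6
      exact_mod_cast h6
    have hdvd : (p : ℕ) ∣ (p : ℕ) - 2 :=
      p.2.dvd_of_dvd_pow (h5 ▸ dvd_pow_self _ (by omega))
    have := Nat.le_of_dvd (by omega) hdvd
    omega

theorem riemannZeta_one_sub_eq_zero {s : ℂ} (hs : s.im ≠ 0) (h : riemannZeta s = 0) :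
    riemannZeta (1 - s) = 0 := by
  rw [riemannZeta_one_sub (fun n hn => hs (by simp [hn])) (fun h1 => hs (by simp [h1])), h, mul_zero]

/-- Off the real axis, the zeta function has no zeros with negative real part. -/
theorem riemannZeta_ne_zero_of_re_neg {s : ℂ} (hs : s.re < 0) (him : s.im ≠ 0) :
    riemannZeta s ≠ 0 := fun h =>
  riemannZeta_ne_zero_of_one_lt_re (s := 1 - s) (by simp; linarith)
    (riemannZeta_one_sub_eq_zero him h)

theorem twinPrimeConst_ne_zero : (twinPrimeConst : ℂ) ≠ 0 := by
  intro h
  have := twinPrimeConst_mul_at_two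
  rw [h, zero_mul] at this
  exact zero_ne_one this

/-- A zero `ρ` of zeta at which the numerator of the transform also vanishes forces a zero at
`1 - ρ / 2`. -/
theorem riemannZeta_one_sub_half_eq_zero {ρ : ℂ} {q : ℚ} (hq : ρ.re = q) (h0 : 0 < ρ.re)
    (h1 : ρ.re < 2) (him : ρ.im ≠ 0) (hζ : riemannZeta ρ = 0) (hN : errorNumer (ρ / 2) = 0) :
    riemannZeta (1 - ρ / 2) = 0 := by
  set w : ℂ := ρ / 2 with hw
  have hρ : 2 * w = ρ := by rw [hw]; ring
  have hre : w.re = ρ.re / 2 := by rw [hw]; simp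
  have him' : w.im ≠ 0 := by
    have : w.im = ρ.im / 2 := by rw [hw]; simp
    rw [this]
    exact div_ne_zero him two_ne_zero
  have hne : ∀ c : ℝ, w ≠ c := fun c h => him' (by rw [h]; simp)
  have n0 : w ≠ 0 := by simpa using hne 0
  have n1 : w ≠ 1 := by simpa using hne 1
  have n2 : w - 1 ≠ 1 := fun h => hne 2 (by push_cast; linear_combination h)
  have n3 : 2 * w - 1 ≠ 0 := fun h => hne (1 / 2) (by push_cast; linear_combination h / 2)
  have hρ1 : ρ ≠ 1 := by rw [← hρ]; exact fun h => n3 (by rw [h, sub_self])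
  have hz : riemannZeta₁ (w - 1) ≠ 0 := by
    rw [riemannZeta₁_eq n2]
    refine mul_ne_zero (sub_ne_zero.2 n2) (riemannZeta_ne_zero_of_re_neg ?_ ?_)
    · simp; linarith
    · simpa using him'
  have hQ : correctionProduct w ≠ 0 := correctionProduct_ne_zero (by linarith)
    (one_add_correctionTerm_ne_zero (q := q / 2) (by rw [hre, hq]; push_cast; ring)
      (by linarith) (by linarith))
  have h2 : (2 : ℂ) ^ (1 - w) ≠ 0 := by simp [Complex.cpow_eq_zero_iff]
  rw [errorNumer, hρ, riemannZeta₁_eq hρ1, hζ, mul_zero, zero_mul, sub_zero, mellinNumer] at hN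
  refine riemannZeta_one_sub_eq_zero him' ?_
  have : riemannZeta₁ w = 0 := by
    simpa [n0, hz, hQ, h2, n3, Complex.ofReal_ne_zero.1 twinPrimeConst_ne_zero] using hN
  rw [riemannZeta₁_eq n1] at this
  exact (mul_eq_zero.1 this).resolve_left (sub_ne_zero.2 n1)

/-- The zeros of `ζ(2w)` with `1 / 4 ≤ re w` are not all zeros of `errorNumer`: otherwise iterating
`ρ ↦ 1 - ρ / 2` from a critical zero produces zeros of zeta tending to the fixed point `2 / 3`,
where zeta does not vanish. -/
theorem exists_errorNumer_ne_zero :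
    ∃ w : ℂ, 1 / 4 ≤ w.re ∧ riemannZeta₁ (2 * w) = 0 ∧ errorNumer w ≠ 0 := by
  by_contra! hall
  obtain ⟨t, ht, hζ⟩ := exists_riemannZeta_half_add_eq_zero
  set ρ : ℕ → ℂ := fun n => 2 / 3 + (-(1 / 2)) ^ n * ((1 / 2 + t * Complex.I) - 2 / 3) with hρ
  have hsucc : ∀ n, ρ (n + 1) = 1 - ρ n / 2 := fun n => by
    simp only [hρ]; ring
  have hzero : ∀ n, riemannZeta (ρ n) = 0 ∧ (ρ n).im ≠ 0 ∧ 1 / 2 ≤ (ρ n).re ∧ (ρ n).re ≤ 3 / 4 ∧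
      ∃ q : ℚ, (ρ n).re = q := by
    intro n
    induction n with
    | zero =>
      have e : ρ 0 = 1 / 2 + t * Complex.I := by simp only [hρ]; ring
      have ere : (ρ 0).re = 1 / 2 := by rw [e]; simp
      have eim : (ρ 0).im = t := by rw [e]; simp
      refine ⟨by rw [e]; exact hζ, by rw [eim]; exact ht, ere.ge, by rw [ere]; norm_num, 1 / 2, ?_⟩
      rw [ere]; norm_num
    | succ n ih =>
      obtain ⟨hz, him, hl, hu, q, hq⟩ := ih
      have hne1 : ρ n ≠ 1 := fun h => him (by rw [h]; simp)
      have ere : (ρ (n + 1)).re = 1 - (ρ n).re / 2 := by rw [hsucc]; simp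
      have eim : (ρ (n + 1)).im = -((ρ n).im / 2) := by rw [hsucc]; simp
      refine ⟨?_, ?_, by linarith, by linarith, 1 - q / 2, ?_⟩
      · rw [hsucc]
        refine riemannZeta_one_sub_half_eq_zero hq (by linarith) (by linarith) him hz (hall _ ?_ ?_)
        · simp; linarith
        · rw [mul_div_cancel₀ _ two_ne_zero, riemannZeta₁_eq hne1, hz, mul_zero]
      · rw [eim]
        exact neg_ne_zero.2 (div_ne_zero him two_ne_zero)
      · rw [ere, hq]; push_cast; ring
  have hlim : Tendsto ρ atTop (nhds (2 / 3)) := by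
    have h1 : Tendsto (fun n : ℕ => (-(1 / 2) : ℂ) ^ n) atTop (nhds 0) :=
      tendsto_pow_atTop_nhds_zero_of_norm_lt_one (by norm_num)
    have := (h1.mul_const ((1 / 2 + t * Complex.I) - 2 / 3)).const_add (2 / 3 : ℂ)
    rwa [zero_mul, add_zero] at this
  have hcont : Tendsto (fun n => riemannZeta (ρ n)) atTop (nhds (riemannZeta (2 / 3))) :=
    (differentiableAt_riemannZeta (by norm_num)).continuousAt.tendsto.comp hlim
  simp only [fun n => (hzero n).1] at hcont
  have h23 := tendsto_nhds_unique hcont tendsto_const_nhds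
  refine riemannZeta_ofReal_ne_zero (σ := 2 / 3) (by norm_num) (by norm_num) ?_
  push_cast
  exact h23

theorem riemannZeta₁_two_mul_ofReal_ne_zero {σ : ℝ} (hσ : 0 < σ) :
    riemannZeta₁ (2 * (σ : ℂ)) ≠ 0 := by
  rcases lt_trichotomy (2 * σ) 1 with h | h | h
  · have hne : (2 * (σ : ℂ)) ≠ 1 := by exact_mod_cast h.ne
    rw [riemannZeta₁_eq hne]
    refine mul_ne_zero (sub_ne_zero.2 hne) ?_
    have := riemannZeta_ofReal_ne_zero (σ := 2 * σ) (by linarith) h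
    rwa [Complex.ofReal_mul, Complex.ofReal_ofNat] at this
  · have : (2 * (σ : ℂ)) = 1 := by exact_mod_cast h
    rw [this, riemannZeta₁_one]
    exact one_ne_zero
  · have hne : (2 * (σ : ℂ)) ≠ 1 := by exact_mod_cast h.ne'
    rw [riemannZeta₁_eq hne]
    exact mul_ne_zero (sub_ne_zero.2 hne) (riemannZeta_ne_zero_of_one_lt_re (by simpa using h))

/-- Neither the error term (`ε = 1`) nor its negative (`ε = -1`) is bounded above by
`o(x ^ (1 / 4))`. -/
theorem not_forall_eventually_mul_cesaroError_le {ε : ℝ} (hε : ε ≠ 0) :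
    ¬ ∀ c : ℝ, 0 < c → ∀ᶠ x in atTop, ε * cesaroError x ≤ c * x ^ (1 / 4 : ℝ) := by
  intro hle
  obtain ⟨D, hD, hfac, hmel⟩ := exists_continuation_mellin_cesaroError
  obtain ⟨w₀, hw₀, hz₀, hne⟩ := exists_errorNumer_ne_zero
  have hcast : ∀ (w : ℂ) (x : ℝ), ((ε * cesaroError x : ℝ) : ℂ) * (x : ℂ) ^ (-w - 1) =
      ε * ((cesaroError x : ℂ) * (x : ℂ) ^ (-w - 1)) := fun w x => by push_cast; ring
  have key := eq_zero_of_forall_eventually_le (E := fun x => ε * cesaroError x)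
    (measurable_cesaroError.const_mul ε)
    (fun Y => by
      obtain ⟨C, hC⟩ := exists_abs_cesaroError_le Y
      refine ⟨|ε| * C, fun x hx => ?_⟩
      rw [abs_mul]
      exact mul_le_mul_of_nonneg_left (hC x hx) (abs_nonneg ε))
    (θ := 1 / 4) (b := 3) (by norm_num) (by norm_num)
    (fun w hw => by
      simp only [hcast]
      exact (mellin_cesaroError hw).1.const_mul _)
    (Z := fun w => riemannZeta₁ (2 * w)) (D := fun w => ε * D w)
    (differentiable_riemannZeta₁.comp (differentiable_id.const_mul 2)).differentiableOn
    (hD.const_mul _)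
    (fun σ hσ => riemannZeta₁_two_mul_ofReal_ne_zero (by linarith))
    (fun w hw => by
      simp only [hcast]
      rw [MeasureTheory.integral_const_mul, ← hmel w hw]
      ring)
    hle hw₀ hz₀
  have hD0 : D w₀ = 0 := (mul_eq_zero.1 key).resolve_left (by exact_mod_cast hε)
  exact hne (by rw [hfac, hD0, mul_zero])

theorem theorem1 : IsOmegaPlusMinus cesaroError (fun x : ℝ => x ^ (1 / 4 : ℝ)) := by
  constructor
  · by_contra! hlim
    refine not_forall_eventually_mul_cesaroError_le one_ne_zero fun c hc => ?_
    have hlt := eventually_lt_of_limsup_lt (hlim.trans_lt (EReal.coe_pos.2 hc))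
    filter_upwards [hlt, eventually_gt_atTop 0] with x hx hx0
    have hpow : (0 : ℝ) < x ^ (1 / 4 : ℝ) := Real.rpow_pos_of_pos hx0 _
    rw [one_mul]
    exact ((div_lt_iff₀ hpow).1 (EReal.coe_lt_coe_iff.1 hx)).le
  · by_contra! hlim
    refine not_forall_eventually_mul_cesaroError_le (neg_ne_zero.2 one_ne_zero) fun c hc => ?_
    have hneg : ((-c : ℝ) : EReal) < 0 := EReal.coe_neg'.2 (neg_lt_zero.2 hc)
    have hlt := eventually_lt_of_lt_liminf (hneg.trans_le hlim)
    filter_upwards [hlt, eventually_gt_atTop 0] with x hx hx0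
    have hpow : (0 : ℝ) < x ^ (1 / 4 : ℝ) := Real.rpow_pos_of_pos hx0 _
    have := (lt_div_iff₀ hpow).1 (EReal.coe_lt_coe_iff.1 hx)
    linarith
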